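/- Let $n,\mathbf p,k,l$ be integers with $1<\mathbf p\le n$ and $0\le l<k\le N:=\binom n{\mathbf p}$, and let $b,q\in\mathbb R$. For $\kappa\in\mathbb R^n$ let $\Lambda(\kappa)\in\mathbb R^N$ be the vector of all sums $\kappa_{i_1}+\dots+\kappa_{i_{\mathbf p}}$, $1\le i_1<\dots<i_{\mathbf p}\le n$, and let $\sigma_j$ be the $j$-th elementary symmetric function of $N$ variables ($\sigma_0=1$). Let $M=\{\rho(x)x:x\in\mathbb S^n\}\subset\mathbb R^{n+1}$, with $\rho\in C^2(\mathbb S^n)$ positive, be a closed star-shaped hypersurface with outer unit normal $\nu$ and principal curvatures $\kappa=(\kappa_1,\dots,\kappa_n)$ (with the sign for which round spheres have positive curvatures). Suppose that $M$ is $(\mathbf p,k)$-convex, that is, $\sigma_j(\Lambda(\kappa))>0$ on $M$ for all $1\le j\le k$. Let $f\in C^2(\mathbb S^n)$ be positive, and let $\nabla$ and $|\cdot|$ on $\mathbb S^n$ refer to the round metric. (1) Suppose $-b-q-k+l>0$ and $$\frac{\sigma_k}{\sigma_l}(\Lambda(\kappa))=f\Big(\frac X{|X|}\Big)|X|^b\langle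 X,\nu\rangle^q,\qquad X\in M.$$ Then $$\max_{\mathbb S^n}|\nabla\log\rho|\le C\qquad\text{and}\qquad 1\le\frac{\max_{\mathbb S^n}\rho}{\min_{\mathbb S^n}\rho}\le e^C,$$ where $C$ depends only on $b,q,\mathbf p,k,l$ and $\max_{\mathbb S^n}\frac{|\nabla f|}f$. (2) Suppose $-b-q-k+l=0$, let $\varepsilon>0$, and suppose $$\frac{\sigma_k}{\sigma_l}(\Lambda(\kappa))=f\Big(\frac X{|X|}\Big)|X|^{b-\varepsilon}\langle X,\nu\rangle^q,\qquad X\in M.$$ Suppose also that either $q\ne0$, or $q=0$ and $\frac{|\nabla f|}f<2(k-l)\sqrt{\frac{\mathbf p-1}{\mathbf p}}$ on $\mathbb S^n$. Then the two estimates of (1) hold with a constant $C$ that depends only on $n,k,l,\mathbf p,q$ and $\min_{\mathbb S^n}f$, $\max_{\mathbb S^n}f$, $\max_{\mathbb S^n}\frac{|\nabla f|}f$; in particular, $C$ is independent of $\varepsilon$. -/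

import Mathlib

open scoped Manifold ContDiff RealInnerProductSpace

noncomputable section

namespace StarShaped

/-- The ambient Euclidean space `ℝ^{n+1}`. -/
abbrev Amb (n : ℕ) : Type := EuclideanSpace ℝ (Fin (n + 1))

/-- The unit sphere `𝕊^n ⊂ ℝ^{n+1}`. -/
abbrev Sph (n : ℕ) : Type := Metric.sphere (0 : Amb n) 1

instance instFactFinrankAmb (n : ℕ) : Fact (Module.finrank ℝ (Amb n) = n + 1) :=
  ⟨by simp⟩

variable {n : ℕ}

/-- The function `X ↦ g (X / |X|)` on `ℝ^{n+1} \ {0}` (with the value `0` at the origin). -/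
def radialExt (g : Sph n → ℝ) (X : Amb n) : ℝ :=
  if hX : X ≠ 0 then
    g ⟨‖X‖⁻¹ • X, by
      rw [mem_sphere_zero_iff_norm, norm_smul, norm_inv, norm_norm,
        inv_mul_cancel₀ (norm_ne_zero_iff.mpr hX)]⟩
  else 0

/-- `g ∈ C²(𝕊^n)`. -/
def IsC2 (g : Sph n → ℝ) : Prop := ContMDiff (𝓡 n) 𝓘(ℝ, ℝ) 2 g

/-- The gradient `∇g` at `x ∈ 𝕊^n` for the round metric, as a vector of `ℝ^{n+1}` tangent to the
sphere at `x`: it is the Euclidean gradient at `x` of `X ↦ g (X / |X|)`, a function that is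
constant in the radial direction. -/
def sphGrad (g : Sph n → ℝ) (x : Sph n) : Amb n := gradient (radialExt g) (x : Amb n)

/-- The hypersurface `M = {ρ(x) x : x ∈ 𝕊^n}`. -/
def radialGraph (ρ : Sph n → ℝ) : Set (Amb n) := Set.range fun x : Sph n => ρ x • (x : Amb n)

/-- The function `|X| / ρ (X / |X|)`. For `ρ > 0` it is `1` on `M`, less than `1` on the domain
enclosed by `M`, and greater than `1` outside. -/
def levelFun (ρ : Sph n → ℝ) (X : Amb n) : ℝ := ‖X‖ / radialExt ρ X

/-- The outer unit normal `ν` of `M` at its points `X`, as the normalized gradient of `levelFun`;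
the same formula extends `ν` to a unit vector field on `ℝ^{n+1} \ {0}`. -/
def outerNormal (ρ : Sph n → ℝ) (X : Amb n) : Amb n :=
  ‖gradient (levelFun ρ) X‖⁻¹ • gradient (levelFun ρ) X

/-- The tangent space of `M` at `X`, the orthogonal complement of `ν(X)`. -/
def tangentPlane (ρ : Sph n → ℝ) (X : Amb n) : Submodule ℝ (Amb n) :=
  (Submodule.span ℝ {outerNormal ρ X})ᗮ

/-- The Weingarten map `v ↦ D_v ν` of `M` at `X`, an endomorphism of the tangent space of `M`
at `X`. With respect to the induced metric it represents the second fundamental form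
`h(v, w) = ⟨D_v ν, w⟩`, i.e. `h_{ij} = -⟨∂_i ∂_j X, ν⟩`. (Since `|ν| = 1`, the vector `D_v ν` is
already tangent to `M`; the orthogonal projection only adjusts the codomain.) -/
def weingarten (ρ : Sph n → ℝ) (X : Amb n) : tangentPlane ρ X →ₗ[ℝ] tangentPlane ρ X :=
  (tangentPlane ρ X).orthogonalProjectionOnto.toLinearMap ∘ₗ
    (fderiv ℝ (outerNormal ρ) X).toLinearMap ∘ₗ (tangentPlane ρ X).subtype

/-- The principal curvatures `κ(X)` of `M` at `X`: the roots of `det (h_{ij} - κ g_{ij}) = 0`,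
i.e. the eigenvalues of the Weingarten map, counted with multiplicity. -/
def principalCurvatures (ρ : Sph n → ℝ) (X : Amb n) : Multiset ℝ :=
  (weingarten ρ X).charpoly.roots

/-- The family `Λ(κ)` of all sums `κ_{i_1} + ⋯ + κ_{i_p}`, `i_1 < ⋯ < i_p`, for
`κ = (κ_1, …, κ_n)`; it has `N = C(n, p)` entries, counted with multiplicity. -/
def pSums (p : ℕ) (κ : Multiset ℝ) : Multiset ℝ := (κ.powersetCard p).map Multiset.sum

/-- `M = {ρ(x) x : x ∈ 𝕊^n}` is a closed, star-shaped, `(p, k)`-convex hypersurface of class `C²`: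
`ρ` is positive and of class `C²`, and at every point of `M` the vector `Λ(κ)` lies in the Garding
cone, i.e. `σ_j(Λ(κ)) > 0` for `1 ≤ j ≤ k`. -/
structure IsPKConvex (p k : ℕ) (ρ : Sph n → ℝ) : Prop where
  c2 : IsC2 ρ
  pos : ∀ x, 0 < ρ x
  cone : ∀ X ∈ radialGraph ρ, ∀ j : ℕ, 1 ≤ j → j ≤ k →
    0 < (pSums p (principalCurvatures ρ X)).esymm j

/-- The curvature equation `σ_k(Λ(κ)) / σ_l(Λ(κ)) = f(X/|X|) |X|^b ⟨X, ν⟩^q` on `M`. -/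
def SolvesEq (p k l : ℕ) (b q : ℝ) (f ρ : Sph n → ℝ) : Prop :=
  ∀ X ∈ radialGraph ρ,
    (pSums p (principalCurvatures ρ X)).esymm k / (pSums p (principalCurvatures ρ X)).esymm l =
      radialExt f X * ‖X‖ ^ b * ⟪X, outerNormal ρ X⟫ ^ q

/-- The estimates `max |∇ log ρ| ≤ C` and `1 ≤ max ρ / min ρ ≤ e^C` on `𝕊^n`. -/
def GradientBound (C : ℝ) (ρ : Sph n → ℝ) : Prop :=
  (∀ x, ‖sphGrad (fun y => Real.log (ρ y)) x‖ ≤ C) ∧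
    ∃ ρmax ρmin : ℝ, IsGreatest (Set.range ρ) ρmax ∧ IsLeast (Set.range ρ) ρmin ∧
      1 ≤ ρmax / ρmin ∧ ρmax / ρmin ≤ Real.exp C

end StarShaped

end

open scoped Manifold ContDiff RealInnerProductSpace Topology
open Filter

namespace StarShaped

/-! ### Elementary symmetric functions and Newton's inequalities. -/

section ElementarySymmetric

/-! Put v(X) = log(|X| / ρ(X/|X|)) (`logLevel`). Then v(tX) = v(X) + log t, and at unit x one has ∇v
= x - ∇log ρ, so |∇v|² = 1 + |∇log ρ|². On the ray through X the principal curvatures of M are e^v /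
|∇v| times the eigenvalues `curv` of D²v on the complement of ∇v. The equation becomes
log(σ_k/σ_l)(Λ(curv)) = log f + b log|X| + δ v + c log|∇v|² with δ = -b-q-k+l and c = (k-l-q)/2
(`SolvesEq.log_eq`).

Let m > 0 be the maximum of |∇log ρ|, attained at x₀, and let x₁ be the direction of ∇log ρ there.
Differentiating the equation along x₁ would need third derivatives of v, which need not exist.
`LogHomogeneous.variation_le` instead compares v with v ∘ J_t, where J_t = (1 - tS) e^{-tK}, K
rotates x₀ towards x₁, and S is symmetric and acts transversally to both. A barrier Q forces the
maximum points of v ∘ J_t - v - tQ on the sphere to tend to x₀. The first and second order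
conditions there, the monotonicity and rotation invariance of σ_k/σ_l, and division by t give an
inequality that contains only D²v(x₀). For the best S it says (`LogHomogeneous.exists_logDeriv_le`,
`SolvesEq.exists_logDeriv_le`): one eigenvalue is 1, and the derivative of log(σ_k/σ_l) ∘ Λ in the
direction that is 0 for this eigenvalue and ((1-κ_i)² + m²)/m for the others is at most L - δm,
where L = max |∇f|/f.

If δ > 0, that derivative is nonnegative, hence m ≤ L/δ, with no dependence on the dimension.

In case (2) δ equals ε and only δ ≥ 0 is used. Let w_I ≥ 0 be the partial derivatives of
log(σ_k/σ_l) at Λ(κ), U = Σ w_I and Q = Σ_I (Σ_{i∈I} κ_i²) w_I. A set I contains the exceptional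
index at most once, so with D = k-l (`exists_logDeriv_bounds`) Q - 2D + (p + m²(p-1))U ≤ Lm, and D²
≤ pQU by Cauchy-Schwarz. For q = 0 the arithmetic-geometric mean inequality bounds m when L <
2D√((p-1)/p). For q ≠ 0 the size of σ_k/σ_l, which is comparable to (1+m²)^{(D-q)/2}, is used as
well: Newton's inequalities bound U from below when q > 0 and Q from below when q < 0. The
comparison is uniform in ε because e^{δv} is bounded through round spheres at the extrema of ρ
(`SolvesEq.exp_logLevel_bounds`).

The bound on ∇log ρ is integrated along two chords to give the oscillation of log ρ
(`gradientBound_of_isMax`). -/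

theorem esymm_zero' {R : Type*} [CommSemiring R] (s : Multiset R) : s.esymm 0 = 1 := by
  simp [Multiset.esymm]

theorem esymm_cons {R : Type*} [CommSemiring R] (a : R) (s : Multiset R) (j : ℕ) :
    (a ::ₘ s).esymm (j + 1) = s.esymm (j + 1) + a * s.esymm j := by
  simp [Multiset.esymm, Multiset.powersetCard_cons, Multiset.map_map,
    Multiset.sum_map_mul_left]

theorem esymm_eq_zero_of_card_lt {R : Type*} [CommSemiring R] {s : Multiset R} {j : ℕ}
    (h : Multiset.card s < j) : s.esymm j = 0 := by
  simp [Multiset.esymm, Multiset.powersetCard_eq_empty _ h]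

theorem esymm_card {R : Type*} [CommSemiring R] (s : Multiset R) :
    s.esymm (Multiset.card s) = s.prod := by
  induction s using Multiset.induction_on with
  | empty => simp [Multiset.esymm]
  | cons a s ih =>
    rw [Multiset.card_cons, esymm_cons, esymm_eq_zero_of_card_lt (Nat.lt_succ_self _), ih,
      Multiset.prod_cons, zero_add]

theorem esymm_one' {R : Type*} [CommSemiring R] (s : Multiset R) : s.esymm 1 = s.sum := by
  induction s using Multiset.induction_on with
  | empty => rw [esymm_eq_zero_of_card_lt (by simp)]; simp
  | cons a s ih => rw [esymm_cons, ih, esymm_zero', Multiset.sum_cons]; ring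

/-- A product of i reciprocals times the full product is the product over the complementary entries.
This moves the top of the range of σ_j to the bottom. -/
theorem esymm_map_inv_mul_prod {s : Multiset ℝ} (hs : ∀ a ∈ s, a ≠ 0) :
    ∀ {i j : ℕ}, i + j = Multiset.card s →
      (s.map (·⁻¹)).esymm i * s.prod = s.esymm j := by
  induction s using Multiset.induction_on with
  | empty =>
    intro i j h
    obtain ⟨rfl, rfl⟩ : i = 0 ∧ j = 0 := by simpa using h
    simp [Multiset.esymm]
  | cons a s ih =>
    have ha : a ≠ 0 := hs a (Multiset.mem_cons_self a s)
    have hs' : ∀ b ∈ s, b ≠ 0 := fun b hb => hs b (Multiset.mem_cons_of_mem hb)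
    intro i j h
    rw [Multiset.card_cons] at h
    cases i with
    | zero =>
      obtain rfl : j = Multiset.card (a ::ₘ s) := by rw [Multiset.card_cons]; omega
      rw [esymm_zero', esymm_card, one_mul]
    | succ i =>
      cases j with
      | zero =>
        have : i + 1 = Multiset.card ((a ::ₘ s).map (·⁻¹)) := by simp; omega
        rw [this, esymm_card, esymm_zero', Multiset.prod_map_inv', inv_mul_cancel₀]
        rw [Ne, Multiset.prod_eq_zero_iff]
        exact fun h0 => hs 0 h0 rfl
      | succ j =>
        rw [Multiset.map_cons, esymm_cons, esymm_cons, Multiset.prod_cons,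
          ← ih hs' (i := i + 1) (j := j) (by omega), ← ih hs' (i := i) (j := j + 1) (by omega)]
        field_simp
        ring

theorem two_mul_esymm_two (s : Multiset ℝ) :
    2 * s.esymm 2 = s.sum ^ 2 - (s.map (· ^ 2)).sum := by
  induction s using Multiset.induction_on with
  | empty => rw [esymm_eq_zero_of_card_lt (by simp)]; simp
  | cons a s ih =>
    rw [esymm_cons, mul_add, ih, esymm_one', Multiset.sum_cons, Multiset.map_cons,
      Multiset.sum_cons]
    ring

theorem sum_sq_le_card_mul (s : Multiset ℝ) :
    s.sum ^ 2 ≤ Multiset.card s * (s.map (· ^ 2)).sum := by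
  induction s using Quotient.inductionOn with
  | h l =>
    have h := sq_sum_le_card_mul_sum_sq (s := Finset.univ) (f := fun i : Fin l.length => l.get i)
    have h1 : ∑ i : Fin l.length, l.get i = l.sum := by
      simp
    have h2 : ∑ i : Fin l.length, l.get i ^ 2 = (l.map (· ^ 2)).sum := by
      have := Fin.sum_univ_fun_getElem l (fun x : ℝ => x ^ 2)
      simpa using this
    rw [h1, h2] at h
    simpa using h

/-- The normalized derivative of a real-rooted polynomial is real-rooted, in terms of the
elementary symmetric functions of the roots. -/
theorem exists_derivative_roots (s : Multiset ℝ) {N : ℕ} (hN : Multiset.card s = N + 1) :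
    ∃ t : Multiset ℝ, Multiset.card t = N ∧ ∀ j ≤ N,
      ((N : ℝ) + 1) * t.esymm j = (N + 1 - j) * s.esymm j := by
  set P : Polynomial ℝ := (s.map fun a => Polynomial.X + Polynomial.C a).prod with hP
  have hPm : P.Monic := Polynomial.monic_multiset_prod_of_monic _ _
    fun a _ => Polynomial.monic_X_add_C a
  have hdeg : P.natDegree = N + 1 := by
    rw [hP, Polynomial.natDegree_multiset_prod_of_monic]
    · simp [hN, add_comm]
    · intro f hf
      obtain ⟨a, -, rfl⟩ := Multiset.mem_map.1 hf
      exact Polynomial.monic_X_add_C a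
  have hroots : P.roots = s.map (- ·) := by
    have : P = ((s.map (- ·)).map fun a => Polynomial.X - Polynomial.C a).prod := by
      rw [hP, Multiset.map_map]
      congr 1
      refine Multiset.map_congr rfl fun a _ => ?_
      simp
    rw [this, Polynomial.roots_multiset_prod_X_sub_C]
  set D := Polynomial.derivative P with hD
  have hDdeg : D.natDegree = N := by
    rw [hD, Polynomial.natDegree_derivative, hdeg, Nat.add_sub_cancel]
  have hDroots : Multiset.card D.roots = N := by
    -- Rolle's theorem: differentiation loses at most one real root, so all N roots of the
    -- derivative are real.
    have h1 := Polynomial.card_roots_le_derivative P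
    rw [hroots, Multiset.card_map, hN, ← hD] at h1
    have h2 := Polynomial.card_roots' D
    omega
  have hlead : D.leadingCoeff = N + 1 := by
    rw [Polynomial.leadingCoeff, hDdeg, hD, Polynomial.coeff_derivative]
    have : P.coeff (N + 1) = 1 := by rw [← hdeg]; exact hPm
    rw [this, one_mul]
  refine ⟨D.roots.map (- ·), by simpa using hDroots, fun j hj => ?_⟩
  have h1 := Polynomial.coeff_eq_esymm_roots_of_card (p := D) (by rw [hDroots, hDdeg])
    (k := N - j) (by omega)
  rw [hDdeg, hlead, Nat.sub_sub_self hj] at h1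
  have h2 := Multiset.prod_X_add_C_coeff s (k := N - j + 1) (by omega)
  rw [hN, show N + 1 - (N - j + 1) = j by omega, ← hP] at h2
  rw [hD, Polynomial.coeff_derivative, h2, Nat.cast_sub hj] at h1
  have h3 : (D.roots.map (- ·)).esymm j = (-1) ^ j * D.roots.esymm j :=
    Multiset.esymm_neg D.roots j
  rw [h3, ← mul_assoc, ← h1]
  ring

/-- After division by the square of the product this relates σ_1 and σ_2 of the reciprocals, where
it is Cauchy-Schwarz. If some entry is zero, the left side vanishes. -/
theorem newton_inequality_top (s : Multiset ℝ) {N : ℕ} (hN : Multiset.card s = N + 2) :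
    2 * ((N : ℝ) + 2) * (s.esymm N * s.esymm (N + 2)) ≤ (N + 1) * s.esymm (N + 1) ^ 2 := by
  by_cases h0 : ∀ a ∈ s, a ≠ 0
  · have e0 := esymm_map_inv_mul_prod h0 (i := 0) (j := N + 2) (by omega)
    have e1 := esymm_map_inv_mul_prod h0 (i := 1) (j := N + 1) (by omega)
    have e2 := esymm_map_inv_mul_prod h0 (i := 2) (j := N) (by omega)
    rw [← e0, ← e1, ← e2, esymm_zero', esymm_one']
    have h1 := two_mul_esymm_two (s.map (·⁻¹))
    have h2 := sum_sq_le_card_mul (s.map (·⁻¹))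
    rw [Multiset.card_map, hN] at h2
    push_cast at h2
    have h3 : ((N : ℝ) + 2) * (2 * (s.map (·⁻¹)).esymm 2) ≤
        (N + 1) * (s.map (·⁻¹)).sum ^ 2 := by
      rw [h1]; linarith
    have h4 := mul_le_mul_of_nonneg_right h3 (sq_nonneg s.prod)
    linarith
  · push Not at h0
    obtain ⟨a, ha, rfl⟩ := h0
    have : s.esymm (N + 2) = 0 := by
      rw [← hN, esymm_card, Multiset.prod_eq_zero ha]
    rw [this, mul_zero, mul_zero]
    positivity

/-- **Newton's inequalities** for the elementary symmetric functions of real numbers. -/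
theorem newton_inequality (s : Multiset ℝ) (i : ℕ) :
    ((i : ℝ) + 2) * (Multiset.card s - i) * (s.esymm i * s.esymm (i + 2)) ≤
      (i + 1) * (Multiset.card s - i - 1) * s.esymm (i + 1) ^ 2 := by
  obtain ⟨N, hN⟩ : ∃ N, Multiset.card s = N := ⟨_, rfl⟩
  rw [hN]
  induction N generalizing s with
  | zero =>
    rw [esymm_eq_zero_of_card_lt (j := i + 2) (by omega),
      esymm_eq_zero_of_card_lt (j := i + 1) (by omega)]
    simp
  | succ N ih =>
    rcases lt_trichotomy (N + 1) (i + 2) with h | h | h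
    · rw [esymm_eq_zero_of_card_lt (j := i + 2) (by omega)]
      rcases Nat.lt_or_ge N (i + 1) with h' | h'
      · rcases Nat.lt_or_ge N i with h'' | h''
        · rw [esymm_eq_zero_of_card_lt (j := i + 1) (by omega)]; simp
        · obtain rfl : N = i := by omega
          push_cast; simp
      · omega
    · obtain rfl : N = i + 1 := by omega
      have := newton_inequality_top s (N := i) (by omega)
      push_cast
      nlinarith
    -- Passing to the derivative removes one root and only rescales σ_j, which reduces the
    -- inequality to the case where σ_{i+2} is the product of all entries.
    · obtain ⟨t, ht, hte⟩ := exists_derivative_roots s hN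
      have h1 := ih t ht
      have hNi : (i : ℝ) + 2 ≤ N := by exact_mod_cast (by omega : i + 2 ≤ N)
      have e0 := hte i (by omega)
      have e1 := hte (i + 1) (by omega)
      have e2 := hte (i + 2) (by omega)
      push_cast at e1 e2 ⊢
      have h2 : ((i : ℝ) + 2) * (N - i) *
          (((N + 1) * t.esymm i) * ((N + 1) * t.esymm (i + 2))) ≤
          (i + 1) * (N - i - 1) * ((N + 1) * t.esymm (i + 1)) ^ 2 := by
        have := mul_le_mul_of_nonneg_right h1 (sq_nonneg ((N : ℝ) + 1))
        linarith
      rw [e0, e1, e2] at h2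
      have hpos : (0 : ℝ) < (N - i) * (N - i - 1) := by
        apply mul_pos <;> linarith
      refine le_of_mul_le_mul_left ?_ hpos
      linarith

/-- `σ_{i} σ_{i+2} ≤ σ_{i+1}²`. -/
theorem esymm_mul_le_sq (s : Multiset ℝ) (i : ℕ) :
    s.esymm i * s.esymm (i + 2) ≤ s.esymm (i + 1) ^ 2 := by
  rcases le_or_gt (s.esymm i * s.esymm (i + 2)) 0 with h | h
  · exact h.trans (sq_nonneg _)
  · have hi : i + 2 ≤ Multiset.card s := by
      by_contra hlt
      rw [esymm_eq_zero_of_card_lt (j := i + 2) (by omega), mul_zero] at h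
      exact lt_irrefl _ h
    have hi' : (i : ℝ) + 2 ≤ Multiset.card s := by exact_mod_cast hi
    have h1 := newton_inequality s i
    have hpos : (0 : ℝ) < (i + 1) * (Multiset.card s - i - 1) := by
      apply mul_pos <;> [positivity; linarith]
    refine le_of_mul_le_mul_left (le_trans ?_ h1) hpos
    refine mul_le_mul_of_nonneg_right ?_ h.le
    nlinarith

end ElementarySymmetric

/-! ### Garding cones and monotonicity of the quotient. -/

section GardingCone

/-- The Garding cone `Γ_k`. -/
def InCone (k : ℕ) (s : Multiset ℝ) : Prop := ∀ j ≤ k, 0 < s.esymm j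

theorem InCone.mono {k l : ℕ} {s : Multiset ℝ} (h : InCone k s) (hl : l ≤ k) : InCone l s :=
  fun j hj => h j (hj.trans hl)

theorem InCone.le_card {k : ℕ} {s : Multiset ℝ} (h : InCone k s) : k ≤ Multiset.card s := by
  by_contra hlt
  have := h k le_rfl
  rw [esymm_eq_zero_of_card_lt (by omega)] at this
  exact lt_irrefl _ this

/-- If the last σ_{k+1}(s) were nonpositive while σ_k(s) > 0, positivity of σ_{k+1} and σ_{k+2} of
the larger family would force a > 0 and then σ_k σ_{k+2} > σ_{k+1}² on s, against Newton. -/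
theorem InCone.of_cons {k : ℕ} {a : ℝ} {s : Multiset ℝ} (h : InCone (k + 1) (a ::ₘ s)) :
    InCone k s := by
  induction k with
  | zero =>
    intro j hj
    obtain rfl : j = 0 := by omega
    rw [esymm_zero']; exact one_pos
  | succ k ih =>
    have hk := ih (h.mono (by omega))
    intro j hj
    rcases Nat.lt_or_ge k j with hlt | hle
    · obtain rfl : j = k + 1 := by omega
      by_contra hneg
      push Not at hneg
      have h1 := h (k + 1) (by omega)
      have h2 := h (k + 2) (by omega)
      rw [esymm_cons] at h1 h2
      have h3 := hk k le_rfl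
      have h4 := esymm_mul_le_sq s k
      have ha : 0 < a := by
        by_contra ha
        push Not at ha
        nlinarith
      rcases hneg.lt_or_eq with h5 | h5
      · nlinarith [mul_pos h3 h2, mul_pos (neg_pos.2 h5) h1]
      · rw [h5] at h1 h2 h4
        nlinarith [mul_pos h3 h2]
    · exact hk j hle

/-- The ratios `(j + 1) σ_{j+1} / ((N - j) σ_j)` decrease with `j`. -/
theorem InCone.newton_ratio {l k : ℕ} (hlk : l ≤ k) {s : Multiset ℝ} (h : InCone k s) :
    ((k : ℝ) + 1) * (Multiset.card s - l) * (s.esymm (k + 1) * s.esymm l) ≤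
      (l + 1) * (Multiset.card s - k) * (s.esymm (l + 1) * s.esymm k) := by
  induction k, hlk using Nat.le_induction with
  | base => exact le_rfl
  | succ k hlk ih =>
    have h1 := ih (h.mono (by omega))
    have h2 := newton_inequality s k
    have hc : ((k : ℝ) + 1) ≤ Multiset.card s := by exact_mod_cast h.le_card
    have hl : (l : ℝ) ≤ k := by exact_mod_cast hlk
    have e0 := h k (by omega)
    have e1 := h (k + 1) le_rfl
    have el := h l (by omega)
    push_cast
    have hN : 0 ≤ ((Multiset.card s : ℝ) - l) * s.esymm l * (k + 1) := by
      apply mul_nonneg (mul_nonneg _ el.le) (by positivity); linarith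
    have h3 := mul_le_mul_of_nonneg_left h2 hN
    have hM : 0 ≤ ((k : ℝ) + 1) * (Multiset.card s - k - 1) * s.esymm (k + 1) := by
      apply mul_nonneg (mul_nonneg (by positivity) _) e1.le; linarith
    have h4 := mul_le_mul_of_nonneg_left h1 hM
    have hpos : 0 < ((k : ℝ) + 1) * (Multiset.card s - k) * s.esymm k := by
      apply mul_pos (mul_pos (by positivity) _) e0; linarith
    refine le_of_mul_le_mul_left ?_ hpos
    linarith

/-- The binomial factors of Newton's inequalities are dropped. Here σ_{k+1} may have either sign, as
is needed when an entry has been removed from a point of the cone. -/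
theorem InCone.ratio_le {l k : ℕ} (hlk : l ≤ k) {s : Multiset ℝ} (h : InCone k s) :
    s.esymm (k + 1) * s.esymm l ≤ s.esymm (l + 1) * s.esymm k := by
  rcases hlk.eq_or_lt with rfl | hlt
  · exact le_rfl
  have e0 := h k le_rfl
  have el := h l (by omega)
  have el' := h (l + 1) (by omega)
  rcases le_or_gt (s.esymm (k + 1)) 0 with h0 | h0
  · exact (mul_nonpos_of_nonpos_of_nonneg h0 el.le).trans (mul_pos el' e0).le
  · have h1 := h.newton_ratio hlk
    have hc : ((k : ℝ)) + 1 ≤ Multiset.card s := by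
      have : InCone (k + 1) s := fun j hj => by
        rcases hj.lt_or_eq with hj | rfl
        exacts [h j (by omega), h0]
      exact_mod_cast this.le_card
    have hl : (l : ℝ) ≤ k := by exact_mod_cast hlk
    have hpos : (0 : ℝ) < (k + 1) * (Multiset.card s - l) := by
      apply mul_pos (by positivity); linarith
    refine le_of_mul_le_mul_left (h1.trans ?_) hpos
    refine mul_le_mul_of_nonneg_right ?_ (mul_pos el' e0).le
    nlinarith

/-- Numerator and denominator are affine in the distinguished entry. After cross-multiplication the
difference is b - a times the quantity that `InCone.ratio_le` makes nonnegative on s. -/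
theorem InCone.cons_mono {k l : ℕ} (hlk : l < k) {a b : ℝ} (hab : a ≤ b) {s : Multiset ℝ}
    (h : InCone k (a ::ₘ s)) :
    InCone k (b ::ₘ s) ∧
      (a ::ₘ s).esymm k / (a ::ₘ s).esymm l ≤ (b ::ₘ s).esymm k / (b ::ₘ s).esymm l := by
  obtain ⟨k, rfl⟩ : ∃ k', k = k' + 1 := ⟨k - 1, by omega⟩
  have hs := h.of_cons
  have hb : InCone (k + 1) (b ::ₘ s) := by
    intro j hj
    cases j with
    | zero => rw [esymm_zero']; exact one_pos
    | succ j =>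
      have h1 := h (j + 1) hj
      have h2 := hs j (by omega)
      rw [esymm_cons] at h1 ⊢
      nlinarith
  refine ⟨hb, ?_⟩
  rw [div_le_div_iff₀ (h l (by omega)) (hb l (by omega))]
  cases l with
  | zero =>
    rw [esymm_zero', esymm_zero', esymm_cons, esymm_cons]
    nlinarith [hs k le_rfl]
  | succ l =>
    simp only [esymm_cons]
    have := hs.ratio_le (l := l) (k := k) (by omega)
    nlinarith [mul_nonneg (sub_nonneg.2 hab) (sub_nonneg.2 this)]

/-- `σ_k / σ_l` and the Garding cone are monotone in each variable. -/
theorem InCone.rel_mono {k l : ℕ} (hlk : l < k) {s t : Multiset ℝ}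
    (hst : Multiset.Rel (· ≤ ·) s t) (h : InCone k s) :
    InCone k t ∧ s.esymm k / s.esymm l ≤ t.esymm k / t.esymm l := by
  -- The entries are raised one at a time; u collects those already raised.
  suffices H : ∀ u : Multiset ℝ, InCone k (s + u) → InCone k (t + u) ∧
      (s + u).esymm k / (s + u).esymm l ≤ (t + u).esymm k / (t + u).esymm l by
    simpa using H 0 (by simpa using h)
  clear h
  induction hst with
  | zero => exact fun u hu => ⟨hu, le_rfl⟩
  | @cons a b as bs hab _ ih =>
    intro u hu
    rw [Multiset.cons_add] at hu ⊢
    obtain ⟨h1, h2⟩ := hu.cons_mono hlk hab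
    have e : b ::ₘ (as + u) = as + b ::ₘ u := by rw [Multiset.add_cons]
    rw [e] at h1 h2
    obtain ⟨h3, h4⟩ := ih _ h1
    rw [Multiset.cons_add, ← Multiset.add_cons]
    exact ⟨h3, h2.trans h4⟩

end GardingCone

/-! ### Derivatives of log(σ_k/σ_l) and their weighted sums. -/

section Weights

variable {ι : Type*} [DecidableEq ι]

/-- The partial derivative of `σ_j`, as a function of `(x_i)_{i ∈ s}`, with respect to `x_a`. -/
noncomputable def esymmDeriv (s : Finset ι) (x : ι → ℝ) (a : ι) : ℕ → ℝ
  | 0 => 0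
  | j + 1 => ((s.erase a).val.map x).esymm j

theorem esymm_erase {s : Finset ι} {a : ι} (ha : a ∈ s) (x : ι → ℝ) (j : ℕ) :
    (s.val.map x).esymm (j + 1) =
      ((s.erase a).val.map x).esymm (j + 1) + x a * ((s.erase a).val.map x).esymm j := by
  conv_lhs => rw [← Finset.insert_erase ha, Finset.insert_val_of_notMem (Finset.notMem_erase a s),
    Multiset.map_cons, esymm_cons]

theorem esymm_erase_deriv {s : Finset ι} {a : ι} (ha : a ∈ s) (x : ι → ℝ) (j : ℕ) :
    (s.val.map x).esymm j = ((s.erase a).val.map x).esymm j + x a * esymmDeriv s x a j := by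
  cases j with
  | zero => simp [esymmDeriv, esymm_zero']
  | succ j => exact esymm_erase ha x j

theorem esymm_insert {s : Finset ι} {a : ι} (ha : a ∉ s) (x : ι → ℝ) (j : ℕ) :
    ((insert a s).val.map x).esymm (j + 1) =
      (s.val.map x).esymm (j + 1) + x a * (s.val.map x).esymm j := by
  rw [Finset.insert_val_of_notMem ha, Multiset.map_cons, esymm_cons]

theorem esymmDeriv_insert_self {s : Finset ι} {a : ι} (ha : a ∉ s) (x : ι → ℝ) (j : ℕ) :
    esymmDeriv (insert a s) x a (j + 1) = (s.val.map x).esymm j := by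
  rw [esymmDeriv, Finset.erase_insert ha]

theorem esymmDeriv_insert {s : Finset ι} {a b : ι} (ha : a ∉ s) (hb : b ∈ s) (x : ι → ℝ)
    (j : ℕ) :
    esymmDeriv (insert a s) x b (j + 1) =
      esymmDeriv s x b (j + 1) + x a * esymmDeriv s x b j := by
  have hab : a ≠ b := fun h => ha (h ▸ hb)
  have h : (insert a s).erase b = insert a (s.erase b) := Finset.erase_insert_of_ne hab
  have ha' : a ∉ s.erase b := fun h' => ha (Finset.mem_of_mem_erase h')
  cases j with
  | zero => simp [esymmDeriv, esymm_zero']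
  | succ j => simp only [esymmDeriv]; rw [h, esymm_insert ha']

theorem hasDerivAt_esymm (s : Finset ι) (x y : ι → ℝ) (j : ℕ) :
    HasDerivAt (fun t : ℝ => (s.val.map fun a => x a + t * y a).esymm j)
      (∑ a ∈ s, y a * esymmDeriv s x a j) 0 := by
  induction s using Finset.induction_on generalizing j with
  | empty =>
    cases j with
    | zero => simpa [esymm_zero'] using hasDerivAt_const (0 : ℝ) (1 : ℝ)
    | succ j =>
      have : ∀ t : ℝ, ((∅ : Finset ι).val.map fun a => x a + t * y a).esymm (j + 1) = 0 :=
        fun t => esymm_eq_zero_of_card_lt (by simp)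
      simp only [this, Finset.sum_empty]
      exact hasDerivAt_const (0 : ℝ) (0 : ℝ)
  | insert a s ha ih =>
    cases j with
    | zero => simpa [esymm_zero', esymmDeriv] using hasDerivAt_const (0 : ℝ) (1 : ℝ)
    | succ j =>
      simp only [esymm_insert ha]
      have h1 : HasDerivAt (fun t : ℝ => x a + t * y a) (y a) 0 := by
        simpa using ((hasDerivAt_id (0 : ℝ)).mul_const (y a)).const_add (x a)
      have h2 := (ih (j + 1)).add (h1.mul (ih j))
      refine h2.congr_deriv ?_
      have hsum : ∑ b ∈ s, y b * esymmDeriv (insert a s) x b (j + 1) =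
          ∑ b ∈ s, y b * esymmDeriv s x b (j + 1) + x a * ∑ b ∈ s, y b * esymmDeriv s x b j := by
        rw [Finset.mul_sum, ← Finset.sum_add_distrib]
        refine Finset.sum_congr rfl fun b hb => ?_
        rw [esymmDeriv_insert ha hb]
        ring
      rw [Finset.sum_insert ha, esymmDeriv_insert_self ha, hsum]
      simp only [zero_mul, add_zero]
      ring

/-- Euler's identity. -/
theorem sum_mul_esymmDeriv (s : Finset ι) (x : ι → ℝ) (j : ℕ) :
    ∑ a ∈ s, x a * esymmDeriv s x a j = j * (s.val.map x).esymm j := by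
  induction s using Finset.induction_on generalizing j with
  | empty =>
    cases j with
    | zero => simp
    | succ j => rw [esymm_eq_zero_of_card_lt (by simp)]; simp
  | insert a s ha ih =>
    cases j with
    | zero => simp [esymmDeriv]
    | succ j =>
      rw [Finset.sum_insert ha, esymmDeriv_insert_self ha, esymm_insert ha,
        Finset.sum_congr rfl fun b hb => by rw [esymmDeriv_insert ha hb, mul_add],
        Finset.sum_add_distrib, ih]
      have : ∀ b, x b * (x a * esymmDeriv s x b j) = x a * (x b * esymmDeriv s x b j) :=
        fun b => by ring
      simp only [this]
      rw [← Finset.mul_sum, ih]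
      push_cast
      ring

theorem sum_esymmDeriv (s : Finset ι) (x : ι → ℝ) (j : ℕ) :
    ∑ a ∈ s, esymmDeriv s x a (j + 1) = (s.card - j) * (s.val.map x).esymm j := by
  have h := sum_mul_esymmDeriv s x j
  have h2 : ∑ a ∈ s, (s.val.map x).esymm j =
      ∑ a ∈ s, (esymmDeriv s x a (j + 1) + x a * esymmDeriv s x a j) :=
    Finset.sum_congr rfl fun a ha => esymm_erase_deriv ha x j
  rw [Finset.sum_add_distrib, h, Finset.sum_const, nsmul_eq_mul] at h2
  linarith

/-- Split σ_j according to whether x_a occurs, multiply by x_a, sum over a, and apply Euler's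
identity in degree j + 1. -/
theorem sum_sq_mul_esymmDeriv (s : Finset ι) (x : ι → ℝ) (j : ℕ) :
    ∑ a ∈ s, x a ^ 2 * esymmDeriv s x a j =
      (∑ a ∈ s, x a) * (s.val.map x).esymm j - (j + 1) * (s.val.map x).esymm (j + 1) := by
  have h := sum_mul_esymmDeriv s x (j + 1)
  have h2 : ∑ a ∈ s, x a * (s.val.map x).esymm j =
      ∑ a ∈ s, (x a * esymmDeriv s x a (j + 1) + x a ^ 2 * esymmDeriv s x a j) :=
    Finset.sum_congr rfl fun a ha => by rw [esymm_erase_deriv ha x j, esymmDeriv]; ring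
  rw [Finset.sum_add_distrib, h, ← Finset.sum_mul] at h2
  push_cast at h2
  linarith

/-- The partial derivatives of `log (σ_k / σ_l)`. -/
noncomputable def weight (k l : ℕ) (s : Finset ι) (x : ι → ℝ) (a : ι) : ℝ :=
  esymmDeriv s x a k / (s.val.map x).esymm k - esymmDeriv s x a l / (s.val.map x).esymm l

variable {k l : ℕ} {s : Finset ι} {x : ι → ℝ}

theorem hasDerivAt_log_esymm_sub (h : InCone k (s.val.map x)) (hl : l ≤ k) (y : ι → ℝ) :
    HasDerivAt (fun t : ℝ => Real.log ((s.val.map fun a => x a + t * y a).esymm k) -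
        Real.log ((s.val.map fun a => x a + t * y a).esymm l))
      (∑ a ∈ s, y a * weight k l s x a) 0 := by
  have hk := (hasDerivAt_esymm s x y k).log (by simpa using (h k le_rfl).ne')
  have hl := (hasDerivAt_esymm s x y l).log (by simpa using (h l hl).ne')
  refine (hk.sub hl).congr_deriv ?_
  simp only [zero_mul, add_zero, weight, mul_sub, Finset.sum_sub_distrib, Finset.sum_div,
    mul_div_assoc]

/-- The infinitesimal form of monotonicity: cross-multiplied, it is `InCone.ratio_le` for the family
without x_a. -/
theorem weight_nonneg (hlk : l < k) (h : InCone k (s.val.map x)) {a : ι} (ha : a ∈ s) :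
    0 ≤ weight k l s x a := by
  obtain ⟨k, rfl⟩ : ∃ k', k = k' + 1 := ⟨k - 1, by omega⟩
  have he : InCone k ((s.erase a).val.map x) := by
    refine InCone.of_cons (a := x a) ?_
    rwa [← Multiset.map_cons x, ← Finset.insert_val_of_notMem (Finset.notMem_erase a s),
      Finset.insert_erase ha]
  rw [weight, sub_nonneg]
  cases l with
  | zero =>
    simp only [esymmDeriv, zero_div]
    exact div_nonneg (he k le_rfl).le (h _ le_rfl).le
  | succ l =>
    simp only [esymmDeriv]
    rw [div_le_div_iff₀ (h _ hlk.le) (h _ le_rfl), esymm_erase ha, esymm_erase ha]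
    have := he.ratio_le (l := l) (k := k) (by omega)
    linarith

theorem sum_mul_weight (h : InCone k (s.val.map x)) (hl : l ≤ k) :
    ∑ a ∈ s, x a * weight k l s x a = k - l := by
  simp only [weight, mul_sub, Finset.sum_sub_distrib, ← mul_div_assoc, ← Finset.sum_div,
    sum_mul_esymmDeriv]
  rw [mul_div_cancel_right₀ _ (h k le_rfl).ne', mul_div_cancel_right₀ _ (h l hl).ne']

/-- Take r = σ_k/σ_{k-1}. Newton's inequalities bound the sum of the weights below by a multiple of
1/r. The ratios σ_j/σ_{j-1} decrease in j, so r is the smallest of the k - l ratios whose product is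
σ_k/σ_l. -/
theorem sum_weight_ge (hlk : l < k) (h : InCone k (s.val.map x)) :
    ∃ r : ℝ, 0 < r ∧ (k : ℝ) - l ≤ k * (∑ a ∈ s, weight k l s x a) * r ∧
      r ^ (k - l) ≤ (s.val.map x).esymm k / (s.val.map x).esymm l := by
  obtain ⟨k, rfl⟩ : ∃ k', k = k' + 1 := ⟨k - 1, by omega⟩
  have hk1 := h (k + 1) le_rfl
  have hk := h k (by omega)
  have hl := h l (by omega)
  have hc : ((k : ℝ)) + 1 ≤ s.card := by simpa using (Nat.cast_le (α := ℝ)).2 h.le_card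
  refine ⟨(s.val.map x).esymm (k + 1) / (s.val.map x).esymm k, div_pos hk1 hk, ?_, ?_⟩
  · have key : ((k : ℝ) + 1 - l) * (s.card - k) * (s.val.map x).esymm k ≤
        (k + 1) * ((∑ a ∈ s, weight (k + 1) l s x a) * (s.val.map x).esymm (k + 1)) := by
      simp only [weight, Finset.sum_sub_distrib, ← Finset.sum_div, sum_esymmDeriv]
      rw [sub_mul (_ / _) _ ((s.val.map x).esymm (k + 1)), div_mul_cancel₀ _ hk1.ne']
      cases l with
      | zero => simp [esymmDeriv]; linarith
      | succ l =>
        rw [sum_esymmDeriv]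
        have h1 := (h.mono (Nat.le_succ k)).newton_ratio (l := l) (by omega)
        simp only [Multiset.card_map, Finset.card_val] at h1
        have h2 : ((k : ℝ) + 1) * ((s.card - l) * (s.val.map x).esymm l /
            (s.val.map x).esymm (l + 1) * (s.val.map x).esymm (k + 1)) ≤
            (l + 1) * (s.card - k) * (s.val.map x).esymm k := by
          rw [div_mul_eq_mul_div, mul_div_assoc', div_le_iff₀ hl]
          linarith
        push_cast
        linarith
    rw [← mul_div_assoc, le_div_iff₀ hk]
    push_cast
    refine le_trans ?_ (key.trans (by linarith))
    have hlk' : (l : ℝ) ≤ k := by exact_mod_cast Nat.lt_succ_iff.1 hlk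
    refine mul_le_mul_of_nonneg_right ?_ hk.le
    nlinarith
  · have : ∀ j, j ≤ k + 1 - l → ((s.val.map x).esymm (k + 1) / (s.val.map x).esymm k) ^ j ≤
        (s.val.map x).esymm (k + 1) / (s.val.map x).esymm (k + 1 - j) := by
      intro j hj
      induction j with
      | zero => simp [hk1.ne']
      | succ j ih =>
        have h1 := ih (by omega)
        have ej := h (k + 1 - j) (by omega)
        have ej' := h (k + 1 - (j + 1)) (by omega)
        have h2 := (h.mono (Nat.le_succ k)).ratio_le (l := k + 1 - (j + 1)) (by omega)
        rw [show k + 1 - (j + 1) + 1 = k + 1 - j by omega] at h2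
        have h3 : (s.val.map x).esymm (k + 1) / (s.val.map x).esymm k ≤
            (s.val.map x).esymm (k + 1 - j) / (s.val.map x).esymm (k + 1 - (j + 1)) := by
          rwa [div_le_div_iff₀ hk ej']
        rw [pow_succ]
        refine (mul_le_mul h1 h3 (div_pos hk1 hk).le (div_pos hk1 ej).le).trans (le_of_eq ?_)
        field_simp
    simpa [Nat.sub_sub_self hlk.le] using this (k + 1 - l) le_rfl

/-- Take R = σ_{l+1}/σ_l, the largest of the k - l ratios whose product is σ_k/σ_l. In the weighted
sum of squares the terms with σ_1 cancel, leaving (l+1)R - (k+1)σ_{k+1}/σ_k, and Newton's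
inequalities keep a fixed part of R. -/
theorem sum_sq_mul_weight_ge (hlk : l < k) (h : InCone k (s.val.map x)) :
    ∃ R : ℝ, 0 < R ∧ ((k : ℝ) - l) * R ≤ s.card * (∑ a ∈ s, x a ^ 2 * weight k l s x a) ∧
      (s.val.map x).esymm k / (s.val.map x).esymm l ≤ R ^ (k - l) := by
  have hk := h k le_rfl
  have hl := h l hlk.le
  have hl1 := h (l + 1) hlk
  have hc : (k : ℝ) ≤ s.card := by simpa using (Nat.cast_le (α := ℝ)).2 h.le_card
  have hlk' : (l : ℝ) + 1 ≤ k := by exact_mod_cast hlk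
  refine ⟨(s.val.map x).esymm (l + 1) / (s.val.map x).esymm l, div_pos hl1 hl, ?_, ?_⟩
  · have e : ∑ a ∈ s, x a ^ 2 * weight k l s x a =
        (l + 1) * ((s.val.map x).esymm (l + 1) / (s.val.map x).esymm l) -
        (k + 1) * ((s.val.map x).esymm (k + 1) / (s.val.map x).esymm k) := by
      simp only [weight, mul_sub, Finset.sum_sub_distrib, ← mul_div_assoc, ← Finset.sum_div,
        sum_sq_mul_esymmDeriv]
      field_simp
      ring
    have h1 := h.newton_ratio hlk.le
    simp only [Multiset.card_map, Finset.card_val] at h1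
    have h2 : ((k : ℝ) + 1) * (s.card - l) *
        ((s.val.map x).esymm (k + 1) / (s.val.map x).esymm k) ≤
        (l + 1) * (s.card - k) * ((s.val.map x).esymm (l + 1) / (s.val.map x).esymm l) := by
      rw [← mul_div_assoc, ← mul_div_assoc, div_le_div_iff₀ hk hl]
      linarith
    set R := (s.val.map x).esymm (l + 1) / (s.val.map x).esymm l
    set y := (s.val.map x).esymm (k + 1) / (s.val.map x).esymm k
    have hR : 0 < R := div_pos hl1 hl
    have hpos : (0 : ℝ) < s.card - l := by linarith
    rw [e]
    have h3 : ((l : ℝ) + 1) * (k - l) * R ≤ (s.card - l) * ((l + 1) * R - (k + 1) * y) := by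
      nlinarith
    have h4 : ((k : ℝ) - l) * R ≤ (l + 1) * (k - l) * R := by
      refine mul_le_mul_of_nonneg_right ?_ hR.le
      nlinarith [(Nat.cast_nonneg l : (0 : ℝ) ≤ l)]
    have h5 : 0 ≤ (l + 1) * R - (k + 1) * y := by
      refine nonneg_of_mul_nonneg_right (le_trans ?_ h3) hpos
      refine mul_nonneg (mul_nonneg (by positivity) (by linarith)) hR.le
    refine (h4.trans h3).trans (mul_le_mul_of_nonneg_right ?_ h5)
    linarith [(Nat.cast_nonneg l : (0 : ℝ) ≤ l)]
  · have : ∀ j, l + j ≤ k → (s.val.map x).esymm (l + j) / (s.val.map x).esymm l ≤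
        ((s.val.map x).esymm (l + 1) / (s.val.map x).esymm l) ^ j := by
      intro j hj
      induction j with
      | zero => simp [hl.ne']
      | succ j ih =>
        have h1 := ih (by omega)
        have ej := h (l + j) (by omega)
        have ej' := h (l + (j + 1)) hj
        have h2 := (h.mono (show l + j ≤ k by omega)).ratio_le (l := l) (by omega)
        have h3 : (s.val.map x).esymm (l + j + 1) / (s.val.map x).esymm (l + j) ≤
            (s.val.map x).esymm (l + 1) / (s.val.map x).esymm l := by
          rwa [div_le_div_iff₀ ej hl]
        rw [pow_succ]
        refine le_trans (le_of_eq ?_) (mul_le_mul h1 h3 (div_pos ej' ej).le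
          (pow_pos (div_pos hl1 hl) j).le)
        rw [← add_assoc]
        field_simp
    simpa [Nat.add_sub_cancel' hlk.le] using this (k - l) (by omega)

end Weights

/-! ### The quotient as a function of the curvatures through Λ. -/

section PSums

variable {α : Type*} [Fintype α]

theorem pSums_map_univ (p : ℕ) (κ : α → ℝ) :
    pSums p (Finset.univ.val.map κ) =
      (Finset.univ.powersetCard p).val.map fun I : Finset α => ∑ i ∈ I, κ i := by
  rw [pSums, Multiset.powersetCard_map, ← Finset.map_val_val_powersetCard, Multiset.map_map,
    Multiset.map_map]
  rfl

variable [DecidableEq α]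

/-- The weights of `log (σ_k / σ_l)` at `Λ(κ)`. -/
noncomputable def pWeight (p k l : ℕ) (κ : α → ℝ) (I : Finset α) : ℝ :=
  weight k l (Finset.univ.powersetCard p) (fun J : Finset α => ∑ i ∈ J, κ i) I

/-- The derivative of `log (σ_k / σ_l) ∘ Λ` at `κ` in the direction `ε`. -/
noncomputable def logDeriv (p k l : ℕ) (κ ε : α → ℝ) : ℝ :=
  ∑ I ∈ Finset.univ.powersetCard p, (∑ i ∈ I, ε i) * pWeight p k l κ I

variable {p k l : ℕ} {κ : α → ℝ}

theorem hasDerivAt_logDeriv (h : InCone k (pSums p (Finset.univ.val.map κ))) (hl : l ≤ k)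
    (ε : α → ℝ) :
    HasDerivAt (fun t : ℝ =>
        Real.log ((pSums p (Finset.univ.val.map fun i => κ i + t * ε i)).esymm k) -
        Real.log ((pSums p (Finset.univ.val.map fun i => κ i + t * ε i)).esymm l))
      (logDeriv p k l κ ε) 0 := by
  rw [pSums_map_univ] at h
  simp only [pSums_map_univ, Finset.sum_add_distrib, ← Finset.mul_sum]
  exact hasDerivAt_log_esymm_sub h hl fun J : Finset α => ∑ i ∈ J, ε i

theorem pWeight_nonneg (hlk : l < k) (h : InCone k (pSums p (Finset.univ.val.map κ)))
    {I : Finset α} (hI : I ∈ Finset.univ.powersetCard p) : 0 ≤ pWeight p k l κ I := by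
  rw [pSums_map_univ] at h
  exact weight_nonneg hlk h hI

theorem logDeriv_nonneg (hlk : l < k) (h : InCone k (pSums p (Finset.univ.val.map κ)))
    {ε : α → ℝ} (hε : ∀ i, 0 ≤ ε i) : 0 ≤ logDeriv p k l κ ε :=
  Finset.sum_nonneg fun _ hI =>
    mul_nonneg (Finset.sum_nonneg fun i _ => hε i) (pWeight_nonneg hlk h hI)

/-- The estimate for the derivative of `log (σ_k / σ_l) ∘ Λ` in the direction
`ε_i = ((1 - κ_i)² + m²) / m` for `i ≠ i₀`, `ε_{i₀} = 0`, where `κ_{i₀} = 1`. -/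
theorem exists_logDeriv_bounds (hlk : l < k)
    (h : InCone k (pSums p (Finset.univ.val.map κ))) {m : ℝ}
    {i₀ : α} (hκ : κ i₀ = 1) {ε : α → ℝ} (hε₀ : ε i₀ = 0)
    (hε : ∀ i, i ≠ i₀ → m * ε i = (1 - κ i) ^ 2 + m ^ 2) :
    ∃ U Q : ℝ, 0 ≤ U ∧ 0 ≤ Q ∧ ((k : ℝ) - l) ^ 2 ≤ Q * (p * U) ∧
      Q - 2 * ((k : ℝ) - l) + (p + m ^ 2 * (p - 1)) * U ≤ m * logDeriv p k l κ ε ∧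
      (∃ r : ℝ, 0 < r ∧ (k : ℝ) - l ≤ k * U * r ∧
        r ^ (k - l) ≤ (pSums p (Finset.univ.val.map κ)).esymm k /
          (pSums p (Finset.univ.val.map κ)).esymm l) ∧
      (∃ R : ℝ, 0 < R ∧ ((k : ℝ) - l) * R ≤ ((Fintype.card α).choose p) * (p * Q) ∧
        (pSums p (Finset.univ.val.map κ)).esymm k /
          (pSums p (Finset.univ.val.map κ)).esymm l ≤ R ^ (k - l)) := by
  have hW : ∀ I ∈ Finset.univ.powersetCard p, 0 ≤ pWeight p k l κ I :=
    fun I hI => pWeight_nonneg hlk h hI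
  rw [pSums_map_univ] at h ⊢
  set S : Finset (Finset α) := Finset.univ.powersetCard p with hS
  set lam : Finset α → ℝ := fun J => ∑ i ∈ J, κ i with hlam
  have hcard : ∀ I ∈ S, I.card = p := fun I hI => (Finset.mem_powersetCard.1 hI).2
  have hsq : ∀ I ∈ S, lam I ^ 2 ≤ p * ∑ i ∈ I, κ i ^ 2 := by
    intro I hI
    have := sq_sum_le_card_mul_sum_sq (s := I) (f := κ)
    rwa [hcard I hI] at this
  have hQ : ∑ I ∈ S, lam I ^ 2 * pWeight p k l κ I ≤
      p * ∑ I ∈ S, (∑ i ∈ I, κ i ^ 2) * pWeight p k l κ I := by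
    rw [Finset.mul_sum]
    refine Finset.sum_le_sum fun I hI => ?_
    rw [← mul_assoc]
    exact mul_le_mul_of_nonneg_right (hsq I hI) (hW I hI)
  have h1 : ∑ I ∈ S, lam I * pWeight p k l κ I = k - l := sum_mul_weight h hlk.le
  have hU : 0 ≤ ∑ I ∈ S, pWeight p k l κ I := Finset.sum_nonneg hW
  refine ⟨∑ I ∈ S, pWeight p k l κ I, ∑ I ∈ S, (∑ i ∈ I, κ i ^ 2) * pWeight p k l κ I,
    hU, Finset.sum_nonneg fun I hI =>
      mul_nonneg (Finset.sum_nonneg fun i _ => sq_nonneg _) (hW I hI), ?_, ?_,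
    sum_weight_ge hlk h, ?_⟩
  -- Weighted Cauchy-Schwarz for Σ λ_I w_I, which equals k - l by homogeneity.
  · have h2 := Finset.sum_sq_le_sum_mul_sum_of_sq_le_mul S
      (r := fun I => lam I * pWeight p k l κ I) (f := fun I => lam I ^ 2 * pWeight p k l κ I)
      (g := pWeight p k l κ) (fun I hI => mul_nonneg (sq_nonneg _) (hW I hI)) hW
      (fun I _ => le_of_eq (by ring))
    rw [h1] at h2
    refine h2.trans ((mul_le_mul_of_nonneg_right hQ hU).trans (le_of_eq (by ring)))
  -- Of the p indices in I at most one is i₀, so the term m² is lost at most once. This is the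
  -- origin of p - 1, and the reason why p > 1 is needed for a gain.
  · have h3 : ∀ I ∈ S, (∑ i ∈ I, κ i ^ 2) - 2 * lam I + (p + m ^ 2 * (p - 1)) ≤
        m * ∑ i ∈ I, ε i := by
      intro I hI
      have e1 : ∀ i, (1 - κ i) ^ 2 + m ^ 2 - (if i = i₀ then m ^ 2 else 0) ≤ m * ε i := by
        intro i
        split_ifs with hi
        · rw [hi, hκ, hε₀]; simp
        · rw [hε i hi]; simp
      have e2 : ∑ i ∈ I, ((1 - κ i) ^ 2 + m ^ 2 - (if i = i₀ then m ^ 2 else 0)) ≤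
          m * ∑ i ∈ I, ε i := by
        rw [Finset.mul_sum]; exact Finset.sum_le_sum fun i _ => e1 i
      have e3 : ∑ i ∈ I, (if i = i₀ then m ^ 2 else 0) ≤ m ^ 2 := by
        rw [Finset.sum_ite_eq']
        split_ifs <;> [exact le_rfl; positivity]
      have e4 : ∑ i ∈ I, ((1 - κ i) ^ 2 + m ^ 2 - (if i = i₀ then m ^ 2 else 0)) =
          (∑ i ∈ I, κ i ^ 2) - 2 * lam I + p * (1 + m ^ 2) -
            ∑ i ∈ I, (if i = i₀ then m ^ 2 else 0) := by
        rw [Finset.sum_sub_distrib]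
        congr 1
        have : ∀ i, (1 - κ i) ^ 2 + m ^ 2 = κ i ^ 2 - 2 * κ i + (1 + m ^ 2) := fun i => by ring
        simp only [this, Finset.sum_add_distrib, Finset.sum_sub_distrib, ← Finset.mul_sum,
          Finset.sum_const, hcard I hI, nsmul_eq_mul, hlam]
        ring
      rw [e4] at e2
      linarith
    have h4 : ∑ I ∈ S, ((∑ i ∈ I, κ i ^ 2) - 2 * lam I + (p + m ^ 2 * (p - 1))) *
        pWeight p k l κ I ≤ ∑ I ∈ S, (m * ∑ i ∈ I, ε i) * pWeight p k l κ I :=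
      Finset.sum_le_sum fun I hI => mul_le_mul_of_nonneg_right (h3 I hI) (hW I hI)
    simp only [add_mul, sub_mul, Finset.sum_add_distrib, Finset.sum_sub_distrib, mul_assoc,
      ← Finset.mul_sum] at h4
    rw [h1] at h4
    rw [logDeriv]
    linarith
  · obtain ⟨R, hR, hR1, hR2⟩ := sum_sq_mul_weight_ge hlk h
    refine ⟨R, hR, hR1.trans ?_, hR2⟩
    rw [hS, Finset.card_powersetCard, Finset.card_univ]
    exact mul_le_mul_of_nonneg_left hQ (Nat.cast_nonneg _)

end PSums

/-! ### Symmetric polynomials in the curvatures. -/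

section SymmetricPolynomials

theorem map_multiset_esymm {R S : Type*} [CommSemiring R] [CommSemiring S] (f : R →+* S)
    (s : Multiset R) (j : ℕ) : f (s.esymm j) = (s.map f).esymm j := by
  simp only [Multiset.esymm, map_multiset_sum, Multiset.map_map, Multiset.powersetCard_map]
  refine congrArg Multiset.sum (Multiset.map_congr rfl fun t _ => ?_)
  simp [map_multiset_prod]

/-- `σ_j(Λ(κ))` is a polynomial in the elementary symmetric functions of `κ`. -/
theorem exists_polynomial_pSums (d p j : ℕ) :
    ∃ P : MvPolynomial (Fin d) ℝ, ∀ κ : Fin d → ℝ,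
      MvPolynomial.eval (fun i : Fin d => (Finset.univ.val.map κ).esymm (i + 1)) P =
        (pSums p (Finset.univ.val.map κ)).esymm j := by
  obtain ⟨X, hX⟩ : ∃ X : Multiset (MvPolynomial (Fin d) ℝ),
    X = Finset.univ.val.map MvPolynomial.X := ⟨_, rfl⟩
  set Q : MvPolynomial (Fin d) ℝ := ((X.powersetCard p).map Multiset.sum).esymm j with hQ
  have hmap : ∀ {S : Type} [CommSemiring S] (f : MvPolynomial (Fin d) ℝ →+* S),
      f Q = (((X.map f).powersetCard p).map Multiset.sum).esymm j := by
    intro S _ f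
    rw [hQ, map_multiset_esymm, Multiset.powersetCard_map, Multiset.map_map, Multiset.map_map]
    congr 1
    refine Multiset.map_congr rfl fun t _ => ?_
    simp [map_multiset_sum]
  have hsymm : Q.IsSymmetric := by
    intro e
    have h1 := hmap (MvPolynomial.rename (R := ℝ) e : _ →ₐ[ℝ] _).toRingHom
    have h2 : X.map (MvPolynomial.rename (R := ℝ) e : _ →ₐ[ℝ] _).toRingHom = X := by
      rw [hX, Multiset.map_map]
      conv_rhs => rw [← Multiset.map_univ_val_equiv e, Multiset.map_map]
      refine Multiset.map_congr rfl fun t _ => ?_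
      simp
    rw [h2] at h1
    exact h1
  obtain ⟨P, hP⟩ := MvPolynomial.esymmAlgHom_surjective (σ := Fin d) ℝ (n := d) (by simp)
    ⟨Q, hsymm⟩
  refine ⟨P, fun κ => ?_⟩
  have h1 : MvPolynomial.aeval (fun i : Fin d => MvPolynomial.esymm (Fin d) ℝ (i + 1)) P = Q := by
    rw [← MvPolynomial.esymmAlgHom_apply, hP]
  have h2 := hmap (MvPolynomial.eval κ)
  have h3 : X.map (MvPolynomial.eval κ) = Finset.univ.val.map κ := by
    rw [hX, Multiset.map_map]
    exact Multiset.map_congr rfl fun t _ => by simp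
  rw [h3] at h2
  rw [hX] at h3
  rw [pSums, ← h2, ← h1, MvPolynomial.aeval_def, ← MvPolynomial.coe_eval₂Hom,
    ← RingHom.comp_apply]
  refine DFunLike.congr_fun (MvPolynomial.ringHom_ext ?_ ?_) P
  · intro r; simp
  · intro i
    simp only [MvPolynomial.eval_X, RingHom.comp_apply, MvPolynomial.coe_eval₂Hom,
      MvPolynomial.eval₂_X]
    rw [MvPolynomial.esymm_eq_multiset_esymm, map_multiset_esymm]
    exact congrArg (fun s => Multiset.esymm s _) h3.symm

theorem contDiff_mvPolynomial_eval {σ : Type*} [Fintype σ] (P : MvPolynomial σ ℝ)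
    {n : WithTop ℕ∞} : ContDiff ℝ n fun x : σ → ℝ => MvPolynomial.eval x P := by
  induction P using MvPolynomial.induction_on with
  | C a => simpa using contDiff_const
  | add P Q hP hQ => simpa using hP.add hQ
  | mul_X P i hP => simpa using hP.mul (contDiff_apply ℝ ℝ i)

end SymmetricPolynomials

/-! ### Eigenvalues of compressions to a hyperplane, and their smooth symmetric functions. -/

section Operators

variable {E : Type*} [NormedAddCommGroup E] [InnerProductSpace ℝ E]

/-- The orthogonal projection onto the orthogonal complement of `ξ ≠ 0`. -/
noncomputable def tanProj (ξ : E) : E →L[ℝ] E :=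
  ContinuousLinearMap.id ℝ E - (‖ξ‖ ^ 2)⁻¹ • InnerProductSpace.rankOne ℝ ξ ξ

theorem tanProj_apply (ξ x : E) : tanProj ξ x = x - ((‖ξ‖ ^ 2)⁻¹ * ⟪ξ, x⟫) • ξ := by
  simp [tanProj, smul_smul]

theorem tanProj_self {ξ : E} (h : ξ ≠ 0) : tanProj ξ ξ = 0 := by
  have : ‖ξ‖ ^ 2 ≠ 0 := by simpa using h
  rw [tanProj_apply, real_inner_self_eq_norm_sq, inv_mul_cancel₀ this, one_smul, sub_self]

theorem tanProj_of_inner_eq_zero {ξ x : E} (h : ⟪ξ, x⟫ = 0) : tanProj ξ x = x := by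
  rw [tanProj_apply, h]; simp

theorem inner_tanProj_comm (ξ x y : E) : ⟪tanProj ξ x, y⟫ = ⟪x, tanProj ξ y⟫ := by
  simp only [tanProj_apply, inner_sub_left, inner_sub_right, real_inner_smul_left,
    real_inner_smul_right, real_inner_comm ξ x]
  ring

theorem contDiffAt_tanProj {ξ : E} (h : ξ ≠ 0) {n : WithTop ℕ∞} :
    ContDiffAt ℝ n (tanProj : E → E →L[ℝ] E) ξ := by
  unfold tanProj
  have h1 : ContDiffAt ℝ n (fun ξ : E => (‖ξ‖ ^ 2)⁻¹) ξ :=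
    (contDiff_norm_sq ℝ).contDiffAt.inv (by simpa using h)
  have h2 : ContDiffAt ℝ n (fun ξ : E => InnerProductSpace.rankOne ℝ ξ ξ) ξ :=
    (InnerProductSpace.rankOne ℝ : E →L[ℝ] E →L[ℝ] E →L[ℝ] E).contDiff.contDiffAt.clm_apply
      contDiffAt_id
  exact contDiffAt_const.sub (h1.smul h2)

/-- The restriction of the quadratic form of `A` to the orthogonal complement of `ξ`, extended by
zero, as an operator. -/
noncomputable def tanOp (ξ : E) (A : E →L[ℝ] E) : E →L[ℝ] E := tanProj ξ ∘L A ∘L tanProj ξ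

theorem contDiffAt_tanOp {z : E × (E →L[ℝ] E)} (h : z.1 ≠ 0) {n : WithTop ℕ∞} :
    ContDiffAt ℝ n (fun z : E × (E →L[ℝ] E) => tanOp z.1 z.2) z := by
  have h1 : ContDiffAt ℝ n (fun z : E × (E →L[ℝ] E) => tanProj z.1) z :=
    (contDiffAt_tanProj h).comp z contDiffAt_fst
  exact h1.clm_comp (contDiffAt_snd.clm_comp h1)

/-- The compression of `A` to the orthogonal complement of `ξ`. -/
noncomputable def compress (ξ : E) (A : E →L[ℝ] E) :
    (Submodule.span ℝ {ξ})ᗮ →ₗ[ℝ] (Submodule.span ℝ {ξ})ᗮ :=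
  (Submodule.span ℝ {ξ})ᗮ.orthogonalProjectionOnto.toLinearMap ∘ₗ
    A.toLinearMap ∘ₗ (Submodule.span ℝ {ξ})ᗮ.subtype

theorem inner_compress (ξ : E) (A : E →L[ℝ] E) (x y : (Submodule.span ℝ {ξ})ᗮ) :
    ⟪compress ξ A x, y⟫ = ⟪A x, (y : E)⟫ := by
  rw [compress, LinearMap.comp_apply, LinearMap.comp_apply]
  exact Submodule.inner_orthogonalProjectionOnto_eq_of_mem_right y _

theorem compress_isSymmetric (ξ : E) {A : E →L[ℝ] E} (hA : ∀ x y, ⟪A x, y⟫ = ⟪x, A y⟫) :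
    (compress ξ A).IsSymmetric := by
  intro x y
  rw [inner_compress, hA, ← real_inner_comm, ← inner_compress, real_inner_comm]

variable [FiniteDimensional ℝ E]

/-- The coefficients are polynomials in the coordinates of the operator. Single eigenvalues need not
be differentiable, so all smoothness passes through these coefficients. -/
theorem contDiff_charpoly_coeff (i : ℕ) {n : WithTop ℕ∞} :
    ContDiff ℝ n fun A : E →L[ℝ] E => (A : E →ₗ[ℝ] E).charpoly.coeff i := by
  classical
  set b := Module.finBasis ℝ (E →L[ℝ] E)
  set φ : (E →L[ℝ] E) →ₗ[ℝ] Module.End ℝ E := ContinuousLinearMap.coeLM ℝ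
  have h : ∀ A : E →L[ℝ] E, (A : E →ₗ[ℝ] E).charpoly.coeff i =
      MvPolynomial.eval (b.equivFunL A) ((φ.polyCharpoly b).coeff i) := by
    intro A
    exact (LinearMap.polyCharpoly_coeff_eval φ b A i).symm
  simp only [h]
  exact (contDiff_mvPolynomial_eval _).comp b.equivFunL.contDiff

theorem charpoly_eq_prod_of_basis {ι : Type*} [Fintype ι] [DecidableEq ι]
    (b : Module.Basis ι ℝ E) {T : E →ₗ[ℝ] E} {μ : ι → ℝ} (h : ∀ i, T (b i) = μ i • b i) :
    T.charpoly = ∏ i, (Polynomial.X - Polynomial.C (μ i)) := by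
  rw [← LinearMap.charpoly_toMatrix T b, ← Matrix.charpoly_diagonal]
  congr 1
  ext i j
  rw [LinearMap.toMatrix_apply, h, Matrix.diagonal_apply]
  simp only [map_smul, Module.Basis.repr_self, Finsupp.smul_apply, smul_eq_mul,
    Finsupp.single_apply]
  split_ifs with h1 h2 h2 <;> simp_all

theorem roots_charpoly_of_basis {ι : Type*} [Fintype ι] [DecidableEq ι]
    (b : Module.Basis ι ℝ E) {T : E →ₗ[ℝ] E} {μ : ι → ℝ} (h : ∀ i, T (b i) = μ i • b i) :
    T.charpoly.roots = Finset.univ.val.map μ := by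
  rw [charpoly_eq_prod_of_basis b h]
  exact Polynomial.roots_multiset_prod_X_sub_C (Finset.univ.val.map μ) ▸ by
    rw [Multiset.map_map]; rfl

/-- Monotonicity of the ordered eigenvalues. -/
theorem eigenvalues_le_eigenvalues {T₁ T₂ : E →ₗ[ℝ] E} (h₁ : T₁.IsSymmetric)
    (h₂ : T₂.IsSymmetric) {d : ℕ} (hd : Module.finrank ℝ E = d)
    (h : ∀ x, ⟪T₁ x, x⟫ ≤ ⟪T₂ x, x⟫) (i : Fin d) :
    h₁.eigenvalues hd i ≤ h₂.eigenvalues hd i := by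
  set e₁ := h₁.eigenvectorBasis hd
  set e₂ := h₂.eigenvectorBasis hd
  have hquad : ∀ {T : E →ₗ[ℝ] E} (hT : T.IsSymmetric) (x : E), ⟪T x, x⟫ =
      ∑ j, hT.eigenvalues hd j * ⟪hT.eigenvectorBasis hd j, x⟫ ^ 2 := by
    intro T hT x
    rw [← (hT.eigenvectorBasis hd).sum_inner_mul_inner]
    refine Finset.sum_congr rfl fun j _ => ?_
    rw [hT x, hT.apply_eigenvectorBasis, real_inner_smul_right, real_inner_comm]
    simp only [RCLike.ofReal_real_eq_id, id]
    ring
  have hnorm : ∀ (b : OrthonormalBasis (Fin d) ℝ E) (x : E), ⟪x, x⟫ = ∑ j, ⟪b j, x⟫ ^ 2 := by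
    intro b x
    rw [← b.sum_inner_mul_inner]
    exact Finset.sum_congr rfl fun j _ => by rw [real_inner_comm]; ring
  -- These are d - 1 linear conditions: no component along the eigenvectors of T₁ after i, none
  -- along those of T₂ before i. A nonzero vector survives, and its two quadratic forms separate the
  -- i-th eigenvalues.
  let f : E →ₗ[ℝ] ({j : Fin d // j ≠ i} → ℝ) := LinearMap.pi fun j =>
    if i < j.1 then (innerₛₗ ℝ (e₁ j.1)) else (innerₛₗ ℝ (e₂ j.1))
  have hker : LinearMap.ker f ≠ ⊥ := by
    apply LinearMap.ker_ne_bot_of_finrank_lt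
    rw [Module.finrank_fintype_fun_eq_card, hd]
    have := Fintype.card_subtype_lt (p := fun j : Fin d => j ≠ i) (x := i) (by simp)
    simpa using this
  obtain ⟨x, hx, hx0⟩ := Submodule.exists_mem_ne_zero_of_ne_bot hker
  have hfx : ∀ j (hj : j ≠ i), f x ⟨j, hj⟩ = 0 := fun j hj => by
    rw [LinearMap.mem_ker.1 hx]; rfl
  have hx1 : ∀ j, i < j → ⟪e₁ j, x⟫ = 0 := fun j hj => by
    simpa [f, hj] using hfx j hj.ne'
  have hx2 : ∀ j, j < i → ⟪e₂ j, x⟫ = 0 := fun j hj => by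
    simpa [f, hj.le, not_lt.2 hj.le] using hfx j hj.ne
  have key1 : h₁.eigenvalues hd i * ⟪x, x⟫ ≤ ⟪T₁ x, x⟫ := by
    rw [hquad h₁, hnorm e₁, Finset.mul_sum]
    refine Finset.sum_le_sum fun j _ => ?_
    rcases lt_or_ge i j with hj | hj
    · rw [hx1 j hj]; simp
    · exact mul_le_mul_of_nonneg_right (h₁.eigenvalues_antitone hd hj) (sq_nonneg _)
  have key2 : ⟪T₂ x, x⟫ ≤ h₂.eigenvalues hd i * ⟪x, x⟫ := by
    rw [hquad h₂, hnorm e₂, Finset.mul_sum]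
    refine Finset.sum_le_sum fun j _ => ?_
    rcases lt_or_ge j i with hj | hj
    · rw [hx2 j hj]; simp
    · exact mul_le_mul_of_nonneg_right (h₂.eigenvalues_antitone hd hj) (sq_nonneg _)
  have hpos : 0 < ⟪x, x⟫ := real_inner_self_pos.2 hx0
  exact le_of_mul_le_mul_right (key1.trans ((h x).trans key2)) hpos

/-- The eigenvalues of the compression of `A` to the orthogonal complement of `ξ`. -/
noncomputable def curv (ξ : E) (A : E →L[ℝ] E) : Multiset ℝ := (compress ξ A).charpoly.roots

/-- The extension by zero acts on a space that does not vary with ξ, at the price of one extra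
eigenvalue 0 in the direction ξ. -/
theorem roots_charpoly_tanOp_of_basis {ι : Type*} [Fintype ι] [DecidableEq ι]
    (b : OrthonormalBasis (Option ι) ℝ E) {ξ : E} (hξ : ξ ≠ 0) {c : ℝ} (hb : ξ = c • b none)
    {A : E →L[ℝ] E} {κ : ι → ℝ}
    (h : ∀ i j : ι, ⟪A (b (some i)), b (some j)⟫ = if i = j then κ i else 0) :
    (tanOp ξ A : E →ₗ[ℝ] E).charpoly.roots = 0 ::ₘ Finset.univ.val.map κ := by
  have hc : c ≠ 0 := by rintro rfl; simp at hb; exact hξ hb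
  have horth : ∀ i, ⟪ξ, b (some i)⟫ = 0 := fun i => by
    rw [hb, real_inner_smul_left, b.orthonormal.2 (by simp), mul_zero]
  have hnone : tanProj ξ (b none) = 0 := by
    have : b none = c⁻¹ • ξ := by rw [hb, smul_smul, inv_mul_cancel₀ hc, one_smul]
    rw [this, map_smul, tanProj_self hξ, smul_zero]
  rw [roots_charpoly_of_basis b.toBasis (μ := fun o => o.elim 0 κ)]
  · simp [univ_option, Finset.insertNone, Function.comp_def]
  · intro o
    rw [OrthonormalBasis.coe_toBasis]
    cases o with
    | none => simp [tanOp, hnone]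
    | some i =>
      simp only [Option.elim_some]
      refine InnerProductSpace.ext_inner_right_basis b.toBasis fun o => ?_
      rw [OrthonormalBasis.coe_toBasis]
      simp only [tanOp, ContinuousLinearMap.coe_coe, ContinuousLinearMap.comp_apply]
      rw [inner_tanProj_comm, tanProj_of_inner_eq_zero (horth i), real_inner_smul_left]
      cases o with
      | none => rw [hnone, inner_zero_right, b.orthonormal.2 (by simp), mul_zero]
      | some j =>
        rw [tanProj_of_inner_eq_zero (horth j), h, orthonormal_iff_ite.1 b.orthonormal]
        simp

theorem exists_basis_compress {d : ℕ} (hd : Module.finrank ℝ E = d + 1) {ξ : E} (hξ : ξ ≠ 0)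
    {A : E →L[ℝ] E} (hA : ∀ x y, ⟪A x, y⟫ = ⟪x, A y⟫) :
    ∃ (κ : Fin d → ℝ) (b : OrthonormalBasis (Option (Fin d)) ℝ E),
      ξ = ‖ξ‖ • b none ∧ curv ξ A = Finset.univ.val.map κ ∧
      ∀ i j : Fin d, ⟪A (b (some i)), b (some j)⟫ = if i = j then κ i else 0 := by
  have : Fact (Module.finrank ℝ E = d + 1) := ⟨hd⟩
  have hn : ‖ξ‖ ≠ 0 := norm_ne_zero_iff.2 hξ
  have hV : Module.finrank ℝ (Submodule.span ℝ {ξ})ᗮ = d :=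
    Submodule.finrank_orthogonal_span_singleton hξ
  have hs := compress_isSymmetric ξ hA
  set e := hs.eigenvectorBasis hV
  let v : Option (Fin d) → E := fun o => o.elim (‖ξ‖⁻¹ • ξ) fun i => (e i : E)
  have hperp : ∀ i, ⟪ξ, (e i : E)⟫ = 0 := fun i =>
    Submodule.mem_orthogonal_singleton_iff_inner_right.1 (e i).2
  have hv : Orthonormal ℝ v := by
    rw [orthonormal_iff_ite]
    rintro (_ | i) (_ | j)
    · simp [v, norm_smul, hn]
    · simp [v, real_inner_smul_left, hperp]
    · rw [real_inner_comm]
      simp [v, real_inner_smul_left, hperp]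
    · simpa [v] using orthonormal_iff_ite.1 e.orthonormal i j
  have hcard : Fintype.card (Option (Fin d)) = Module.finrank ℝ E := by simp [hd]
  set B := basisOfOrthonormalOfCardEqFinrank hv hcard
  have hB : ⇑B = v := coe_basisOfOrthonormalOfCardEqFinrank hv hcard
  refine ⟨hs.eigenvalues hV, B.toOrthonormalBasis (by rw [hB]; exact hv), ?_, ?_, ?_⟩
  · simp [hB, v, smul_smul, hn]
  · rw [curv, hs.roots_charpoly_eq_eigenvalues hV]; rfl
  · intro i j
    simp only [Module.Basis.coe_toOrthonormalBasis, hB, v, Option.elim_some]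
    rw [← inner_compress, hs.apply_eigenvectorBasis, real_inner_smul_left,
      orthonormal_iff_ite.1 e.orthonormal]
    simp

variable {ξ : E} {A : E →L[ℝ] E}

theorem roots_charpoly_tanOp (hξ : ξ ≠ 0) (hA : ∀ x y, ⟪A x, y⟫ = ⟪x, A y⟫) :
    (tanOp ξ A : E →ₗ[ℝ] E).charpoly.roots = 0 ::ₘ curv ξ A := by
  obtain ⟨d, hd⟩ : ∃ d, Module.finrank ℝ E = d + 1 := by
    have : Nontrivial E := ⟨ξ, 0, hξ⟩
    exact ⟨Module.finrank ℝ E - 1, by have := Module.finrank_pos (R := ℝ) (M := E); omega⟩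
  obtain ⟨κ, b, h1, h2, h3⟩ := exists_basis_compress hd hξ hA
  rw [roots_charpoly_tanOp_of_basis b hξ h1 h3, h2]

theorem curv_of_basis {ι : Type*} [Fintype ι] [DecidableEq ι]
    (b : OrthonormalBasis (Option ι) ℝ E) (hξ : ξ ≠ 0) {c : ℝ} (hb : ξ = c • b none)
    (hA : ∀ x y, ⟪A x, y⟫ = ⟪x, A y⟫) {κ : ι → ℝ}
    (h : ∀ i j : ι, ⟪A (b (some i)), b (some j)⟫ = if i = j then κ i else 0) :
    curv ξ A = Finset.univ.val.map κ := by
  have h1 := roots_charpoly_tanOp hξ hA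
  rw [roots_charpoly_tanOp_of_basis b hξ hb h] at h1
  exact ((Multiset.cons_inj_right 0).1 h1).symm

theorem curv_smul_left (hξ : ξ ≠ 0) {c : ℝ} (hc : c ≠ 0)
    (hA : ∀ x y, ⟪A x, y⟫ = ⟪x, A y⟫) : curv (c • ξ) A = curv ξ A := by
  have h : tanOp (c • ξ) A = tanOp ξ A := by
    have : tanProj (c • ξ) = tanProj ξ := by
      ext x
      rw [tanProj_apply, tanProj_apply, norm_smul, real_inner_smul_left, smul_smul, mul_pow,
        Real.norm_eq_abs, sq_abs]
      congr 2
      field_simp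
    rw [tanOp, this, tanOp]
  have h1 := roots_charpoly_tanOp (smul_ne_zero hc hξ) hA
  rw [h, roots_charpoly_tanOp hξ hA] at h1
  exact ((Multiset.cons_inj_right 0).1 h1).symm

theorem curv_smul_right (hξ : ξ ≠ 0) (c : ℝ) (hA : ∀ x y, ⟪A x, y⟫ = ⟪x, A y⟫) :
    curv ξ (c • A) = (curv ξ A).map (c * ·) := by
  obtain ⟨d, hd⟩ : ∃ d, Module.finrank ℝ E = d + 1 := by
    have : Nontrivial E := ⟨ξ, 0, hξ⟩
    exact ⟨Module.finrank ℝ E - 1, by have := Module.finrank_pos (R := ℝ) (M := E); omega⟩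
  obtain ⟨κ, b, h1, h2, h3⟩ := exists_basis_compress hd hξ hA
  rw [h2, Multiset.map_map]
  refine curv_of_basis b hξ h1 ?_ ?_
  · intro x y
    simp [real_inner_smul_left, real_inner_smul_right, hA]
  · intro i j
    simp only [smul_apply, real_inner_smul_left, h3]
    split_ifs <;> simp

/-- Only the bilinear form on the complement of ξ matters. No symmetry is assumed, so this applies
to the full derivative of the extended normal field. -/
theorem curv_congr {A' : E →L[ℝ] E}
    (h : ∀ x y, ⟪ξ, x⟫ = 0 → ⟪ξ, y⟫ = 0 → ⟪A x, y⟫ = ⟪A' x, y⟫) : curv ξ A = curv ξ A' := by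
  rw [curv, curv]
  congr 2
  refine LinearMap.ext fun x => ext_inner_right ℝ fun y => ?_
  rw [inner_compress, inner_compress]
  exact h x y (Submodule.mem_orthogonal_singleton_iff_inner_right.1 x.2)
    (Submodule.mem_orthogonal_singleton_iff_inner_right.1 y.2)

/-- Rotation invariance: the extensions by zero are conjugate and hence have the same characteristic
polynomial. -/
theorem curv_conj (hξ : ξ ≠ 0) (hA : ∀ x y, ⟪A x, y⟫ = ⟪x, A y⟫) (R : E ≃ₗᵢ[ℝ] E)
    {A' : E →L[ℝ] E} (h : ∀ x, A' x = R (A (R.symm x))) : curv (R ξ) A' = curv ξ A := by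
  have hA' : ∀ x y, ⟪A' x, y⟫ = ⟪x, A' y⟫ := by
    intro x y
    rw [h, h, ← R.symm.inner_map_map, R.symm_apply_apply, hA, ← R.inner_map_map,
      R.apply_symm_apply]
  have hR : R ξ ≠ 0 := by simpa using hξ
  have hP : ∀ x, tanProj (R ξ) x = R (tanProj ξ (R.symm x)) := by
    intro x
    rw [tanProj_apply, tanProj_apply, map_sub, map_smul, R.norm_map, R.apply_symm_apply,
      ← R.inner_map_map ξ, R.apply_symm_apply]
  have hop : (tanOp (R ξ) A' : E →ₗ[ℝ] E) =
      R.toLinearEquiv.conj (tanOp ξ A : E →ₗ[ℝ] E) := by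
    ext x
    simp [tanOp, hP, h, LinearEquiv.conj_apply]
  have h1 := roots_charpoly_tanOp hR hA'
  rw [hop, LinearEquiv.charpoly_conj, roots_charpoly_tanOp hξ hA] at h1
  exact ((Multiset.cons_inj_right 0).1 h1).symm

theorem pSums_curv_rel_mono {A' : E →L[ℝ] E} (hA : ∀ x y, ⟪A x, y⟫ = ⟪x, A y⟫)
    (hA' : ∀ x y, ⟪A' x, y⟫ = ⟪x, A' y⟫) (h : ∀ x, ⟪ξ, x⟫ = 0 → ⟪A x, x⟫ ≤ ⟪A' x, x⟫) (p : ℕ) :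
    Multiset.Rel (· ≤ ·) (pSums p (curv ξ A)) (pSums p (curv ξ A')) := by
  have hs := compress_isSymmetric ξ hA
  have hs' := compress_isSymmetric ξ hA'
  have e : curv ξ A = Finset.univ.val.map (hs.eigenvalues rfl) := by
    rw [curv, hs.roots_charpoly_eq_eigenvalues rfl]; rfl
  have e' : curv ξ A' = Finset.univ.val.map (hs'.eigenvalues rfl) := by
    rw [curv, hs'.roots_charpoly_eq_eigenvalues rfl]; rfl
  rw [e, e', pSums_map_univ, pSums_map_univ, Multiset.rel_map]
  refine Multiset.rel_refl_of_refl_on fun I _ => Finset.sum_le_sum fun i _ => ?_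
  refine eigenvalues_le_eigenvalues hs hs' rfl (fun x => ?_) i
  rw [inner_compress, inner_compress]
  exact h x (Submodule.mem_orthogonal_singleton_iff_inner_right.1 x.2)

/-- `σ_j(Λ(κ))`, for the eigenvalues `κ` of the compression of `A` to the orthogonal complement of
`ξ`, is a smooth function of `(ξ, A)`. -/
theorem exists_smooth_esymm_pSums_curv {d : ℕ} (hd : Module.finrank ℝ E = d + 1) (p j : ℕ) :
    ∃ Φ : E × (E →L[ℝ] E) → ℝ, (∀ z, z.1 ≠ 0 → ContDiffAt ℝ 1 Φ z) ∧
      ∀ (ξ : E) (A : E →L[ℝ] E), ξ ≠ 0 → (∀ x y, ⟪A x, y⟫ = ⟪x, A y⟫) →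
        Φ (ξ, A) = (pSums p (curv ξ A)).esymm j := by
  obtain ⟨P, hP⟩ := exists_polynomial_pSums d p j
  -- By Vieta the signed coefficient of degree d - i is σ_{i+1} of all d + 1 eigenvalues, and the
  -- extra eigenvalue 0 does not change it.
  refine ⟨fun z => MvPolynomial.eval (fun i : Fin d => (-1) ^ ((i : ℕ) + 1) *
    (tanOp z.1 z.2 : E →ₗ[ℝ] E).charpoly.coeff (d - i)) P, ?_, ?_⟩
  · intro z hz
    refine (contDiff_mvPolynomial_eval P).contDiffAt.comp z ?_
    rw [contDiffAt_pi]
    intro i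
    exact contDiffAt_const.mul
      ((contDiff_charpoly_coeff (E := E) (d - i)).contDiffAt.comp z (contDiffAt_tanOp hz))
  · intro ξ A hξ hA
    obtain ⟨κ, b, h1, h2, h3⟩ := exists_basis_compress hd hξ hA
    rw [h2, ← hP κ]
    refine congrArg (fun x : Fin d → ℝ => MvPolynomial.eval x P) (funext fun i => ?_)
    have hr := roots_charpoly_tanOp hξ hA
    have hdeg : (tanOp ξ A : E →ₗ[ℝ] E).charpoly.natDegree = d + 1 := by
      rw [LinearMap.charpoly_natDegree, hd]
    have hc := Polynomial.coeff_eq_esymm_roots_of_card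
      (p := (tanOp ξ A : E →ₗ[ℝ] E).charpoly) (by rw [hr, hdeg]; simp [h2]) (k := d - i)
      (by omega)
    rw [hdeg, (LinearMap.charpoly_monic _).leadingCoeff, one_mul,
      show d + 1 - (d - (i : ℕ)) = i + 1 by omega, hr, h2, esymm_cons, zero_mul, add_zero] at hc
    simp only [hc, ← mul_assoc, ← mul_pow]
    simp

end Operators

/-! ### Gradients, Hessians and the second derivative test. -/

section Calculus

variable {E : Type*} [NormedAddCommGroup E] [InnerProductSpace ℝ E]

/-- Difference quotients of a strictly differentiable function along two moving points. -/
theorem tendsto_smul_sub_of_hasStrictFDerivAt {F G ι : Type*} [NormedAddCommGroup F]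
    [NormedSpace ℝ F] [NormedAddCommGroup G] [NormedSpace ℝ G] {f : F → G} {f' : F →L[ℝ] G}
    {a d : F} (hf : HasStrictFDerivAt f f' a) {l : Filter ι} {x y : ι → F} {r : ι → ℝ}
    (hx : Tendsto x l (𝓝 a)) (hy : Tendsto y l (𝓝 a))
    (hd : Tendsto (fun i => r i • (y i - x i)) l (𝓝 d)) :
    Tendsto (fun i => r i • (f (y i) - f (x i))) l (𝓝 (f' d)) := by
  have h1 : (fun i => f (y i) - f (x i) - f' (y i - x i)) =o[l] fun i => y i - x i :=
    hf.isLittleO.comp_tendsto (hy.prodMk_nhds hx)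
  have h2 : (fun i => r i • (f (y i) - f (x i) - f' (y i - x i))) =o[l]
      fun i => r i • (y i - x i) := (Asymptotics.isBigO_refl r l).smul_isLittleO h1
  have h3 := (h2.trans_isBigO (hd.isBigO_one ℝ)).tendsto_zero_of_tendsto tendsto_const_nhds
  have h4 := h3.add ((f'.continuous.tendsto d).comp hd)
  rw [zero_add] at h4
  refine h4.congr fun i => ?_
  simp only [Function.comp_apply, map_sub, map_smul, smul_sub]
  abel

theorem eventually_contDiffAt_two {f : E → ℝ} {x : E} (hf : ContDiffAt ℝ 2 f x) :
    ∀ᶠ y in 𝓝 x, ContDiffAt ℝ 2 f y := hf.eventually (by simp)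

theorem contDiff_inner_clm (B : E →L[ℝ] E) {n : WithTop ℕ∞} :
    ContDiff ℝ n fun x : E => ⟪B x, x⟫ := B.contDiff.inner ℝ contDiff_id

/-- A function that is homogeneous of degree zero and has a maximum on the unit sphere at `y` has a
local maximum at `y`. -/
theorem isLocalMax_of_sphere {D : E → ℝ} {y : E} (hy : ‖y‖ = 1)
    (hD : ∀ t : ℝ, 0 < t → ∀ x, x ≠ 0 → D (t • x) = D x)
    (hmax : ∀ x, ‖x‖ = 1 → D x ≤ D y) : IsLocalMax D y := by
  have hy0 : y ≠ 0 := by rintro rfl; simp at hy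
  filter_upwards [isOpen_ne.mem_nhds hy0] with x hx
  have hx0 : 0 < ‖x‖ := norm_pos_iff.2 hx
  rw [← hD ‖x‖⁻¹ (inv_pos.2 hx0) x hx]
  exact hmax _ (by rw [norm_smul, norm_inv, norm_norm, inv_mul_cancel₀ hx0.ne'])

variable [CompleteSpace E]

/-- The Hessian of `f`, as an operator. -/
noncomputable def hess (f : E → ℝ) (x : E) : E →L[ℝ] E := fderiv ℝ (gradient f) x

theorem contDiffAt_gradient {f : E → ℝ} {x : E} (hf : ContDiffAt ℝ 2 f x) :
    ContDiffAt ℝ 1 (gradient f) x :=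
  (InnerProductSpace.toDual ℝ E).symm.contDiff.contDiffAt.comp x
    (hf.fderiv_right (m := 1) (by norm_num))

theorem hasStrictFDerivAt_of_contDiffAt_two {f : E → ℝ} {x : E} (hf : ContDiffAt ℝ 2 f x) :
    HasStrictFDerivAt f (innerSL ℝ (gradient f x)) x := by
  have h := hf.hasStrictFDerivAt (by norm_num)
  have e : innerSL ℝ (gradient f x) = fderiv ℝ f x := by
    ext y
    rw [innerSL_apply_apply, inner_gradient_left]
  rwa [e]

theorem hasStrictFDerivAt_gradient {f : E → ℝ} {x : E} (hf : ContDiffAt ℝ 2 f x) :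
    HasStrictFDerivAt (gradient f) (hess f x) x :=
  (contDiffAt_gradient hf).hasStrictFDerivAt one_ne_zero

theorem hess_symm {f : E → ℝ} {x : E} (hf : ContDiffAt ℝ 2 f x) (a b : E) :
    ⟪hess f x a, b⟫ = ⟪a, hess f x b⟫ := by
  have h1 : ∀ c : E, hess f x c = (InnerProductSpace.toDual ℝ E).symm
      (fderiv ℝ (fderiv ℝ f) x c) := by
    intro c
    have h2 : HasFDerivAt (fderiv ℝ f) (fderiv ℝ (fderiv ℝ f) x) x :=
      ((hf.fderiv_right (m := 1) (by norm_num)).differentiableAt one_ne_zero).hasFDerivAt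
    have h3 := (((InnerProductSpace.toDual ℝ E).symm.toContinuousLinearEquiv :
      _ ≃L[ℝ] E).hasFDerivAt (x := fderiv ℝ f x)).comp x h2
    have h4 : hess f x = _ := h3.fderiv
    rw [h4]; rfl
  have h5 := hf.isSymmSndFDerivAt (by simp)
  rw [h1, h1, InnerProductSpace.toDual_symm_apply, real_inner_comm,
    InnerProductSpace.toDual_symm_apply]
  exact h5 a b

theorem continuousAt_hess {f : E → ℝ} {x : E} (hf : ContDiffAt ℝ 2 f x) :
    ContinuousAt (hess f) x :=
  ((contDiffAt_gradient hf).fderiv_right (m := 0) (by norm_num)).continuousAt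

theorem gradient_eq_of_hasFDerivAt {f : E → ℝ} {x g : E} {f' : E →L[ℝ] ℝ}
    (h : HasFDerivAt f f' x) (hg : ∀ y, f' y = ⟪g, y⟫) : gradient f x = g := by
  refine ext_inner_right ℝ fun y => ?_
  rw [inner_gradient_left, h.fderiv, hg]

theorem gradient_sub' {f g : E → ℝ} {x : E} (hf : ContDiffAt ℝ 2 f x)
    (hg : ContDiffAt ℝ 2 g x) :
    gradient (fun y => f y - g y) x = gradient f x - gradient g x := by
  refine gradient_eq_of_hasFDerivAt ((hasStrictFDerivAt_of_contDiffAt_two hf).hasFDerivAt.sub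
    (hasStrictFDerivAt_of_contDiffAt_two hg).hasFDerivAt) fun y => ?_
  simp [inner_sub_left]

theorem hess_sub {f g : E → ℝ} {x : E} (hf : ContDiffAt ℝ 2 f x) (hg : ContDiffAt ℝ 2 g x) :
    hess (fun y => f y - g y) x = hess f x - hess g x := by
  have h1 : gradient (fun y => f y - g y) =ᶠ[𝓝 x] fun y => gradient f y - gradient g y := by
    filter_upwards [eventually_contDiffAt_two hf, eventually_contDiffAt_two hg] with y h1 h2
    exact gradient_sub' h1 h2
  rw [hess, h1.fderiv_eq]
  exact ((hasStrictFDerivAt_gradient hf).hasFDerivAt.sub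
    (hasStrictFDerivAt_gradient hg).hasFDerivAt).fderiv

theorem gradient_mul' {f g : E → ℝ} {x : E} (hf : ContDiffAt ℝ 2 f x)
    (hg : ContDiffAt ℝ 2 g x) :
    gradient (fun y => f y * g y) x = g x • gradient f x + f x • gradient g x := by
  refine gradient_eq_of_hasFDerivAt ((hasStrictFDerivAt_of_contDiffAt_two hf).hasFDerivAt.mul
    (hasStrictFDerivAt_of_contDiffAt_two hg).hasFDerivAt) fun y => ?_
  simp [inner_add_left, real_inner_smul_left]
  ring

theorem hess_mul {f g : E → ℝ} {x : E} (hf : ContDiffAt ℝ 2 f x) (hg : ContDiffAt ℝ 2 g x)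
    (h0 : f x = 0) (h1 : gradient f x = 0) :
    hess (fun y => f y * g y) x = g x • hess f x := by
  have h2 : gradient (fun y => f y * g y) =ᶠ[𝓝 x]
      fun y => g y • gradient f y + f y • gradient g y := by
    filter_upwards [eventually_contDiffAt_two hf, eventually_contDiffAt_two hg] with y h1 h2
    exact gradient_mul' h1 h2
  rw [hess, h2.fderiv_eq]
  have h3 := ((hasStrictFDerivAt_of_contDiffAt_two hg).hasFDerivAt.smul
    (hasStrictFDerivAt_gradient hf).hasFDerivAt).add
    ((hasStrictFDerivAt_of_contDiffAt_two hf).hasFDerivAt.smul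
      (hasStrictFDerivAt_gradient hg).hasFDerivAt)
  refine h3.fderiv.trans ?_
  ext y
  simp [h0, h1]

theorem gradient_comp_clm {f : E → ℝ} {J : E →L[ℝ] E} {x : E} (hf : ContDiffAt ℝ 2 f (J x)) :
    gradient (fun y => f (J y)) x = ContinuousLinearMap.adjoint J (gradient f (J x)) := by
  refine gradient_eq_of_hasFDerivAt
    ((hasStrictFDerivAt_of_contDiffAt_two hf).hasFDerivAt.comp x J.hasFDerivAt) fun y => ?_
  simp [ContinuousLinearMap.adjoint_inner_left]

theorem hess_comp_clm {f : E → ℝ} {J : E →L[ℝ] E} {x : E} (hf : ContDiffAt ℝ 2 f (J x)) :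
    hess (fun y => f (J y)) x =
      ContinuousLinearMap.adjoint J ∘L (hess f (J x)) ∘L J := by
  have h1 : gradient (fun y => f (J y)) =ᶠ[𝓝 x]
      fun y => ContinuousLinearMap.adjoint J (gradient f (J y)) := by
    filter_upwards [J.continuous.continuousAt.eventually (eventually_contDiffAt_two hf)] with y hy
    exact gradient_comp_clm hy
  rw [hess, h1.fderiv_eq]
  exact ((ContinuousLinearMap.adjoint J).hasFDerivAt.comp x
    ((hasStrictFDerivAt_gradient hf).hasFDerivAt.comp x J.hasFDerivAt)).fderiv

theorem gradient_inner_clm {B : E →L[ℝ] E} (hB : ∀ x y, ⟪B x, y⟫ = ⟪x, B y⟫) (x : E) :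
    gradient (fun x : E => ⟪B x, x⟫) x = (2 : ℝ) • B x := by
  refine gradient_eq_of_hasFDerivAt (B.hasFDerivAt.inner ℝ (hasFDerivAt_id x)) fun y => ?_
  simp only [fderivInnerCLM_apply, ContinuousLinearMap.comp_apply,
    ContinuousLinearMap.prod_apply, ContinuousLinearMap.id_apply, real_inner_smul_left, hB y x,
    real_inner_comm (B x) y]
  ring

theorem hess_inner_clm {B : E →L[ℝ] E} (hB : ∀ x y, ⟪B x, y⟫ = ⟪x, B y⟫) (x : E) :
    hess (fun x : E => ⟪B x, x⟫) x = (2 : ℝ) • B := by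
  have : gradient (fun x : E => ⟪B x, x⟫) = fun x => ((2 : ℝ) • B) x :=
    funext fun x => gradient_inner_clm hB x
  rw [hess, this]
  exact ((2 : ℝ) • B).fderiv

theorem gradient_eq_zero_of_isLocalMax {f : E → ℝ} {x : E} (h : IsLocalMax f x) :
    gradient f x = 0 := by
  simp [gradient, h.fderiv_eq_zero]

/-- The second derivative test: the Hessian is nonpositive at a local maximum. -/
theorem hess_nonpos_of_isLocalMax {f : E → ℝ} {x : E} (hf : ContDiffAt ℝ 2 f x)
    (h : IsLocalMax f x) (a : E) : ⟪hess f x a, a⟫ ≤ 0 := by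
  by_contra hpos
  push Not at hpos
  have hline : ∀ t : ℝ, HasDerivAt (fun t : ℝ => x + t • a) a t := fun t => by
    simpa using ((hasDerivAt_id t).smul_const a).const_add x
  have hcont : Tendsto (fun t : ℝ => x + t • a) (𝓝 0) (𝓝 x) := by
    have := (hline 0).continuousAt.tendsto
    simpa using this
  have hd1 : deriv (fun t : ℝ => f (x + t • a)) =ᶠ[𝓝 0]
      fun t : ℝ => ⟪gradient f (x + t • a), a⟫ := by
    filter_upwards [hcont.eventually (eventually_contDiffAt_two hf)] with t ht
    exact ((hasStrictFDerivAt_of_contDiffAt_two ht).hasFDerivAt.comp_hasDerivAt t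
      (hline t)).deriv
  have hd2 : HasDerivAt (fun t : ℝ => ⟪gradient f (x + t • a), a⟫) ⟪hess f x a, a⟫ 0 := by
    have h1 : HasFDerivAt (gradient f) (hess f x) (x + (0 : ℝ) • a) := by
      simpa using (hasStrictFDerivAt_gradient hf).hasFDerivAt
    have h2 := (h1.comp_hasDerivAt (0 : ℝ) (hline 0)).inner ℝ (hasDerivAt_const (0 : ℝ) a)
    simpa using h2
  have hdd : deriv (deriv fun t : ℝ => f (x + t • a)) 0 = ⟪hess f x a, a⟫ := by
    rw [hd1.deriv_eq, hd2.deriv]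
  have hd0 : deriv (fun t : ℝ => f (x + t • a)) 0 = 0 := by
    rw [hd1.self_of_nhds]
    simp [gradient_eq_zero_of_isLocalMax h]
  have hc : ContinuousAt (fun t : ℝ => f (x + t • a)) 0 := by
    refine ContinuousAt.comp (f := fun t : ℝ => x + t • a) ?_ (hline 0).continuousAt
    simpa using hf.continuousAt
  -- A positive second derivative along the line would make the point a local minimum too. The
  -- restriction would then be locally constant, with second derivative zero.
  have hmin := isLocalMin_of_deriv_deriv_pos (hdd ▸ hpos) hd0 hc
  have hmax : ∀ᶠ t : ℝ in 𝓝 0, f (x + t • a) ≤ f x := hcont.eventually h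
  have hconst : (fun t : ℝ => f (x + t • a)) =ᶠ[𝓝 0] fun _ => f x := by
    filter_upwards [hmin, hmax] with t h1 h2
    exact le_antisymm h2 (by simpa using h1)
  have hz : deriv (deriv fun t : ℝ => f (x + t • a)) 0 = 0 := by
    rw [hconst.deriv.deriv_eq]
    simp
  rw [hdd] at hz
  exact hpos.ne' hz

end Calculus

/-! ### Log-homogeneous functions. -/

section LogHomogeneous

variable {E : Type*} [NormedAddCommGroup E] [InnerProductSpace ℝ E] [CompleteSpace E]

/-- `v` is of class `C²` away from the origin and `v (t X) = v X + log t`. -/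
structure LogHomogeneous (v : E → ℝ) : Prop where
  contDiffAt : ∀ x, x ≠ 0 → ContDiffAt ℝ 2 v x
  smul : ∀ t : ℝ, 0 < t → ∀ x, x ≠ 0 → v (t • x) = v x + Real.log t

variable {v : E → ℝ}

theorem LogHomogeneous.gradient_smul (h : LogHomogeneous v) {t : ℝ} (ht : 0 < t) {x : E}
    (hx : x ≠ 0) : gradient v (t • x) = t⁻¹ • gradient v x := by
  have h1 : (fun y => v (t • y)) =ᶠ[𝓝 x] fun y => v y + Real.log t := by
    filter_upwards [isOpen_ne.mem_nhds hx] with y hy using h.smul t ht y hy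
  have h2 := gradient_comp_clm (J := t • ContinuousLinearMap.id ℝ E) (x := x) (f := v)
    (by simpa using h.contDiffAt _ (smul_ne_zero ht.ne' hx))
  have h3 : gradient (fun y => v y + Real.log t) x = gradient v x :=
    gradient_eq_of_hasFDerivAt ((hasStrictFDerivAt_of_contDiffAt_two
      (h.contDiffAt x hx)).hasFDerivAt.add_const _) fun y => rfl
  have h4 := h1.gradient_eq
  rw [h3] at h4
  simp only [smul_apply, ContinuousLinearMap.id_apply] at h2
  rw [h4] at h2
  have h5 : ContinuousLinearMap.adjoint (t • ContinuousLinearMap.id ℝ E) (gradient v (t • x)) =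
      t • gradient v (t • x) := by
    refine ext_inner_right ℝ fun y => ?_
    rw [ContinuousLinearMap.adjoint_inner_left]
    simp [real_inner_smul_left]
  rw [h2, h5, smul_smul, inv_mul_cancel₀ ht.ne', one_smul]

theorem LogHomogeneous.hess_smul (h : LogHomogeneous v) {t : ℝ} (ht : 0 < t) {x : E}
    (hx : x ≠ 0) : hess v (t • x) = (t⁻¹ ^ 2) • hess v x := by
  have h1 : (fun y => gradient v (t • y)) =ᶠ[𝓝 x] fun y => t⁻¹ • gradient v y := by
    filter_upwards [isOpen_ne.mem_nhds hx] with y hy using h.gradient_smul ht hy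
  have h2 : HasFDerivAt (fun y => gradient v (t • y))
      ((hess v (t • x)) ∘L (t • ContinuousLinearMap.id ℝ E)) x :=
    (hasStrictFDerivAt_gradient (h.contDiffAt _ (smul_ne_zero ht.ne' hx))).hasFDerivAt.comp x
      ((hasFDerivAt_id x).const_smul t)
  have h3 : HasFDerivAt (fun y => t⁻¹ • gradient v y) (t⁻¹ • hess v x) x :=
    (hasStrictFDerivAt_gradient (h.contDiffAt _ hx)).hasFDerivAt.const_smul _
  have h4 := (h2.congr_of_eventuallyEq h1.symm).unique h3
  rw [ContinuousLinearMap.comp_smul, ContinuousLinearMap.comp_id] at h4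
  rw [pow_two, mul_smul, ← h4, smul_smul, inv_mul_cancel₀ ht.ne', one_smul]

theorem LogHomogeneous.inner_gradient_self (h : LogHomogeneous v) {x : E} (hx : x ≠ 0) :
    ⟪gradient v x, x⟫ = 1 := by
  have h0 : HasDerivAt (fun t : ℝ => t • x) x 1 := by
    simpa using (hasDerivAt_id (1 : ℝ)).smul_const x
  have h1 : HasDerivAt (fun t : ℝ => v (t • x)) ⟪gradient v x, x⟫ 1 := by
    have h2 : HasFDerivAt v (innerSL ℝ (gradient v x)) ((1 : ℝ) • x) := by
      simpa using (hasStrictFDerivAt_of_contDiffAt_two (h.contDiffAt x hx)).hasFDerivAt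
    exact h2.comp_hasDerivAt 1 h0
  have h3 : HasDerivAt (fun t : ℝ => v x + Real.log t) 1 1 := by
    simpa using (Real.hasDerivAt_log one_ne_zero).const_add (v x)
  refine h1.unique (h3.congr_of_eventuallyEq ?_)
  filter_upwards [lt_mem_nhds one_pos] with t ht using h.smul t ht x hx

theorem LogHomogeneous.gradient_ne_zero (h : LogHomogeneous v) {x : E} (hx : x ≠ 0) :
    gradient v x ≠ 0 := by
  intro h0
  have := h.inner_gradient_self hx
  rw [h0, inner_zero_left] at this
  exact zero_ne_one this

theorem LogHomogeneous.hess_self (h : LogHomogeneous v) {x : E} (hx : x ≠ 0) :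
    hess v x x = -gradient v x := by
  have h0 : HasDerivAt (fun t : ℝ => t • x) x 1 := by
    simpa using (hasDerivAt_id (1 : ℝ)).smul_const x
  have h1 : HasDerivAt (fun t : ℝ => gradient v (t • x)) (hess v x x) 1 := by
    have h2 : HasFDerivAt (gradient v) (hess v x) ((1 : ℝ) • x) := by
      simpa using (hasStrictFDerivAt_gradient (h.contDiffAt x hx)).hasFDerivAt
    exact h2.comp_hasDerivAt 1 h0
  have h3 : HasDerivAt (fun t : ℝ => t⁻¹ • gradient v x) (-gradient v x) 1 := by
    simpa using (hasDerivAt_inv (one_ne_zero (α := ℝ))).smul_const (gradient v x)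
  refine h1.unique (h3.congr_of_eventuallyEq ?_)
  filter_upwards [lt_mem_nhds one_pos] with t ht using h.gradient_smul ht hx

/-- At a maximum point of `|∇v|` on the unit sphere, `∇v` is mapped by the Hessian to a multiple of
the position vector. -/
theorem LogHomogeneous.hess_gradient_of_isMax (h : LogHomogeneous v) {x : E} (hx : ‖x‖ = 1)
    (hmax : ∀ y, ‖y‖ = 1 → ‖gradient v y‖ ^ 2 ≤ ‖gradient v x‖ ^ 2) :
    hess v x (gradient v x) = -(‖gradient v x‖ ^ 2) • x := by
  have hx0 : x ≠ 0 := by rintro rfl; simp at hx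
  -- The factor |y|² makes the function homogeneous of degree zero, so the constrained maximum is a
  -- free one and no Lagrange multiplier is needed.
  have hloc : IsLocalMax (fun y => ‖gradient v y‖ ^ 2 * ‖y‖ ^ 2) x := by
    refine isLocalMax_of_sphere hx ?_ ?_
    · intro t ht y hy
      rw [h.gradient_smul ht hy, norm_smul, norm_smul, norm_inv, Real.norm_of_nonneg ht.le]
      field_simp
    · intro y hy
      simpa [hy, hx] using hmax y hy
  have hg := (hasStrictFDerivAt_gradient (h.contDiffAt x hx0)).hasFDerivAt
  have hd := hg.norm_sq.mul (hasStrictFDerivAt_norm_sq x).hasFDerivAt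
  have h0 := hloc.hasFDerivAt_eq_zero hd
  refine ext_inner_right ℝ fun y => ?_
  have h1 := DFunLike.congr_fun h0 y
  simp [hx, -inner_gradient_left] at h1
  rw [hess_symm (h.contDiffAt x hx0), real_inner_smul_left]
  linarith

end LogHomogeneous

/-! ### The frame at a maximum of the gradient and the optimal deformation. -/

section Frame

variable {E : Type*} [NormedAddCommGroup E] [InnerProductSpace ℝ E]

/-- An orthonormal pair `x₀, x₁` whose span is invariant under the symmetric operator `H`, with the
matrix of `H` that occurs at a maximum point of the gradient. -/
structure AdaptedFrame (H : E →L[ℝ] E) (x₀ x₁ : E) (m : ℝ) : Prop where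
  pos : 0 < m
  norm₀ : ‖x₀‖ = 1
  norm₁ : ‖x₁‖ = 1
  orth : ⟪x₀, x₁⟫ = 0
  symm : ∀ x y, ⟪H x, y⟫ = ⟪x, H y⟫
  apply₀ : H x₀ = -x₀ + m • x₁
  apply₁ : H x₁ = m • x₀ + x₁

/-- The orthogonal projection onto the orthogonal complement of `x₀` and `x₁`. -/
noncomputable def transProj (x₀ x₁ : E) : E →L[ℝ] E :=
  1 - InnerProductSpace.rankOne ℝ x₀ x₀ - InnerProductSpace.rankOne ℝ x₁ x₁

/-- The infinitesimal deformation transversal to `x₀` and `x₁`. -/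
noncomputable def transOp (H : E →L[ℝ] E) (x₀ x₁ : E) (m : ℝ) : E →L[ℝ] E :=
  m⁻¹ • (transProj x₀ x₁ - H * transProj x₀ x₁)

/-- The infinitesimal rotation that maps `x₀` to `x₁`. -/
noncomputable def rotOp (x₀ x₁ : E) : E →L[ℝ] E :=
  InnerProductSpace.rankOne ℝ x₁ x₀ - InnerProductSpace.rankOne ℝ x₀ x₁

/-- The operator of the quadratic barrier. -/
noncomputable def barrierOp (H : E →L[ℝ] E) (x₀ x₁ : E) (m : ℝ) : E →L[ℝ] E :=
  (m / 2) • (transOp H x₀ x₁ m * transOp H x₀ x₁ m - transProj x₀ x₁) - transOp H x₀ x₁ m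

theorem transProj_apply (x₀ x₁ x : E) :
    transProj x₀ x₁ x = x - ⟪x₀, x⟫ • x₀ - ⟪x₁, x⟫ • x₁ := by
  simp [transProj]

theorem rotOp_apply (x₀ x₁ x : E) : rotOp x₀ x₁ x = ⟪x₀, x⟫ • x₁ - ⟪x₁, x⟫ • x₀ := by
  simp [rotOp]

theorem rotOp_skew (x₀ x₁ x y : E) : ⟪rotOp x₀ x₁ x, y⟫ = -⟪x, rotOp x₀ x₁ y⟫ := by
  simp only [rotOp_apply, inner_sub_left, inner_sub_right, real_inner_smul_left,
    real_inner_smul_right, real_inner_comm x₀ x, real_inner_comm x₁ x]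
  ring

theorem transProj_symm (x₀ x₁ x y : E) :
    ⟪transProj x₀ x₁ x, y⟫ = ⟪x, transProj x₀ x₁ y⟫ := by
  simp only [transProj_apply, inner_sub_left, inner_sub_right, real_inner_smul_left,
    real_inner_smul_right, real_inner_comm x₀ x, real_inner_comm x₁ x]
  ring

variable {H : E →L[ℝ] E} {x₀ x₁ : E} {m : ℝ}

namespace AdaptedFrame

theorem transProj₀ (h : AdaptedFrame H x₀ x₁ m) : transProj x₀ x₁ x₀ = 0 := by
  rw [transProj_apply, real_inner_self_eq_norm_sq, h.norm₀, real_inner_comm, h.orth]; simp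

theorem transProj₁ (h : AdaptedFrame H x₀ x₁ m) : transProj x₀ x₁ x₁ = 0 := by
  rw [transProj_apply, real_inner_self_eq_norm_sq, h.norm₁, h.orth]; simp

theorem transProj_sq (h : AdaptedFrame H x₀ x₁ m) :
    transProj x₀ x₁ * transProj x₀ x₁ = transProj x₀ x₁ := by
  ext x
  rw [mul_apply_eq_comp]
  conv_lhs => rw [transProj_apply x₀ x₁ x]
  rw [map_sub, map_sub, map_smul, map_smul, h.transProj₀, h.transProj₁]
  simp

theorem transProj_comm (h : AdaptedFrame H x₀ x₁ m) :
    transProj x₀ x₁ * H = H * transProj x₀ x₁ := by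
  ext x
  rw [mul_apply_eq_comp, mul_apply_eq_comp, transProj_apply, transProj_apply,
    map_sub, map_sub, map_smul, map_smul, ← h.symm, ← h.symm, h.apply₀, h.apply₁]
  simp only [inner_add_left, inner_neg_left, real_inner_smul_left]
  module

theorem transOp_symm (h : AdaptedFrame H x₀ x₁ m) (x y : E) :
    ⟪transOp H x₀ x₁ m x, y⟫ = ⟪x, transOp H x₀ x₁ m y⟫ := by
  have h1 : H (transProj x₀ x₁ y) = transProj x₀ x₁ (H y) :=
    (DFunLike.congr_fun h.transProj_comm y).symm
  simp only [transOp, smul_apply, sub_apply, mul_apply_eq_comp, real_inner_smul_left,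
    real_inner_smul_right, inner_sub_left, inner_sub_right, h1]
  rw [transProj_symm, h.symm, transProj_symm]

theorem transOp₀ (h : AdaptedFrame H x₀ x₁ m) : transOp H x₀ x₁ m x₀ = 0 := by
  simp [transOp, h.transProj₀]

theorem transOp₁ (h : AdaptedFrame H x₀ x₁ m) : transOp H x₀ x₁ m x₁ = 0 := by
  simp [transOp, h.transProj₁]

theorem transProj_mul_transOp (h : AdaptedFrame H x₀ x₁ m) :
    transProj x₀ x₁ * transOp H x₀ x₁ m = transOp H x₀ x₁ m := by
  rw [transOp, mul_smul_comm, mul_sub, ← mul_assoc, h.transProj_comm, mul_assoc, h.transProj_sq]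

theorem transOp_mul_transProj (h : AdaptedFrame H x₀ x₁ m) :
    transOp H x₀ x₁ m * transProj x₀ x₁ = transOp H x₀ x₁ m := by
  rw [transOp, smul_mul_assoc, sub_mul, mul_assoc, h.transProj_sq]

theorem mul_transProj (h : AdaptedFrame H x₀ x₁ m) :
    H * transProj x₀ x₁ = transProj x₀ x₁ - m • transOp H x₀ x₁ m := by
  rw [transOp, smul_smul, mul_inv_cancel₀ h.pos.ne', one_smul]; abel

theorem mul_transOp (h : AdaptedFrame H x₀ x₁ m) :
    H * transOp H x₀ x₁ m =
      transOp H x₀ x₁ m - m • (transOp H x₀ x₁ m * transOp H x₀ x₁ m) := by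
  conv_lhs => rw [← h.transProj_mul_transOp, ← mul_assoc, h.mul_transProj, sub_mul,
    h.transProj_mul_transOp, smul_mul_assoc]

theorem transOp_mul (h : AdaptedFrame H x₀ x₁ m) :
    transOp H x₀ x₁ m * H =
      transOp H x₀ x₁ m - m • (transOp H x₀ x₁ m * transOp H x₀ x₁ m) := by
  conv_lhs => rw [← h.transOp_mul_transProj, mul_assoc, h.transProj_comm, h.mul_transProj,
    mul_sub, h.transOp_mul_transProj, mul_smul_comm]

/-- This identity shows why `transOp` is the right choice. On a transversal eigenvector of H with
eigenvalue κ, a deformation with eigenvalue s would give 2s(1-κ) - ms² + m. This is largest for s =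
(1-κ)/m, with value ((1-κ)² + m²)/m. -/
theorem barrier_variation (h : AdaptedFrame H x₀ x₁ m) :
    -(transOp H x₀ x₁ m * H + H * transOp H x₀ x₁ m) - (2 : ℝ) • barrierOp H x₀ x₁ m =
      m • (transOp H x₀ x₁ m * transOp H x₀ x₁ m) + m • transProj x₀ x₁ := by
  rw [h.mul_transOp, h.transOp_mul, barrierOp]
  module

theorem barrierOp_symm (h : AdaptedFrame H x₀ x₁ m) (x y : E) :
    ⟪barrierOp H x₀ x₁ m x, y⟫ = ⟪x, barrierOp H x₀ x₁ m y⟫ := by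
  simp only [barrierOp, smul_apply, sub_apply, mul_apply_eq_comp, real_inner_smul_left,
    real_inner_smul_right, inner_sub_left, inner_sub_right, h.transOp_symm, transProj_symm]

theorem barrierOp₀ (h : AdaptedFrame H x₀ x₁ m) : barrierOp H x₀ x₁ m x₀ = 0 := by
  simp [barrierOp, h.transOp₀, h.transProj₀]

theorem inner_barrierOp (h : AdaptedFrame H x₀ x₁ m) (y : E) :
    ⟪barrierOp H x₀ x₁ m y, y⟫ = m / 2 * (‖transOp H x₀ x₁ m y‖ ^ 2 -
      ⟪transProj x₀ x₁ y, y⟫) - ⟪transOp H x₀ x₁ m y, y⟫ := by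
  simp only [barrierOp, smul_apply, sub_apply, mul_apply_eq_comp, real_inner_smul_left,
    inner_sub_left, ← real_inner_self_eq_norm_sq]
  rw [h.transOp_symm (transOp H x₀ x₁ m y)]

/-- The two images are orthogonal, and the infinitesimal rotation is isometric on the plane of x₀
and x₁ and zero on its complement. -/
theorem norm_add_sq (h : AdaptedFrame H x₀ x₁ m) {y : E} (hy : ‖y‖ = 1) :
    ‖(transOp H x₀ x₁ m + rotOp x₀ x₁) y‖ ^ 2 =
      ‖transOp H x₀ x₁ m y‖ ^ 2 + 1 - ⟪transProj x₀ x₁ y, y⟫ := by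
  have h0 : ⟪transOp H x₀ x₁ m y, rotOp x₀ x₁ y⟫ = 0 := by
    rw [h.transOp_symm, rotOp_apply, map_sub, map_smul, map_smul, h.transOp₀, h.transOp₁]
    simp
  rw [add_apply, norm_add_sq_real, h0, transProj_apply]
  have h1 : ‖rotOp x₀ x₁ y‖ ^ 2 = ⟪x₀, y⟫ ^ 2 + ⟪x₁, y⟫ ^ 2 := by
    rw [← real_inner_self_eq_norm_sq, rotOp_apply]
    simp only [inner_sub_left, inner_sub_right, real_inner_smul_left, real_inner_smul_right,
      real_inner_self_eq_norm_sq, norm_smul, mul_pow, Real.norm_eq_abs, sq_abs, h.norm₀, h.norm₁,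
      h.orth, real_inner_comm x₀ x₁]
    ring
  rw [h1]
  simp only [inner_sub_left, real_inner_smul_left, real_inner_self_eq_norm_sq, hy]
  ring

/-- The quadratic barrier dominates the derivative of `-v` along the deformation. -/
theorem neg_inner_le (h : AdaptedFrame H x₀ x₁ m) {g y : E} (hy : ‖y‖ = 1) (hgy : ⟪g, y⟫ = 1)
    (hg : ‖g‖ ^ 2 ≤ 1 + m ^ 2) :
    -⟪g, (transOp H x₀ x₁ m + rotOp x₀ x₁) y⟫ ≤ m + ⟪barrierOp H x₀ x₁ m y, y⟫ := by
  -- Since ⟪g, y⟫ = 1, the vector y - g is the tangential part, with |y - g|² = |g|² - 1.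
  have h1 : ‖y - g‖ ≤ m := by
    refine abs_le_of_sq_le_sq' ?_ h.pos.le |>.2
    rw [norm_sub_sq_real, real_inner_comm, hgy, hy]
    linarith
  have h2 := real_inner_le_norm (y - g) ((transOp H x₀ x₁ m + rotOp x₀ x₁) y)
  have h3 := h.norm_add_sq hy
  set Ay := (transOp H x₀ x₁ m + rotOp x₀ x₁) y with hAy
  have h4 : ⟪y, Ay⟫ = ⟪transOp H x₀ x₁ m y, y⟫ := by
    have h5 : ⟪y, rotOp x₀ x₁ y⟫ = 0 := by
      have := rotOp_skew x₀ x₁ y y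
      rw [real_inner_comm] at this
      linarith
    rw [hAy, add_apply, inner_add_right, h5, add_zero, real_inner_comm]
  rw [inner_sub_left, h4] at h2
  rw [h.inner_barrierOp]
  have h5 : ‖y - g‖ * ‖Ay‖ ≤ m * ‖Ay‖ := mul_le_mul_of_nonneg_right h1 (norm_nonneg _)
  -- The square of the norm turns the bound into a quadratic form in y, the barrier. Nothing is lost
  -- at y = x₀, where Ay = x₁ has norm 1.
  have h6 : m * ‖Ay‖ ≤ m / 2 * (1 + ‖Ay‖ ^ 2) := by
    nlinarith [h.pos, mul_nonneg h.pos.le (sq_nonneg (‖Ay‖ - 1))]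
  rw [h3] at h6
  linarith

end AdaptedFrame

/-- Homogeneity gives H x₀ = -∇v, and maximality gives H ∇v = -(1+m²) x₀. Since ∇v = x₀ - m x₁, both
images of the frame follow. -/
theorem LogHomogeneous.adaptedFrame [CompleteSpace E] {v : E → ℝ} (hv : LogHomogeneous v)
    (hx₀ : ‖x₀‖ = 1) (hm : 0 < m) (hg : ‖gradient v x₀‖ ^ 2 = 1 + m ^ 2)
    (hmax : ∀ y, ‖y‖ = 1 → ‖gradient v y‖ ^ 2 ≤ 1 + m ^ 2) :
    AdaptedFrame (hess v x₀) x₀ (m⁻¹ • (x₀ - gradient v x₀)) m := by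
  have h0 : x₀ ≠ 0 := by rintro rfl; simp at hx₀
  have h1 := hv.inner_gradient_self h0
  have h2 := hv.hess_self h0
  have h3 := hv.hess_gradient_of_isMax hx₀ (by rw [hg]; exact hmax)
  rw [hg] at h3
  refine ⟨hm, hx₀, ?_, ?_, hess_symm (hv.contDiffAt _ h0), ?_, ?_⟩
  · have : ‖x₀ - gradient v x₀‖ ^ 2 = m ^ 2 := by
      rw [norm_sub_sq_real, hx₀, hg, real_inner_comm, h1]; ring
    rw [norm_smul, (pow_left_inj₀ (norm_nonneg _) hm.le two_ne_zero).1 this, norm_inv,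
      Real.norm_of_nonneg hm.le, inv_mul_cancel₀ hm.ne']
  · rw [real_inner_smul_right, inner_sub_right, real_inner_self_eq_norm_sq, hx₀, real_inner_comm,
      h1]
    simp
  · rw [h2, smul_smul, mul_inv_cancel₀ hm.ne']; module
  · rw [map_smul, map_sub, h2, h3]
    have : m • x₀ = m⁻¹ • (m ^ 2) • x₀ := by
      rw [smul_smul, pow_two, ← mul_assoc, inv_mul_cancel₀ hm.ne', one_mul]
    rw [this]
    module

end Frame

/-! ### The barrier function and one-parameter rotations. -/

section Barrier

variable {E : Type*} [NormedAddCommGroup E] [InnerProductSpace ℝ E] [CompleteSpace E]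

/-- A barrier of degree zero with prescribed Hessian at `x₀`, with a quartic penalty. -/
theorem exists_barrier {x₀ : E} (hx₀ : ‖x₀‖ = 1) {B : E →L[ℝ] E}
    (hB : ∀ x y, ⟪B x, y⟫ = ⟪x, B y⟫) (hB₀ : B x₀ = 0) :
    ∃ Q : E → ℝ, (∀ x, x ≠ 0 → ContDiffAt ℝ 2 Q x) ∧
      (∀ t : ℝ, 0 < t → ∀ x, x ≠ 0 → Q (t • x) = Q x) ∧
      (∀ x, ‖x‖ = 1 → Q x = ⟪B x, x⟫ + (1 - ⟪x, x₀⟫) ^ 2) ∧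
      gradient Q x₀ = 0 ∧ hess Q x₀ = (2 : ℝ) • B := by
  have h0 : x₀ ≠ 0 := by rintro rfl; simp at hx₀
  set b : E → ℝ := fun x => -⟪B x, x⟫ with hb
  set c : E → ℝ := fun x => (‖x‖ ^ 2)⁻¹ with hc
  set s : E → ℝ := fun x => 1 - ⟪x, x₀⟫ * ‖x‖⁻¹ with hs
  have hbC : ∀ x, ContDiffAt ℝ 2 b x := fun x => (contDiff_inner_clm B).neg.contDiffAt
  have hcC : ∀ x, x ≠ 0 → ContDiffAt ℝ 2 c x := fun x hx =>
    (contDiff_norm_sq ℝ).contDiffAt.inv (by simpa using hx)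
  have hsC : ∀ x, x ≠ 0 → ContDiffAt ℝ 2 s x := fun x hx =>
    contDiffAt_const.sub ((contDiffAt_id.inner ℝ contDiffAt_const).mul
      ((contDiffAt_norm ℝ hx).inv (norm_ne_zero_iff.2 hx)))
  have hs0 : s x₀ = 0 := by
    simp [hs, hx₀]
  have hsg : gradient s x₀ = 0 := by
    have hmin : IsLocalMin s x₀ := by
      refine Filter.Eventually.of_forall fun x => ?_
      rw [hs0]
      have h1 : ⟪x, x₀⟫ ≤ ‖x‖ := by simpa [hx₀] using real_inner_le_norm x x₀
      rcases eq_or_ne x 0 with rfl | hx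
      · simp [hs]
      · have h2 : 0 < ‖x‖ := norm_pos_iff.2 hx
        have h3 : ⟪x, x₀⟫ * ‖x‖⁻¹ ≤ 1 := by
          rw [← div_eq_mul_inv, div_le_one h2]; exact h1
        simp only [hs]; linarith
    simp [gradient, hmin.fderiv_eq_zero]
  have hb0 : b x₀ = 0 := by simp [hb, hB₀]
  have hBn : ∀ x y, ⟪(-B) x, y⟫ = ⟪x, (-B) y⟫ := by
    intro x y
    simp [hB]
  have hbe : b = fun x => ⟪(-B) x, x⟫ := by
    funext x; simp [hb]
  have hbg : gradient b x₀ = 0 := by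
    rw [hbe, gradient_inner_clm hBn]; simp [hB₀]
  have hbh : hess b x₀ = (2 : ℝ) • (-B) := by
    rw [hbe, hess_inner_clm hBn]
  -- The factor s vanishes to first order at x₀, so s² does not affect the Hessian there. It serves
  -- only to make the maximum strict.
  refine ⟨fun x => s x * s x - b x * c x, fun x hx =>
    ((hsC x hx).mul (hsC x hx)).sub ((hbC x).mul (hcC x hx)), ?_, ?_, ?_, ?_⟩
  · intro t ht x hx
    have h2 : ‖x‖ ≠ 0 := norm_ne_zero_iff.2 hx
    have e1 : s (t • x) = s x := by
      simp only [hs, norm_smul, real_inner_smul_left, Real.norm_of_nonneg ht.le]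
      field_simp
    have e2 : b (t • x) * c (t • x) = b x * c x := by
      simp only [hb, hc, norm_smul, real_inner_smul_left, real_inner_smul_right, map_smul,
        Real.norm_of_nonneg ht.le]
      field_simp
    simp only [e1, e2]
  · intro x hx
    simp [hs, hb, hc, hx]
    ring
  · rw [gradient_sub' ((hsC x₀ h0).mul (hsC x₀ h0)) ((hbC x₀).mul (hcC x₀ h0)),
      gradient_mul' (hsC x₀ h0) (hsC x₀ h0), gradient_mul' (hbC x₀) (hcC x₀ h0), hs0, hb0, hbg]
    simp
  · rw [hess_sub ((hsC x₀ h0).mul (hsC x₀ h0)) ((hbC x₀).mul (hcC x₀ h0)),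
      hess_mul (hsC x₀ h0) (hsC x₀ h0) hs0 hsg, hess_mul (hbC x₀) (hcC x₀ h0) hb0 hbg, hs0, hbh]
    simp [hc, hx₀]

/-- The one-parameter group of rotations generated by a skew operator. -/
theorem exists_rotation {K : E →L[ℝ] E} (hK : ∀ x y, ⟪K x, y⟫ = -⟪x, K y⟫) :
    ∃ (R : ℝ → E ≃ₗᵢ[ℝ] E) (P Q : ℝ → E →L[ℝ] E), (∀ t x, P t x = R t x) ∧
      (∀ t x, Q t x = (R t).symm x) ∧ HasDerivAt P K 0 ∧ HasDerivAt Q (-K) 0 ∧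
      P 0 = 1 ∧ Q 0 = 1 := by
  let := NormedAlgebra.restrictScalars ℚ ℝ (E →L[ℝ] E)
  have hKs : K ∈ skewAdjoint (E →L[ℝ] E) := by
    rw [skewAdjoint.mem_iff, ContinuousLinearMap.star_eq_adjoint]
    ext x
    refine ext_inner_right ℝ fun y => ?_
    rw [ContinuousLinearMap.adjoint_inner_left, neg_apply, inner_neg_left, hK, neg_neg]
  have hmem : ∀ t : ℝ, NormedSpace.exp (t • K) ∈ unitary (E →L[ℝ] E) := fun t =>
    NormedSpace.exp_mem_unitary_of_mem_skewAdjoint (skewAdjoint.smul_mem t hKs)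
  refine ⟨fun t => Unitary.linearIsometryEquiv ⟨_, hmem t⟩, fun t => NormedSpace.exp (t • K),
    fun t => NormedSpace.exp (t • (-K)), fun t x => rfl, ?_, ?_, ?_, ?_, ?_⟩
  · intro t x
    rw [LinearIsometryEquiv.eq_symm_apply]
    have h1 : NormedSpace.exp (t • K) * NormedSpace.exp (t • (-K)) = 1 := by
      rw [← NormedSpace.exp_add_of_commute, smul_neg, add_neg_cancel, NormedSpace.exp_zero]
      rw [smul_neg]
      exact (Commute.refl _).neg_right
    exact DFunLike.congr_fun h1 x
  · simpa using hasDerivAt_exp_smul_const K (0 : ℝ)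
  · simpa using hasDerivAt_exp_smul_const (-K) (0 : ℝ)
  · simp
  · simp

end Barrier

/-! ### The maximum principle without third derivatives. -/

section MaximumPrinciple

variable {E : Type*} [NormedAddCommGroup E] [InnerProductSpace ℝ E]

theorem gradient_const_mul' [CompleteSpace E] {f : E → ℝ} {x : E} (hf : ContDiffAt ℝ 2 f x)
    (r : ℝ) : gradient (fun y => r * f y) x = r • gradient f x := by
  refine gradient_eq_of_hasFDerivAt
    ((hasStrictFDerivAt_of_contDiffAt_two hf).hasFDerivAt.const_mul r) fun y => ?_
  simp [real_inner_smul_left]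

theorem hess_const_mul [CompleteSpace E] {f : E → ℝ} {x : E} (hf : ContDiffAt ℝ 2 f x) (r : ℝ) :
    hess (fun y => r * f y) x = r • hess f x := by
  have h1 : gradient (fun y => r * f y) =ᶠ[𝓝 x] fun y => r • gradient f y := by
    filter_upwards [eventually_contDiffAt_two hf] with y h1
    exact gradient_const_mul' h1 r
  rw [hess, h1.fderiv_eq]
  exact ((hasStrictFDerivAt_gradient hf).hasFDerivAt.const_smul r).fderiv

/-- A sequence of operators that converges to the identity does not vanish on nonzero vectors. -/
theorem apply_ne_zero_of_norm_sub_one_lt {J : E →L[ℝ] E} (hJ : ‖J - 1‖ < 1) {x : E}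
    (hx : x ≠ 0) : J x ≠ 0 := by
  intro h
  have h1 := (J - 1).le_opNorm x
  rw [sub_apply, h, zero_sub, norm_neg, one_apply_eq_self] at h1
  have h2 : 0 < ‖x‖ := norm_pos_iff.2 hx
  nlinarith

variable [FiniteDimensional ℝ E]

/-- The contact inequalities at a maximum point of `v ∘ J - v - θ Q` on the unit sphere. -/
theorem LogHomogeneous.contact {v Q : E → ℝ} (hv : LogHomogeneous v)
    (hQ : ∀ x, x ≠ 0 → ContDiffAt ℝ 2 Q x)
    (hQ0 : ∀ t : ℝ, 0 < t → ∀ x, x ≠ 0 → Q (t • x) = Q x) {J : E →L[ℝ] E}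
    (hJ : ∀ x, x ≠ 0 → J x ≠ 0) (θ : ℝ) {y : E} (hy : ‖y‖ = 1)
    (hmax : ∀ x, ‖x‖ = 1 → v (J x) - v x - θ * Q x ≤ v (J y) - v y - θ * Q y) :
    gradient v y = ContinuousLinearMap.adjoint J (gradient v (J y)) - θ • gradient Q y ∧
      ∀ a, ⟪hess v (J y) (J a), J a⟫ - θ * ⟪hess Q y a, a⟫ ≤ ⟪hess v y a, a⟫ := by
  have hy0 : y ≠ 0 := by rintro rfl; simp at hy
  have hloc : IsLocalMax (fun x => v (J x) - v x - θ * Q x) y := by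
    refine isLocalMax_of_sphere hy ?_ hmax
    intro t ht x hx
    rw [map_smul, hv.smul t ht x hx, hv.smul t ht _ (hJ x hx), hQ0 t ht x hx]
    ring
  have c1 : ContDiffAt ℝ 2 (fun x => v (J x)) y :=
    (hv.contDiffAt _ (hJ y hy0)).comp y J.contDiff.contDiffAt
  have c2 := hv.contDiffAt y hy0
  have c3 : ContDiffAt ℝ 2 (fun x => θ * Q x) y := contDiffAt_const.mul (hQ y hy0)
  have h1 := gradient_eq_zero_of_isLocalMax hloc
  have h2 := hess_nonpos_of_isLocalMax ((c1.sub c2).sub c3) hloc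
  rw [gradient_sub' (c1.sub c2) c3, gradient_sub' c1 c2, gradient_const_mul' (hQ y hy0),
    gradient_comp_clm (hv.contDiffAt _ (hJ y hy0))] at h1
  refine ⟨by rw [← sub_eq_zero, ← neg_eq_zero, ← h1]; abel, fun a => ?_⟩
  have h3 := h2 a
  rw [hess_sub (c1.sub c2) c3, hess_sub c1 c2, hess_const_mul (hQ y hy0),
    hess_comp_clm (hv.contDiffAt _ (hJ y hy0))] at h3
  simp only [sub_apply, smul_apply, inner_sub_left, real_inner_smul_left,
    ContinuousLinearMap.comp_apply, ContinuousLinearMap.adjoint_inner_left] at h3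
  linarith

/-- The maximum principle for the gradient, in a form that uses only second derivatives of `v`:
if the equation `Ψ(∇v, D²v) = G + δ v + c log |∇v|²` holds with a rotation invariant and monotone
`Ψ`, then at a maximum point of `|∇v|` on the unit sphere the derivative of `Ψ` in the direction of
the optimal deformation is controlled by the derivative of `G`. -/
theorem LogHomogeneous.variation_le {v : E → ℝ} (hv : LogHomogeneous v) {x₀ x₁ : E} {m : ℝ}
    (hF : AdaptedFrame (hess v x₀) x₀ x₁ m) (hx₁ : gradient v x₀ = x₀ - m • x₁)
    (hmax : ∀ y, ‖y‖ = 1 → ‖gradient v y‖ ^ 2 ≤ 1 + m ^ 2)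
    {Ψ : E × (E →L[ℝ] E) → ℝ} {Ψ' : E × (E →L[ℝ] E) →L[ℝ] ℝ}
    (hΨ : HasStrictFDerivAt Ψ Ψ' (gradient v x₀, hess v x₀))
    (hinv : ∀ (R : E ≃ₗᵢ[ℝ] E) (ξ : E) (A A' : E →L[ℝ] E), ξ ≠ 0 →
      (∀ x y, ⟪A x, y⟫ = ⟪x, A y⟫) → (∀ x, A' x = R (A (R.symm x))) → Ψ (R ξ, A') = Ψ (ξ, A))
    (hmono : ∀ᶠ z in 𝓝 (gradient v x₀, hess v x₀), (∀ x y, ⟪z.2 x, y⟫ = ⟪x, z.2 y⟫) →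
      ∀ A' : E →L[ℝ] E, (∀ x y, ⟪A' x, y⟫ = ⟪x, A' y⟫) → (∀ a, ⟪z.2 a, a⟫ ≤ ⟪A' a, a⟫) →
        Ψ z ≤ Ψ (z.1, A'))
    {G : E → ℝ} {G' : E →L[ℝ] ℝ} (hG : HasStrictFDerivAt G G' x₀) {δ c : ℝ}
    (heq : ∀ x, x ≠ 0 → Ψ (gradient v x, hess v x) =
      G x + δ * v x + c * Real.log (‖gradient v x‖ ^ 2)) :
    Ψ' (0, m • (transOp (hess v x₀) x₀ x₁ m * transOp (hess v x₀) x₀ x₁ m) +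
      m • transProj x₀ x₁) ≤ G' x₁ - δ * m := by
  have h00 : x₀ ≠ 0 := fun h => by simpa [h] using hF.norm₀
  set ξ₀ := gradient v x₀ with hξ₀
  set H₀ := hess v x₀ with hH₀
  set S := transOp H₀ x₀ x₁ m with hS
  set K := rotOp x₀ x₁ with hK
  set B := barrierOp H₀ x₀ x₁ m with hB
  have hξ₀0 : ξ₀ ≠ 0 := hv.gradient_ne_zero h00
  have hSξ : S ξ₀ = 0 := by rw [hx₁, map_sub, map_smul, hF.transOp₀, hF.transOp₁]; simp
  have hKx : K x₀ = x₁ := by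
    rw [hK, rotOp_apply, real_inner_self_eq_norm_sq, hF.norm₀, real_inner_comm, hF.orth]; simp
  have hAx : (S + K) x₀ = x₁ := by rw [add_apply, hF.transOp₀, hKx, zero_add]
  have hgx₁ : ⟪ξ₀, x₁⟫ = -m := by
    rw [hx₁, inner_sub_left, real_inner_smul_left, hF.orth, real_inner_self_eq_norm_sq, hF.norm₁]
    simp
  obtain ⟨R, P, T, hPR, hTR, hP, hT, hP0, hT0⟩ := exists_rotation (rotOp_skew x₀ x₁)
  obtain ⟨Q, hQC, hQ0, hQ1, hQg, hQh⟩ := exists_barrier hF.norm₀ hF.barrierOp_symm hF.barrierOp₀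
  rw [← hB] at hQ1 hQh
  have hPT : ∀ t x, P t (T t x) = x := fun t x => by rw [hPR, hTR, LinearIsometryEquiv.apply_symm_apply]
  have hTP : ∀ t x, T t (P t x) = x := fun t x => by rw [hPR, hTR, LinearIsometryEquiv.symm_apply_apply]
  have hPadj : ∀ t x y, ⟪P t x, y⟫ = ⟪x, T t y⟫ := fun t x y => by
    rw [hPR, hTR, ← (R t).inner_map_map x, LinearIsometryEquiv.apply_symm_apply]
  have hTadj : ∀ t x y, ⟪T t x, y⟫ = ⟪x, P t y⟫ := fun t x y => by
    rw [real_inner_comm, ← hPadj, real_inner_comm]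
  set N : ℝ → E →L[ℝ] E := fun t => 1 - t • S with hN
  have hNs : ∀ t x y, ⟪N t x, y⟫ = ⟪x, N t y⟫ := fun t x y => by
    simp only [hN, sub_apply, smul_apply, one_apply_eq_self, inner_sub_left, inner_sub_right,
      real_inner_smul_left, real_inner_smul_right, hS, hF.transOp_symm]
  -- At t = 0 this moves x₀ with velocity -x₁, along which v increases at the rate m.
  set J : ℝ → E →L[ℝ] E := fun t => N t * T t with hJdef
  set Jt : ℝ → E →L[ℝ] E := fun t => P t * N t with hJtdef
  have hadj : ∀ t, ContinuousLinearMap.adjoint (J t) = Jt t := by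
    intro t
    ext x
    refine ext_inner_right ℝ fun y => ?_
    simp only [ContinuousLinearMap.adjoint_inner_left, hJdef, hJtdef, mul_apply_eq_comp]
    rw [← hNs, hPadj]
  have hNd : HasDerivAt N (-S) 0 := by
    simpa using ((hasDerivAt_id (0 : ℝ)).smul_const S).const_sub (1 : E →L[ℝ] E)
  have hN0 : N 0 = 1 := by simp [hN]
  have hJd : HasDerivAt J (-(S + K)) 0 := by
    refine (hNd.mul hT).congr_deriv ?_
    rw [hN0, hT0, mul_one, one_mul, neg_add]
  have hJtd : HasDerivAt Jt (K - S) 0 := by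
    refine (hP.mul hNd).congr_deriv ?_
    rw [hN0, hP0, mul_one, one_mul, sub_eq_add_neg]
  have hJ0 : J 0 = 1 := by simp [hJdef, hN0, hT0]
  have hJt0 : Jt 0 = 1 := by simp [hJtdef, hN0, hP0]
  -- the ultrafilter along which all limits are taken
  set U : Ultrafilter ℝ := Ultrafilter.of (𝓝[>] (0 : ℝ)) with hUdef
  have hU : (U : Filter ℝ) ≤ 𝓝[>] 0 := Ultrafilter.of_le _
  have hU0 : (U : Filter ℝ) ≤ 𝓝 0 := hU.trans nhdsWithin_le_nhds
  have hUne : (U : Filter ℝ) ≤ 𝓝[≠] 0 := hU.trans (nhdsGT_le_nhdsNE 0)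
  have hpos : ∀ᶠ t in (U : Filter ℝ), 0 < t := hU self_mem_nhdsWithin
  have hid : Tendsto (fun t : ℝ => t) U (𝓝 0) := hU0
  have hslope : ∀ {f : ℝ → E →L[ℝ] E} {f' : E →L[ℝ] E}, HasDerivAt f f' 0 → f 0 = 1 →
      Tendsto (fun t => t⁻¹ • (f t - 1)) U (𝓝 f') := by
    intro f f' hf h0
    refine ((hasDerivAt_iff_tendsto_slope.1 hf).mono_left hUne).congr fun t => ?_
    rw [slope_def_module, sub_zero, h0]
  have hJs := hslope hJd hJ0
  have hJts := hslope hJtd hJt0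
  have hJ1 : Tendsto J U (𝓝 1) := by
    have := hJd.continuousAt.tendsto.mono_left hU0
    rwa [hJ0] at this
  have hT1 : Tendsto T U (𝓝 1) := by
    have := hT.continuousAt.tendsto.mono_left hU0
    rwa [hT0] at this
  have hP1 : Tendsto P U (𝓝 1) := by
    have := hP.continuousAt.tendsto.mono_left hU0
    rwa [hP0] at this
  have hgood : ∀ᶠ t in (U : Filter ℝ), ∀ x, x ≠ 0 → J t x ≠ 0 := by
    have h1 : ∀ᶠ t in (U : Filter ℝ), ‖J t - 1‖ < 1 := by
      have h2 := (hJ1.sub_const 1).norm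
      rw [sub_self, norm_zero] at h2
      exact h2.eventually (gt_mem_nhds one_pos)
    exact h1.mono fun t ht x hx => apply_ne_zero_of_norm_sub_one_lt ht hx
  have hne_of_unit : ∀ {x : E}, ‖x‖ = 1 → x ≠ 0 := fun {x} h h0 => by simp [h0] at h
  -- maximum points
  have hex : ∀ t : ℝ, ∃ y : E, ‖y‖ = 1 ∧ ((∀ x, x ≠ 0 → J t x ≠ 0) → ∀ x, ‖x‖ = 1 →
      v (J t x) - v x - t * Q x ≤ v (J t y) - v y - t * Q y) := by
    intro t
    by_cases hJt' : ∀ x, x ≠ 0 → J t x ≠ 0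
    · have hcont : ContinuousOn (fun x => v (J t x) - v x - t * Q x) (Metric.sphere (0 : E) 1) := by
        intro x hx
        have hx0 : x ≠ 0 := hne_of_unit (by simpa using hx)
        refine ContinuousAt.continuousWithinAt ?_
        exact (((hv.contDiffAt _ (hJt' x hx0)).continuousAt.comp (J t).continuous.continuousAt).sub
          (hv.contDiffAt _ hx0).continuousAt).sub (continuousAt_const.mul (hQC x hx0).continuousAt)
      obtain ⟨y, hy, hym⟩ := (isCompact_sphere (0 : E) 1).exists_isMaxOn
        ⟨x₀, by simpa using hF.norm₀⟩ hcont
      exact ⟨y, by simpa using hy, fun _ x hx => hym (by simpa using hx)⟩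
    · exact ⟨x₀, hF.norm₀, fun h => absurd h hJt'⟩
  choose y hy1 hymax using hex
  obtain ⟨ys, hys, hyt⟩ : ∃ ys : E, ‖ys‖ = 1 ∧ Tendsto y U (𝓝 ys) := by
    obtain ⟨ys, h1, h2⟩ := (isCompact_sphere (0 : E) 1).ultrafilter_le_nhds (U.map y) (by
      rw [Ultrafilter.coe_map, le_principal_iff, mem_map]
      exact Eventually.of_forall fun t => by simpa using hy1 t)
    exact ⟨ys, by simpa using h1, h2⟩
  have hquot : ∀ {f : ℝ → E →L[ℝ] E} {f' : E →L[ℝ] E} {w : ℝ → E} {ws : E},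
      Tendsto (fun t => t⁻¹ • (f t - 1)) U (𝓝 f') → Tendsto w U (𝓝 ws) →
      Tendsto (fun t => t⁻¹ • (f t (w t) - w t)) U (𝓝 (f' ws)) := by
    intro f f' w ws h1 h2
    refine ((isBoundedBilinearMap_apply.continuous.tendsto (f', ws)).comp
      (h1.prodMk_nhds h2)).congr fun t => ?_
    simp
  have happ : ∀ {f : ℝ → E →L[ℝ] E} {w : ℝ → E} {ws : E}, Tendsto f U (𝓝 1) →
      Tendsto w U (𝓝 ws) → Tendsto (fun t => f t (w t)) U (𝓝 ws) := by
    intro f w ws h1 h2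
    exact (isBoundedBilinearMap_apply.continuous.tendsto ((1 : E →L[ℝ] E), ws)).comp
      (h1.prodMk_nhds h2)
  have hvd : ∀ {w : ℝ → E} {ws : E}, ‖ws‖ = 1 → Tendsto w U (𝓝 ws) →
      Tendsto (fun t => t⁻¹ • (v (J t (w t)) - v (w t))) U
        (𝓝 (-⟪gradient v ws, (S + K) ws⟫)) := by
    intro w ws hws hw
    have h1 := tendsto_smul_sub_of_hasStrictFDerivAt
      (hasStrictFDerivAt_of_contDiffAt_two (hv.contDiffAt ws (hne_of_unit hws))) hw (happ hJ1 hw)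
      (hquot hJs hw)
    rwa [innerSL_apply_apply, neg_apply, inner_neg_right] at h1
  -- Divided by t, the maximality inequality tends to one for -⟪∇v, (S+K)·⟫ - Q. That function is m
  -- at x₀ and at most m - (1 - ⟪·, x₀⟫)² elsewhere on the sphere, so x₀ is the only possible limit.
  have hys0 : ys = x₀ := by
    have h1 := (hvd hys hyt).sub ((hQC ys (hne_of_unit hys)).continuousAt.tendsto.comp hyt)
    have h2 := (hvd hF.norm₀ (tendsto_const_nhds (x := x₀))).sub
      (tendsto_const_nhds (x := Q x₀))
    have h3 := le_of_tendsto_of_tendsto h2 h1 (by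
      filter_upwards [hpos, hgood] with t ht hgt
      have h4 := mul_le_mul_of_nonneg_left (hymax t hgt x₀ hF.norm₀) (inv_pos.2 ht).le
      simp only [Function.comp_apply, smul_eq_mul]
      have e : ∀ a b : ℝ, t⁻¹ * (a - t * b) = t⁻¹ * a - b := fun a b => by
        rw [mul_sub, ← mul_assoc, inv_mul_cancel₀ ht.ne', one_mul]
      rwa [e, e] at h4)
    rw [← hξ₀, hAx, hgx₁, neg_neg, hQ1 x₀ hF.norm₀, hQ1 ys hys, hF.barrierOp₀,
      real_inner_self_eq_norm_sq, hF.norm₀] at h3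
    have h5 := hF.neg_inner_le hys (hv.inner_gradient_self (hne_of_unit hys)) (hmax ys hys)
    have h6 : (1 - ⟪ys, x₀⟫) ^ 2 ≤ 0 := by
      simp only [inner_zero_left] at h3
      nlinarith
    have h7 : ⟪ys, x₀⟫ = 1 := by nlinarith [pow_eq_zero_iff (two_ne_zero) |>.1 (le_antisymm h6 (sq_nonneg _))]
    exact (inner_eq_one_iff_of_norm_eq_one hys hF.norm₀).1 h7
  rw [hys0] at hyt
  clear hys0 hys ys
  have hxt : Tendsto (fun t => J t (y t)) U (𝓝 x₀) := happ hJ1 hyt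
  have hgC := hasStrictFDerivAt_gradient (hv.contDiffAt x₀ h00)
  have hgx : Tendsto (fun t => gradient v (J t (y t))) U (𝓝 ξ₀) :=
    hgC.continuousAt.tendsto.comp hxt
  have hgy : Tendsto (fun t => gradient v (y t)) U (𝓝 ξ₀) := hgC.continuousAt.tendsto.comp hyt
  have hHx : Tendsto (fun t => hess v (J t (y t))) U (𝓝 H₀) :=
    (continuousAt_hess (hv.contDiffAt x₀ h00)).tendsto.comp hxt
  have hQgy : Tendsto (fun t => gradient Q (y t)) U (𝓝 0) := by
    have := (contDiffAt_gradient (hQC x₀ h00)).continuousAt.tendsto.comp hyt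
    rwa [hQg] at this
  have hQhy : Tendsto (fun t => hess Q (y t)) U (𝓝 ((2 : ℝ) • B)) := by
    have := (continuousAt_hess (hQC x₀ h00)).tendsto.comp hyt
    rwa [hQh] at this
  -- the perturbed data
  set w : ℝ → E × (E →L[ℝ] E) := fun t =>
    (-S (gradient v (J t (y t))) - T t (gradient Q (y t)),
      -(S * hess v (J t (y t)) + hess v (J t (y t)) * S) +
        t • (S * hess v (J t (y t)) * S) - T t * hess Q (y t) * P t) with hw
  -- The first component vanishes in the limit because S kills ∇v(x₀) and ∇Q(x₀) = 0. Thus only the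
  -- Hessian slot is varied.
  have hwt : Tendsto w U (𝓝 (0, m • (S * S) + m • transProj x₀ x₁)) := by
    refine Tendsto.prodMk_nhds ?_ ?_
    · have h1 : Tendsto (fun t => S (gradient v (J t (y t)))) U (𝓝 0) := by
        have := (S.continuous.tendsto ξ₀).comp hgx
        rwa [hSξ] at this
      simpa using h1.neg.sub (happ hT1 hQgy)
    · rw [← hF.barrier_variation]
      have h1 : Tendsto (fun t => S * hess v (J t (y t))) U (𝓝 (S * H₀)) :=
        hHx.const_mul S
      have h2 : Tendsto (fun t => hess v (J t (y t)) * S) U (𝓝 (H₀ * S)) := hHx.mul_const S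
      have h3 := ((h1.add h2).neg.add (hid.smul (h1.mul_const S))).sub ((hT1.mul hQhy).mul hP1)
      simpa using h3
  set z0 : ℝ → E × (E →L[ℝ] E) := fun t => (gradient v (J t (y t)), hess v (J t (y t))) with hz0
  have hz0t : Tendsto z0 U (𝓝 (ξ₀, H₀)) := hgx.prodMk_nhds hHx
  set z : ℝ → E × (E →L[ℝ] E) := fun t => z0 t + t • w t with hz
  have hzt : Tendsto z U (𝓝 (ξ₀, H₀)) := by
    have := hz0t.add (hid.smul hwt)
    simpa using this
  have hzd : Tendsto (fun t => t⁻¹ • (z t - z0 t)) U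
      (𝓝 (0, m • (S * S) + m • transProj x₀ x₁)) := by
    refine hwt.congr' ?_
    filter_upwards [hpos] with t ht
    rw [hz, add_sub_cancel_left, smul_smul, inv_mul_cancel₀ ht.ne', one_smul]
  have hΨd := tendsto_smul_sub_of_hasStrictFDerivAt hΨ hz0t hzt hzd
  -- comparison
  have hz1 : ∀ t, (z t).1 = N t (gradient v (J t (y t))) - t • T t (gradient Q (y t)) := by
    intro t
    simp only [hz, hz0, hw, hN, Prod.fst_add, Prod.smul_fst, sub_apply, smul_apply,
      one_apply_eq_self]
    module
  have hz2 : ∀ t a, (z t).2 a = N t (hess v (J t (y t)) (N t a)) -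
      t • T t (hess Q (y t) (P t a)) := by
    intro t a
    simp only [hz, hz0, hw, hN, Prod.snd_add, Prod.smul_snd, sub_apply, smul_apply, add_apply,
      neg_apply, mul_apply_eq_comp, one_apply_eq_self, map_sub, map_smul]
    module
  have hcompare : ∀ᶠ t in (U : Filter ℝ),
      gradient v (y t) = Jt t (gradient v (J t (y t))) - t • gradient Q (y t) ∧
      Ψ (z t) ≤ Ψ (gradient v (y t), hess v (y t)) := by
    filter_upwards [hgood, hzt.eventually hmono] with t hgt hmt
    have hy0 := hne_of_unit (hy1 t)
    have hx0 := hgt _ hy0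
    obtain ⟨hc1, hc2⟩ := hv.contact hQC hQ0 hgt t (hy1 t) (hymax t hgt)
    rw [hadj] at hc1
    refine ⟨hc1, ?_⟩
    have hvs := hess_symm (hv.contDiffAt _ hy0)
    have hxs := hess_symm (hv.contDiffAt _ hx0)
    have hQs := hess_symm (hQC _ hy0)
    set A' : E →L[ℝ] E := T t * hess v (y t) * P t with hA'
    have hA'a : ∀ a, A' a = T t (hess v (y t) (P t a)) := fun a => rfl
    -- Rotating the data at y t back by R t gives both arguments the same first component, as
    -- monotonicity requires.
    have e1 : (z t).1 = (R t).symm (gradient v (y t)) := by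
      rw [hz1, ← hTR, hc1, map_sub, map_smul]
      simp only [hJtdef, mul_apply_eq_comp, hTP]
    have h1 := hmt (by
      intro a b
      rw [hz2, hz2, inner_sub_left, inner_sub_right, real_inner_smul_left, real_inner_smul_right,
        hNs, hxs, hNs, hTadj, hQs, hPadj]) A' (by
      intro a b
      rw [hA'a, hA'a, hTadj, hvs, hPadj]) (by
      intro a
      have h2 := hc2 (P t a)
      have e2 : J t (P t a) = N t a := by simp only [hJdef, mul_apply_eq_comp, hTP]
      rw [e2] at h2
      rw [hz2, hA'a, inner_sub_left, real_inner_smul_left, hNs, hTadj, hTadj]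
      exact h2)
    rw [e1] at h1
    refine h1.trans (le_of_eq (hinv (R t).symm (gradient v (y t)) (hess v (y t)) A'
      (hv.gradient_ne_zero hy0) hvs fun x => ?_))
    rw [hA'a, hPR, hTR]
    rfl
  -- the right-hand side
  have hyx : Tendsto (fun t => t⁻¹ • (y t - J t (y t))) U (𝓝 x₁) := by
    have := (hquot hJs hyt).neg
    rw [neg_apply, neg_neg, hAx] at this
    refine this.congr fun t => ?_
    rw [← smul_neg, neg_sub]
  have hGd := tendsto_smul_sub_of_hasStrictFDerivAt hG hxt hyt hyx
  have hvd' := tendsto_smul_sub_of_hasStrictFDerivAt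
    (hasStrictFDerivAt_of_contDiffAt_two (hv.contDiffAt x₀ h00)) hxt hyt hyx
  rw [innerSL_apply_apply, ← hξ₀, hgx₁] at hvd'
  have hgd : Tendsto (fun t => t⁻¹ • (gradient v (y t) - gradient v (J t (y t)))) U
      (𝓝 (K ξ₀)) := by
    have h1 := (hquot hJts hgx).sub hQgy
    rw [sub_apply, hSξ, sub_zero, sub_zero] at h1
    refine h1.congr' ?_
    filter_upwards [hpos, hcompare] with t ht hct
    rw [hct.1, sub_right_comm, smul_sub t⁻¹ _ (t • _), smul_smul, inv_mul_cancel₀ ht.ne', one_smul]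
  have hlog : HasStrictFDerivAt (fun ξ : E => Real.log (‖ξ‖ ^ 2))
      ((‖ξ₀‖ ^ 2)⁻¹ • (2 • innerSL ℝ ξ₀)) ξ₀ :=
    (hasStrictFDerivAt_norm_sq ξ₀).log (by simpa using hξ₀0)
  have hld := tendsto_smul_sub_of_hasStrictFDerivAt hlog hgx hgy hgd
  -- The gradient varies to first order by a skew operator applied to itself, so log|∇v|² has no
  -- first variation and c disappears.
  have hKξ : ⟪ξ₀, K ξ₀⟫ = 0 := by
    have := rotOp_skew x₀ x₁ ξ₀ ξ₀
    rw [real_inner_comm] at this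
    rw [hK]; linarith
  have hl0 : ((‖ξ₀‖ ^ 2)⁻¹ • (2 • innerSL ℝ ξ₀)) (K ξ₀) = 0 := by
    simp [hKξ]
  rw [hl0] at hld
  have hrhs := (hGd.add (hvd'.const_mul δ)).add (hld.const_mul c)
  have hfin := le_of_tendsto_of_tendsto hΨd hrhs (by
    filter_upwards [hpos, hgood, hcompare] with t ht hgt hct
    have hy0 := hne_of_unit (hy1 t)
    have e1 := heq _ hy0
    have e2 := heq _ (hgt _ hy0)
    have h1 := mul_le_mul_of_nonneg_left (sub_le_sub_right hct.2 (Ψ (z0 t))) (inv_pos.2 ht).le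
    simp only [smul_eq_mul]
    refine h1.trans (le_of_eq ?_)
    rw [hz0, e1, e2]
    ring)
  refine hfin.trans (le_of_eq ?_)
  ring

end MaximumPrinciple

/-! ### The inequality at a maximum point in terms of eigenvalues. -/

section Spectral

variable {E : Type*} [NormedAddCommGroup E] [InnerProductSpace ℝ E]

/-- Simultaneous diagonalization of the operator of an adapted frame and of its optimal
deformation on the orthogonal complement of `x₀ - m x₁`. -/
theorem AdaptedFrame.exists_basis [FiniteDimensional ℝ E] {H : E →L[ℝ] E} {x₀ x₁ : E} {m : ℝ}
    (h : AdaptedFrame H x₀ x₁ m) :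
    ∃ (d : ℕ) (b : OrthonormalBasis (Option (Option (Fin d))) ℝ E) (κ ε : Option (Fin d) → ℝ)
      (c : ℝ), x₀ - m • x₁ = c • b none ∧ κ none = 1 ∧ ε none = 0 ∧
      (∀ i, i ≠ none → m * ε i = (1 - κ i) ^ 2 + m ^ 2) ∧
      (∀ i j, ⟪H (b (some i)), b (some j)⟫ = if i = j then κ i else 0) ∧
      ∀ i j, ⟪(m • (transOp H x₀ x₁ m * transOp H x₀ x₁ m) + m • transProj x₀ x₁) (b (some i)),
        b (some j)⟫ = if i = j then ε i else 0 := by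
  have hm := h.pos
  have h00 : ⟪x₀, x₀⟫ = 1 := by rw [real_inner_self_eq_norm_sq, h.norm₀, one_pow]
  have h11 : ⟪x₁, x₁⟫ = 1 := by rw [real_inner_self_eq_norm_sq, h.norm₁, one_pow]
  have h01 := h.orth
  have h10 : ⟪x₁, x₀⟫ = 0 := by rw [real_inner_comm, h01]
  set W : Submodule ℝ E := (Submodule.span ℝ {x₀, x₁})ᗮ with hW
  have hWm : ∀ x, x ∈ W ↔ ⟪x₀, x⟫ = 0 ∧ ⟪x₁, x⟫ = 0 := by
    intro x
    rw [hW, Submodule.mem_orthogonal]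
    constructor
    · intro hx
      exact ⟨hx _ (Submodule.subset_span (by simp)), hx _ (Submodule.subset_span (by simp))⟩
    · rintro ⟨h1, h2⟩ u hu
      obtain ⟨a, b, rfl⟩ := Submodule.mem_span_pair.1 hu
      rw [inner_add_left, real_inner_smul_left, real_inner_smul_left, h1, h2]; simp
  have hHW : ∀ x ∈ W, (H : E →ₗ[ℝ] E) x ∈ W := by
    intro x hx
    obtain ⟨h1, h2⟩ := (hWm x).1 hx
    rw [hWm]
    simp only [ContinuousLinearMap.coe_coe]
    rw [← h.symm, ← h.symm, h.apply₀, h.apply₁]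
    simp [inner_add_left, real_inner_smul_left, h1, h2]
  have hsym : ((H : E →ₗ[ℝ] E).restrict hHW).IsSymmetric :=
    LinearMap.IsSymmetric.restrict_invariant (fun x y => h.symm x y) hHW
  set d := Module.finrank ℝ W with hd
  set u := hsym.eigenvectorBasis (n := d) rfl with hu
  set μ := hsym.eigenvalues (n := d) rfl with hμ
  have hHu : ∀ i, H (u i : E) = μ i • (u i : E) := by
    intro i
    exact congrArg (Subtype.val) (hsym.apply_eigenvectorBasis (n := d) rfl i)
  have hu0 : ∀ i, ⟪x₀, (u i : E)⟫ = 0 := fun i => ((hWm _).1 (u i).2).1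
  have hu1 : ∀ i, ⟪x₁, (u i : E)⟫ = 0 := fun i => ((hWm _).1 (u i).2).2
  have huu : ∀ i j, ⟪(u i : E), (u j : E)⟫ = if i = j then 1 else 0 := fun i j => by
    rw [← Submodule.coe_inner]; exact orthonormal_iff_ite.1 u.orthonormal i j
  have hs0 : 0 < 1 + m ^ 2 := by positivity
  set s := √(1 + m ^ 2) with hs
  have hss : s * s = 1 + m ^ 2 := Real.mul_self_sqrt hs0.le
  have hsp : 0 < s := Real.sqrt_pos.2 hs0
  have hinv : s⁻¹ * (s⁻¹ * (1 + m ^ 2)) = 1 := by rw [← hss]; field_simp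
  -- The outer `none` is the normal direction, `some none` the direction of m x₀ + x₁ that completes
  -- the plane, and the rest are transversal eigenvectors of H.
  set B : Option (Option (Fin d)) → E := fun o => o.elim (s⁻¹ • (x₀ - m • x₁))
    fun o => o.elim (s⁻¹ • (m • x₀ + x₁)) fun i => (u i : E) with hB
  have hu0' : ∀ i, ⟪(u i : E), x₀⟫ = 0 := fun i => by rw [real_inner_comm, hu0]
  have hu1' : ∀ i, ⟪(u i : E), x₁⟫ = 0 := fun i => by rw [real_inner_comm, hu1]
  have hBo : Orthonormal ℝ B := by
    rw [orthonormal_iff_ite]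
    rintro (_ | _ | i) (_ | _ | j) <;>
      simp only [hB, Option.elim_none, Option.elim_some, inner_add_left, inner_add_right, inner_sub_left, inner_sub_right,
        real_inner_smul_left, real_inner_smul_right, h00, h01, h10, h11, hu0, hu1, hu0', hu1',
        huu, Option.some.injEq, reduceCtorEq, if_true, if_false]
    all_goals first | linear_combination hinv | ring
  have hBs : (Submodule.span ℝ (Set.range B))ᗮ = ⊥ := by
    rw [Submodule.eq_bot_iff]
    intro x hx
    have hx' : ∀ i, ⟪B i, x⟫ = 0 := fun i =>
      (Submodule.mem_orthogonal _ _).1 hx _ (Submodule.subset_span ⟨i, rfl⟩)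
    have e1 := hx' none
    have e2 := hx' (some none)
    simp only [hB, Option.elim_none, Option.elim_some, inner_add_left, inner_sub_left, real_inner_smul_left, mul_eq_zero,
      inv_eq_zero, hsp.ne', false_or] at e1 e2
    have e4 : ⟪x₁, x⟫ = 0 := by
      have : (1 + m ^ 2) * ⟪x₁, x⟫ = 0 := by linear_combination e2 - m * e1
      simpa [hs0.ne'] using this
    have e3 : ⟪x₀, x⟫ = 0 := by rw [e4] at e1; linarith
    have hxW : x ∈ W := (hWm x).2 ⟨e3, e4⟩
    have : (⟨x, hxW⟩ : W) = 0 := InnerProductSpace.ext_inner_left_basis (𝕜 := ℝ) u.toBasis (fun i => by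
      rw [inner_zero_right, Submodule.coe_inner]
      simpa [hB] using hx' (some (some i)))
    exact congrArg Subtype.val this
  set b := OrthonormalBasis.mkOfOrthogonalEqBot hBo hBs with hb
  have hbB : ∀ i, b i = B i := fun i => by rw [hb, OrthonormalBasis.coe_of_orthogonal_eq_bot_mk]
  have hproju : ∀ i, transProj x₀ x₁ (u i : E) = u i := fun i => by
    rw [transProj_apply, hu0, hu1]; simp
  have hSu : ∀ i, transOp H x₀ x₁ m (u i : E) = (m⁻¹ * (1 - μ i)) • (u i : E) := fun i => by
    rw [transOp, smul_apply, sub_apply, mul_apply_eq_comp, hproju, hHu]; module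
  refine ⟨d, b, fun i => i.elim 1 μ, fun i => i.elim 0 fun i => m⁻¹ * ((1 - μ i) ^ 2 + m ^ 2), s,
    ?_, rfl, rfl, ?_, ?_, ?_⟩
  · rw [hbB]
    simp only [hB, Option.elim_none]
    rw [smul_smul, mul_inv_cancel₀ hsp.ne', one_smul]
  · rintro (_ | i) hi
    · exact absurd rfl hi
    · simp only [Option.elim]
      rw [← mul_assoc, mul_inv_cancel₀ hm.ne', one_mul]
  -- The quadratic form of H on this vector of squared length 1 + m² is 1 + m², which gives the
  -- eigenvalue 1 of the compression.
  · have hτ : H (m • x₀ + x₁) = (1 + m ^ 2) • x₁ := by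
      rw [map_add, map_smul, h.apply₀, h.apply₁]; module
    rintro (_ | i) (_ | j) <;> simp only [hbB] <;>
      simp only [hB, Option.elim_none, Option.elim_some, map_smul, hτ, hHu, inner_add_right,
        real_inner_smul_left, real_inner_smul_right, h10, h11, hu1, hu0', hu1',
        huu, Option.some.injEq, reduceCtorEq, if_true, if_false, Option.elim_none, Option.elim_some]
    · linear_combination hinv
    · ring
    · ring
    · split_ifs <;> ring
  · have hτ : (m • (transOp H x₀ x₁ m * transOp H x₀ x₁ m) + m • transProj x₀ x₁)
        (m • x₀ + x₁) = 0 := by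
      simp [h.transOp₀, h.transOp₁, h.transProj₀, h.transProj₁]
    have hEu : ∀ i, (m • (transOp H x₀ x₁ m * transOp H x₀ x₁ m) + m • transProj x₀ x₁)
        (u i : E) = (m⁻¹ * ((1 - μ i) ^ 2 + m ^ 2)) • (u i : E) := fun i => by
      rw [add_apply, smul_apply, smul_apply, mul_apply_eq_comp, hSu, map_smul, hSu, hproju,
        smul_smul, smul_smul, ← add_smul]
      congr 1
      field_simp
    rintro (_ | i) (_ | j) <;> simp only [hbB] <;>
      simp only [hB, Option.elim_none, Option.elim_some, map_smul, hτ, hEu, inner_add_right, inner_zero_left, smul_zero,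
        real_inner_smul_left, real_inner_smul_right, hu0', hu1',
        huu, Option.some.injEq, reduceCtorEq, if_true, if_false, Option.elim_none, Option.elim_some]
    · ring
    · split_ifs <;> ring

/-- At a maximum point of the gradient, the logarithmic derivative of the curvature quotient in the
direction of the optimal deformation is controlled by the right-hand side of the equation. -/
theorem LogHomogeneous.exists_logDeriv_le [FiniteDimensional ℝ E] {d : ℕ}
    (hd : Module.finrank ℝ E = d + 1) {v : E → ℝ}
    (hv : LogHomogeneous v) {p k l : ℕ} (hlk : l < k) {x₀ : E} {m : ℝ} (hx₀ : ‖x₀‖ = 1)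
    (hm : 0 < m) (hg : ‖gradient v x₀‖ ^ 2 = 1 + m ^ 2)
    (hmax : ∀ y, ‖y‖ = 1 → ‖gradient v y‖ ^ 2 ≤ 1 + m ^ 2)
    (hcone : InCone k (pSums p (curv (gradient v x₀) (hess v x₀))))
    {G : E → ℝ} {G' : E →L[ℝ] ℝ} (hG : HasStrictFDerivAt G G' x₀) {δ c : ℝ}
    (heq : ∀ x, x ≠ 0 → Real.log ((pSums p (curv (gradient v x) (hess v x))).esymm k) -
      Real.log ((pSums p (curv (gradient v x) (hess v x))).esymm l) =
        G x + δ * v x + c * Real.log (‖gradient v x‖ ^ 2)) :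
    ∃ (d' : ℕ) (κ ε : Option (Fin d') → ℝ), d' + 1 = d ∧
      curv (gradient v x₀) (hess v x₀) = Finset.univ.val.map κ ∧ κ none = 1 ∧ ε none = 0 ∧
      (∀ i, i ≠ none → m * ε i = (1 - κ i) ^ 2 + m ^ 2) ∧
      logDeriv p k l κ ε ≤ G' (m⁻¹ • (x₀ - gradient v x₀)) - δ * m := by
  have h00 : x₀ ≠ 0 := by rintro rfl; simp at hx₀
  have hF := hv.adaptedFrame hx₀ hm hg hmax
  set x₁ := m⁻¹ • (x₀ - gradient v x₀) with hx₁
  have hξ : gradient v x₀ = x₀ - m • x₁ := by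
    rw [hx₁, smul_smul, mul_inv_cancel₀ hm.ne', one_smul, sub_sub_cancel]
  have hξ0 := hv.gradient_ne_zero h00
  choose Φ hΦ1 hΦ2 using fun j => exists_smooth_esymm_pSums_curv hd p j
  have hpos : ∀ j ≤ k, 0 < Φ j (gradient v x₀, hess v x₀) := fun j hj => by
    rw [hΦ2 j _ _ hξ0 hF.symm]; exact hcone j hj
  have hstr : ∀ j, HasStrictFDerivAt (Φ j) (fderiv ℝ (Φ j) (gradient v x₀, hess v x₀))
      (gradient v x₀, hess v x₀) := fun j =>
    (hΦ1 j (gradient v x₀, hess v x₀) hξ0).hasStrictFDerivAt one_ne_zero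
  have hΨ := ((hstr k).log (hpos k le_rfl).ne').sub ((hstr l).log (hpos l hlk.le).ne')
  set Ψ' := (Φ k (gradient v x₀, hess v x₀))⁻¹ • fderiv ℝ (Φ k) (gradient v x₀, hess v x₀) -
    (Φ l (gradient v x₀, hess v x₀))⁻¹ • fderiv ℝ (Φ l) (gradient v x₀, hess v x₀)
  have hmain := hv.variation_le hF hξ hmax hΨ
    (fun R ξ A A' hξ hA hA' => by
      have hA's : ∀ x y, ⟪A' x, y⟫ = ⟪x, A' y⟫ := fun x y => by
        rw [hA', hA', LinearIsometryEquiv.inner_map_eq_flip, hA,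
          ← R.inner_map_map (R.symm x), LinearIsometryEquiv.apply_symm_apply]
      have hRξ : R ξ ≠ 0 := by simpa using hξ
      simp only [Pi.sub_apply]
      rw [hΦ2 k _ _ hRξ hA's, hΦ2 l _ _ hRξ hA's, hΦ2 k _ _ hξ hA, hΦ2 l _ _ hξ hA,
        curv_conj hξ hA R hA'])
    (by
      -- The cone is an open condition, so monotonicity is available near the base point, although
      -- not globally.
      have h1 : ∀ᶠ z in 𝓝 (gradient v x₀, hess v x₀), ∀ j ∈ Finset.range (k + 1), 0 < Φ j z :=
        (Filter.eventually_all_finset _).2 fun j hj =>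
          (hstr j).continuousAt.eventually (lt_mem_nhds (hpos j (by
            have := Finset.mem_range.1 hj; omega)))
      have h2 : ∀ᶠ z : E × (E →L[ℝ] E) in 𝓝 (gradient v x₀, hess v x₀), z.1 ≠ 0 :=
        continuousAt_fst.eventually_ne hξ0
      filter_upwards [h1, h2] with z hz hz0 hzs A' hA' hle
      have e : ∀ j, Φ j z = (pSums p (curv z.1 z.2)).esymm j := fun j => hΦ2 j z.1 z.2 hz0 hzs
      have hc : InCone k (pSums p (curv z.1 z.2)) := fun j hj => by
        rw [← e]; exact hz j (Finset.mem_range.2 (by omega))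
      obtain ⟨hc', hr⟩ := hc.rel_mono hlk
        (pSums_curv_rel_mono hzs hA' (fun x _ => hle x) p)
      simp only [Pi.sub_apply]
      rw [e, e, hΦ2 k _ _ hz0 hA', hΦ2 l _ _ hz0 hA',
        ← Real.log_div (hc k le_rfl).ne' (hc l hlk.le).ne',
        ← Real.log_div (hc' k le_rfl).ne' (hc' l hlk.le).ne']
      exact Real.log_le_log (div_pos (hc k le_rfl) (hc l hlk.le)) hr)
    hG (δ := δ) (c := c) (fun x hx => by
      have hxs := hess_symm (hv.contDiffAt x hx)
      have hx0 := hv.gradient_ne_zero hx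
      simp only [Pi.sub_apply]
      rw [hΦ2 k _ _ hx0 hxs, hΦ2 l _ _ hx0 hxs, heq x hx])
  obtain ⟨d', b, κ, ε, c', hbc, hκ, hε₀, hε, hbH, hbE⟩ := hF.exists_basis
  rw [← hξ] at hbc
  have hcurv := curv_of_basis b hξ0 hbc hF.symm hbH
  refine ⟨d', κ, ε, ?_, hcurv, hκ, hε₀, hε, ?_⟩
  · have := Module.finrank_eq_card_basis b.toBasis
    simp only [Fintype.card_option, Fintype.card_fin] at this
    omega
  refine le_of_eq_of_le ?_ hmain
  set E₀ := m • (transOp (hess v x₀) x₀ x₁ m * transOp (hess v x₀) x₀ x₁ m) +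
    m • transProj x₀ x₁ with hE₀
  have hE₀s : ∀ x y, ⟪E₀ x, y⟫ = ⟪x, E₀ y⟫ := fun x y => by
    simp only [hE₀, smul_apply, add_apply, mul_apply_eq_comp, real_inner_smul_left,
      real_inner_smul_right, inner_add_left, inner_add_right, hF.transOp_symm, transProj_symm]
  -- Along this line the common basis keeps the compression diagonal, with eigenvalues κ_i + t ε_i.
  -- Hence the derivative of Ψ in the direction E₀ is `logDeriv`.
  have hline : HasDerivAt (fun t : ℝ => (gradient v x₀, hess v x₀ + t • E₀)) (0, E₀) 0 := by
    refine (hasDerivAt_const _ _).prodMk ?_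
    simpa using ((hasDerivAt_id (0 : ℝ)).smul_const E₀).const_add (hess v x₀)
  have hcomp := HasFDerivAt.comp_hasDerivAt (0 : ℝ) (by simpa using hΨ.hasFDerivAt) hline
  refine (hasDerivAt_logDeriv (by rw [← hcurv]; exact hcone) hlk.le ε).unique
    (hcomp.congr_of_eventuallyEq (Eventually.of_forall fun t => ?_))
  have hts : ∀ x y, ⟪(hess v x₀ + t • E₀) x, y⟫ = ⟪x, (hess v x₀ + t • E₀) y⟫ := fun x y => by
    simp only [add_apply, smul_apply, inner_add_left, inner_add_right, real_inner_smul_left,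
      real_inner_smul_right, hE₀s, hF.symm]
  have hct := curv_of_basis b hξ0 hbc hts (κ := fun i => κ i + t * ε i) (fun i j => by
    rw [add_apply, smul_apply, inner_add_left, real_inner_smul_left, hbH, hbE]
    split_ifs <;> ring)
  simp only [Function.comp_apply, Pi.sub_apply]
  rw [hΦ2 k _ _ hξ0 hts, hΦ2 l _ _ hξ0 hts, hct]

end Spectral

/-! ### Homogeneity of σ_j and of Λ. -/

theorem esymm_map_const_mul (c : ℝ) (s : Multiset ℝ) (j : ℕ) :
    (s.map (c * ·)).esymm j = c ^ j * s.esymm j := by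
  rw [Multiset.esymm, Multiset.esymm, Multiset.powersetCard_map, Multiset.map_map,
    ← Multiset.sum_map_mul_left]
  refine congrArg Multiset.sum (Multiset.map_congr rfl fun t ht => ?_)
  have := (Multiset.mem_powersetCard.1 ht).2
  simpa [this] using Multiset.prod_map_mul (m := t) (f := fun _ => c) (g := fun x => x)

theorem pSums_map_const_mul (c : ℝ) (p : ℕ) (s : Multiset ℝ) :
    pSums p (s.map (c * ·)) = (pSums p s).map (c * ·) := by
  rw [pSums, pSums, Multiset.powersetCard_map, Multiset.map_map, Multiset.map_map]
  refine Multiset.map_congr rfl fun t _ => ?_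
  simpa using Multiset.sum_map_mul_left (s := t) (a := c) (f := fun x => x)

/-! ### From the hypersurface to the log-homogeneous function v. -/

section Geometry

variable {n : ℕ}

theorem radialExt_smul (g : Sph n → ℝ) {t : ℝ} (ht : 0 < t) (X : Amb n) :
    radialExt g (t • X) = radialExt g X := by
  rcases eq_or_ne X 0 with rfl | hX
  · simp
  · rw [radialExt, radialExt, dif_pos hX, dif_pos (smul_ne_zero ht.ne' hX)]
    congr 2
    rw [norm_smul, Real.norm_of_nonneg ht.le, mul_inv, smul_smul, mul_assoc, mul_comm,
      mul_assoc, mul_inv_cancel₀ ht.ne', mul_one]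

theorem radialExt_coe (g : Sph n → ℝ) (x : Sph n) : radialExt g (x : Amb n) = g x := by
  have hx : ‖(x : Amb n)‖ = 1 := by simp
  have h0 : (x : Amb n) ≠ 0 := by intro h; simp [h] at hx
  rw [radialExt, dif_pos h0]
  congr 1
  ext1
  simp [hx]

theorem radialExt_comp (φ : ℝ → ℝ) (g : Sph n → ℝ) {X : Amb n} (hX : X ≠ 0) :
    radialExt (fun x => φ (g x)) X = φ (radialExt g X) := by
  rw [radialExt, radialExt, dif_pos hX, dif_pos hX]

theorem radialExt_pos {g : Sph n → ℝ} (hg : ∀ x, 0 < g x) {X : Amb n} (hX : X ≠ 0) :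
    0 < radialExt g X := by
  rw [radialExt, dif_pos hX]; exact hg _

theorem IsC2.contDiffAt_radialExt {g : Sph n → ℝ} (hg : IsC2 g) {X : Amb n} (hX : X ≠ 0) :
    ContDiffAt ℝ 2 (radialExt g) X := by
  let U : TopologicalSpace.Opens (Amb n) := ⟨{0}ᶜ, isOpen_compl_singleton⟩
  have hU : ∀ x : U, (x : Amb n) ≠ 0 := fun x => x.2
  have h1 : ContMDiff 𝓘(ℝ, Amb n) 𝓘(ℝ, Amb n) 2 fun x : U => ‖(x : Amb n)‖⁻¹ • (x : Amb n) := by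
    intro x
    refine contMDiffAt_subtype_iff (f := fun x : Amb n => ‖x‖⁻¹ • x) |>.2 ?_
    exact (((contDiffAt_norm ℝ (hU x)).inv (norm_ne_zero_iff.2 (hU x))).smul
      contDiffAt_id).contMDiffAt
  have h2 : ∀ x : U, ‖(x : Amb n)‖⁻¹ • (x : Amb n) ∈ Metric.sphere (0 : Amb n) 1 := fun x => by
    rw [mem_sphere_zero_iff_norm, norm_smul, norm_inv, norm_norm,
      inv_mul_cancel₀ (norm_ne_zero_iff.mpr (hU x))]
  have h3 : ContMDiff 𝓘(ℝ, Amb n) 𝓘(ℝ, ℝ) 2 fun x : U => radialExt g (x : Amb n) := by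
    refine (hg.comp (h1.codRestrict_sphere h2)).congr fun x => ?_
    rw [radialExt, dif_pos (hU x)]
    rfl
  exact (contMDiffAt_subtype_iff.1 (h3 ⟨X, hX⟩)).contDiffAt

/-- The logarithm of the level function. -/
noncomputable def logLevel (ρ : Sph n → ℝ) (X : Amb n) : ℝ := Real.log (levelFun ρ X)

variable {ρ : Sph n → ℝ}

theorem levelFun_pos (hpos : ∀ x, 0 < ρ x) {X : Amb n} (hX : X ≠ 0) : 0 < levelFun ρ X :=
  div_pos (norm_pos_iff.2 hX) (radialExt_pos hpos hX)

theorem contDiffAt_levelFun (hρ : IsC2 ρ) (hpos : ∀ x, 0 < ρ x) {X : Amb n} (hX : X ≠ 0) :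
    ContDiffAt ℝ 2 (levelFun ρ) X :=
  (contDiffAt_norm ℝ hX).div (hρ.contDiffAt_radialExt hX) (radialExt_pos hpos hX).ne'

theorem logHomogeneous_logLevel (hρ : IsC2 ρ) (hpos : ∀ x, 0 < ρ x) :
    LogHomogeneous (logLevel ρ) where
  contDiffAt X hX := (contDiffAt_levelFun hρ hpos hX).log (levelFun_pos hpos hX).ne'
  smul t ht X hX := by
    rw [logLevel, logLevel, levelFun, radialExt_smul ρ ht, norm_smul, Real.norm_of_nonneg ht.le,
      mul_div_assoc]
    exact (Real.log_mul ht.ne' (levelFun_pos hpos hX).ne').trans (add_comm _ _)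

theorem logLevel_eq (hpos : ∀ x, 0 < ρ x) {X : Amb n} (hX : X ≠ 0) :
    logLevel ρ X = Real.log ‖X‖ - radialExt (fun x => Real.log (ρ x)) X := by
  rw [radialExt_comp Real.log ρ hX, logLevel, levelFun,
    Real.log_div (norm_ne_zero_iff.2 hX) (radialExt_pos hpos hX).ne']

theorem gradient_log_norm {x : Amb n} (hx : x ≠ 0) :
    gradient (fun y : Amb n => Real.log ‖y‖) x = (‖x‖ ^ 2)⁻¹ • x := by
  have h1 : (fun y : Amb n => Real.log ‖y‖) = fun y => 2⁻¹ * Real.log (‖y‖ ^ 2) := by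
    ext y; rw [Real.log_pow]; push_cast; ring
  rw [h1]
  refine gradient_eq_of_hasFDerivAt (((hasStrictFDerivAt_norm_sq x).log
    (by simpa using hx)).hasFDerivAt.const_mul (2⁻¹ : ℝ)) fun y => ?_
  simp [real_inner_smul_left]
  ring

theorem contDiffAt_log_norm {x : Amb n} (hx : x ≠ 0) :
    ContDiffAt ℝ 2 (fun y : Amb n => Real.log ‖y‖) x :=
  (contDiffAt_norm ℝ hx).log (norm_ne_zero_iff.2 hx)

theorem IsC2.log (hρ : IsC2 ρ) (hpos : ∀ x, 0 < ρ x) : IsC2 fun x => Real.log (ρ x) := fun x =>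
  (Real.contDiffAt_log.2 (hpos x).ne').contMDiffAt.comp x (hρ x)

theorem sphGrad_log (hρ : IsC2 ρ) (hpos : ∀ x, 0 < ρ x) (x : Sph n) :
    sphGrad (fun y => Real.log (ρ y)) x = (x : Amb n) - gradient (logLevel ρ) x := by
  have hx : ‖(x : Amb n)‖ = 1 := by simp
  have h0 : (x : Amb n) ≠ 0 := by intro h; simp [h] at hx
  have h1 : logLevel ρ =ᶠ[𝓝 (x : Amb n)]
      fun X => Real.log ‖X‖ - radialExt (fun x => Real.log (ρ x)) X := by
    filter_upwards [isOpen_ne.mem_nhds h0] with X hX using logLevel_eq hpos hX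
  rw [sphGrad, gradient, gradient, h1.fderiv_eq, ← gradient, ← gradient,
    gradient_sub' (contDiffAt_log_norm h0) ((hρ.log hpos).contDiffAt_radialExt h0),
    gradient_log_norm h0, hx]
  simp

theorem norm_sphGrad_log_sq (hρ : IsC2 ρ) (hpos : ∀ x, 0 < ρ x) (x : Sph n) :
    ‖gradient (logLevel ρ) (x : Amb n)‖ ^ 2 =
      1 + ‖sphGrad (fun y => Real.log (ρ y)) x‖ ^ 2 := by
  have hx : ‖(x : Amb n)‖ = 1 := by simp
  have h0 : (x : Amb n) ≠ 0 := by intro h; simp [h] at hx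
  rw [sphGrad_log hρ hpos, norm_sub_sq_real, hx, real_inner_comm,
    (logHomogeneous_logLevel hρ hpos).inner_gradient_self h0]
  ring

theorem gradient_levelFun (hρ : IsC2 ρ) (hpos : ∀ x, 0 < ρ x) {X : Amb n} (hX : X ≠ 0) :
    gradient (levelFun ρ) X = levelFun ρ X • gradient (logLevel ρ) X := by
  have h1 : levelFun ρ =ᶠ[𝓝 X] fun Y => Real.exp (logLevel ρ Y) := by
    filter_upwards [isOpen_ne.mem_nhds hX] with Y hY
    rw [logLevel, Real.exp_log (levelFun_pos hpos hY)]
  have h2 := (hasStrictFDerivAt_of_contDiffAt_two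
    ((logHomogeneous_logLevel hρ hpos).contDiffAt X hX)).exp.hasFDerivAt.congr_of_eventuallyEq h1
  refine gradient_eq_of_hasFDerivAt h2 fun y => ?_
  rw [logLevel, Real.exp_log (levelFun_pos hpos hX)]
  simp only [smul_apply, innerSL_apply_apply, real_inner_smul_left, smul_eq_mul]

theorem outerNormal_eq (hρ : IsC2 ρ) (hpos : ∀ x, 0 < ρ x) {X : Amb n} (hX : X ≠ 0) :
    outerNormal ρ X = ‖gradient (logLevel ρ) X‖⁻¹ • gradient (logLevel ρ) X := by
  have h := levelFun_pos hpos hX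
  rw [outerNormal, gradient_levelFun hρ hpos hX, norm_smul, Real.norm_of_nonneg h.le, mul_inv,
    smul_smul, mul_assoc, mul_comm, mul_assoc, mul_inv_cancel₀ h.ne', mul_one]

/-- The derivative of the normalizing factor contributes only a multiple of ∇v, which is orthogonal
to y. -/
theorem inner_fderiv_outerNormal (hρ : IsC2 ρ) (hpos : ∀ x, 0 < ρ x) {X : Amb n} (hX : X ≠ 0)
    (a : Amb n) {y : Amb n} (hy : ⟪gradient (logLevel ρ) X, y⟫ = 0) :
    ⟪fderiv ℝ (outerNormal ρ) X a, y⟫ =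
      ‖gradient (logLevel ρ) X‖⁻¹ * ⟪hess (logLevel ρ) X a, y⟫ := by
  have hv := logHomogeneous_logLevel hρ hpos
  have h1 : outerNormal ρ =ᶠ[𝓝 X]
      fun Y => ‖gradient (logLevel ρ) Y‖⁻¹ • gradient (logLevel ρ) Y := by
    filter_upwards [isOpen_ne.mem_nhds hX] with Y hY using outerNormal_eq hρ hpos hY
  have hg := contDiffAt_gradient (hv.contDiffAt X hX)
  have hn : ‖gradient (logLevel ρ) X‖ ≠ 0 := norm_ne_zero_iff.2 (hv.gradient_ne_zero hX)
  have h2 : DifferentiableAt ℝ (fun Y => ‖gradient (logLevel ρ) Y‖⁻¹) X :=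
    ((hg.norm ℝ (hv.gradient_ne_zero hX)).inv hn).differentiableAt one_ne_zero
  rw [h1.fderiv_eq, fderiv_fun_smul h2 (hg.differentiableAt one_ne_zero)]
  simp only [add_apply, smul_apply, ContinuousLinearMap.smulRight_apply, inner_add_left,
    real_inner_smul_left, hy, mul_zero, add_zero, hess]

theorem principalCurvatures_eq (hρ : IsC2 ρ) (hpos : ∀ x, 0 < ρ x) {X : Amb n} (hX : X ≠ 0) :
    principalCurvatures ρ X = (curv (gradient (logLevel ρ) X) (hess (logLevel ρ) X)).map
      (‖gradient (logLevel ρ) X‖⁻¹ * ·) := by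
  have hv := logHomogeneous_logLevel hρ hpos
  have h0 := hv.gradient_ne_zero hX
  have hn : ‖gradient (logLevel ρ) X‖ ≠ 0 := norm_ne_zero_iff.2 h0
  have hs := hess_symm (hv.contDiffAt X hX)
  have h1 : principalCurvatures ρ X = curv (outerNormal ρ X) (fderiv ℝ (outerNormal ρ) X) := rfl
  have hs' : ∀ x y, ⟪(‖gradient (logLevel ρ) X‖⁻¹ • hess (logLevel ρ) X) x, y⟫ =
      ⟪x, (‖gradient (logLevel ρ) X‖⁻¹ • hess (logLevel ρ) X) y⟫ := fun x y => by
    rw [smul_apply, smul_apply, real_inner_smul_left, real_inner_smul_right, hs]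
  rw [h1, curv_congr (A' := ‖gradient (logLevel ρ) X‖⁻¹ • hess (logLevel ρ) X),
    outerNormal_eq hρ hpos hX, curv_smul_left h0 (inv_ne_zero hn) hs',
    curv_smul_right h0 _ hs]
  intro x y _ hy
  rw [outerNormal_eq hρ hpos hX, real_inner_smul_left, mul_eq_zero, inv_eq_zero,
    or_iff_right hn] at hy
  rw [inner_fderiv_outerNormal hρ hpos hX x hy, smul_apply, real_inner_smul_left]

theorem mem_radialGraph (hpos : ∀ x, 0 < ρ x) {X : Amb n} (hX : X ≠ 0) (h : logLevel ρ X = 0) :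
    X ∈ radialGraph ρ := by
  have h1 := levelFun_pos hpos hX
  have h2 : levelFun ρ X = 1 := by rw [← Real.exp_log h1, ← logLevel, h, Real.exp_zero]
  rw [levelFun, div_eq_one_iff_eq (radialExt_pos hpos hX).ne', radialExt, dif_pos hX] at h2
  refine ⟨⟨‖X‖⁻¹ • X, _⟩, (congrArg (· • (‖X‖⁻¹ • X)) h2.symm).trans ?_⟩
  exact smul_inv_smul₀ (norm_ne_zero_iff.2 hX) X

/-- Every ray meets the hypersurface; the principal curvatures at the point of intersection. -/
theorem exists_mem_radialGraph (hρ : IsC2 ρ) (hpos : ∀ x, 0 < ρ x) {X : Amb n} (hX : X ≠ 0) :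
    Real.exp (-logLevel ρ X) • X ∈ radialGraph ρ ∧
    principalCurvatures ρ (Real.exp (-logLevel ρ X) • X) =
      (curv (gradient (logLevel ρ) X) (hess (logLevel ρ) X)).map
        (Real.exp (logLevel ρ X) * ‖gradient (logLevel ρ) X‖⁻¹ * ·) ∧
    ⟪Real.exp (-logLevel ρ X) • X, outerNormal ρ (Real.exp (-logLevel ρ X) • X)⟫ =
      Real.exp (-logLevel ρ X) * ‖gradient (logLevel ρ) X‖⁻¹ := by
  have hv := logHomogeneous_logLevel hρ hpos
  set t := Real.exp (-logLevel ρ X) with ht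
  have htp : 0 < t := Real.exp_pos _
  have hti : t⁻¹ = Real.exp (logLevel ρ X) := by rw [ht, Real.exp_neg, inv_inv]
  have hY : t • X ≠ 0 := smul_ne_zero htp.ne' hX
  have h0 := hv.gradient_ne_zero hX
  have hs := hess_symm (hv.contDiffAt X hX)
  have hs' : ∀ x y, ⟪(t⁻¹ ^ 2 • hess (logLevel ρ) X) x, y⟫ =
      ⟪x, (t⁻¹ ^ 2 • hess (logLevel ρ) X) y⟫ := fun x y => by
    rw [smul_apply, smul_apply, real_inner_smul_left, real_inner_smul_right, hs]
  have hnorm : ‖t⁻¹ • gradient (logLevel ρ) X‖⁻¹ = t * ‖gradient (logLevel ρ) X‖⁻¹ := by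
    rw [norm_smul, norm_inv, Real.norm_of_nonneg htp.le, mul_inv, inv_inv]
  refine ⟨mem_radialGraph hpos hY ?_, ?_, ?_⟩
  · rw [hv.smul t htp X hX, ht, Real.log_exp, add_neg_cancel]
  · rw [principalCurvatures_eq hρ hpos hY, hv.gradient_smul htp hX, hv.hess_smul htp hX,
      curv_smul_left h0 (inv_ne_zero htp.ne') hs', curv_smul_right h0 _ hs, Multiset.map_map,
      hnorm, ← hti]
    refine Multiset.map_congr rfl fun x _ => ?_
    simp only [Function.comp_apply]
    field_simp
  · rw [outerNormal_eq hρ hpos hY, real_inner_smul_right, real_inner_comm,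
      hv.inner_gradient_self hY, mul_one, hv.gradient_smul htp hX, hnorm]

theorem esymm_pSums_principalCurvatures (hρ : IsC2 ρ) (hpos : ∀ x, 0 < ρ x) {X : Amb n}
    (hX : X ≠ 0) (p j : ℕ) :
    (pSums p (principalCurvatures ρ (Real.exp (-logLevel ρ X) • X))).esymm j =
      (Real.exp (logLevel ρ X) * ‖gradient (logLevel ρ) X‖⁻¹) ^ j *
        (pSums p (curv (gradient (logLevel ρ) X) (hess (logLevel ρ) X))).esymm j := by
  rw [(exists_mem_radialGraph hρ hpos hX).2.1, pSums_map_const_mul, esymm_map_const_mul]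

theorem IsPKConvex.inCone {p k : ℕ} (h : IsPKConvex p k ρ) {X : Amb n} (hX : X ≠ 0) :
    InCone k (pSums p (curv (gradient (logLevel ρ) X) (hess (logLevel ρ) X))) := by
  intro j hj
  rcases Nat.eq_zero_or_pos j with rfl | hj0
  · rw [esymm_zero']; exact one_pos
  · have h1 := h.cone _ (exists_mem_radialGraph h.c2 h.pos hX).1 j hj0 hj
    rw [esymm_pSums_principalCurvatures h.c2 h.pos hX] at h1
    have h0 := norm_pos_iff.2 ((logHomogeneous_logLevel h.c2 h.pos).gradient_ne_zero hX)
    exact (pos_iff_pos_of_mul_pos h1).1 (by positivity)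

/-- The curvature equation in terms of the logarithm of the level function. -/
theorem SolvesEq.log_eq {p k l : ℕ} {b q : ℝ} {f : Sph n → ℝ} (hf : ∀ x, 0 < f x) (hlk : l < k)
    (hρ : IsPKConvex p k ρ) (h : SolvesEq p k l b q f ρ) {X : Amb n} (hX : X ≠ 0) :
    Real.log ((pSums p (curv (gradient (logLevel ρ) X) (hess (logLevel ρ) X))).esymm k) -
      Real.log ((pSums p (curv (gradient (logLevel ρ) X) (hess (logLevel ρ) X))).esymm l) =
        (Real.log (radialExt f X) + b * Real.log ‖X‖) + (-b - q - k + l) * logLevel ρ X +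
          ((k - l - q) / 2) * Real.log (‖gradient (logLevel ρ) X‖ ^ 2) := by
  have hv := logHomogeneous_logLevel hρ.c2 hρ.pos
  obtain ⟨h1, h2, h3⟩ := exists_mem_radialGraph hρ.c2 hρ.pos hX
  have h4 := h _ h1
  have hc := hρ.inCone hX
  have hg : 0 < ‖gradient (logLevel ρ) X‖ := norm_pos_iff.2 (hv.gradient_ne_zero hX)
  have hk := hc k le_rfl
  have hl := hc l hlk.le
  have hXn := norm_pos_iff.2 hX
  have hfX := radialExt_pos hf hX
  rw [esymm_pSums_principalCurvatures hρ.c2 hρ.pos hX,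
    esymm_pSums_principalCurvatures hρ.c2 hρ.pos hX, h3, radialExt_smul f (Real.exp_pos _),
    norm_smul, Real.norm_of_nonneg (Real.exp_pos _).le] at h4
  have he := Real.exp_pos (logLevel ρ X)
  have he' := Real.exp_pos (-logLevel ρ X)
  -- The left side carries (e^v/|∇v|)^{k-l}, the right side e^{-bv} and (e^{-v}/|∇v|)^q. Collecting
  -- the exponents gives the coefficients of v and of log|∇v|.
  have h5 := congrArg Real.log h4
  rw [Real.log_div (by positivity) (by positivity), Real.log_mul (by positivity) hk.ne',
    Real.log_mul (by positivity) hl.ne', Real.log_pow, Real.log_pow,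
    Real.log_mul he.ne' (by positivity), Real.log_mul (by positivity) (by positivity),
    Real.log_mul hfX.ne' (by positivity), Real.log_rpow (by positivity),
    Real.log_rpow (by positivity), Real.log_mul he'.ne' hXn.ne',
    Real.log_mul he'.ne' (by positivity), Real.log_inv, Real.log_exp, Real.log_exp] at h5
  rw [Real.log_pow]
  push_cast
  linarith

end Geometry

/-! ### From the gradient bound to the oscillation of log ρ. -/

section Oscillation

variable {n : ℕ} {ρ : Sph n → ℝ}

theorem norm_coe_sph (x : Sph n) : ‖(x : Amb n)‖ = 1 := by simp

theorem coe_sph_ne_zero (x : Sph n) : (x : Amb n) ≠ 0 := fun h => by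
  have := norm_coe_sph x; simp [h] at this

instance nonempty_sph : Nonempty (Sph n) :=
  (NormedSpace.sphere_nonempty.2 zero_le_one).to_subtype

theorem norm_fderiv_radialExt_log_le (hρ : IsC2 ρ) (hpos : ∀ x, 0 < ρ x) {m : ℝ}
    (hm : ∀ x, ‖sphGrad (fun y => Real.log (ρ y)) x‖ ≤ m) {X : Amb n} (hX : X ≠ 0) :
    ‖fderiv ℝ (radialExt fun y => Real.log (ρ y)) X‖ ≤ ‖X‖⁻¹ * m := by
  set u := radialExt fun y => Real.log (ρ y)
  have hXn := norm_pos_iff.2 hX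
  set x : Sph n := ⟨‖X‖⁻¹ • X, by
    rw [mem_sphere_zero_iff_norm, norm_smul, norm_inv, norm_norm, inv_mul_cancel₀ hXn.ne']⟩ with hx
  have hXx : X = ‖X‖ • (x : Amb n) := (smul_inv_smul₀ hXn.ne' X).symm
  have hd := (hρ.log hpos).contDiffAt_radialExt hX
  have hfd : fderiv ℝ u X = (fderiv ℝ u (x : Amb n)).comp
      (‖X‖⁻¹ • ContinuousLinearMap.id ℝ (Amb n)) := by
    have h1 : u = fun Y => u (‖X‖⁻¹ • Y) := funext fun Y =>
      (radialExt_smul _ (inv_pos.2 hXn) Y).symm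
    have h2 : HasFDerivAt u (fderiv ℝ u (x : Amb n)) (‖X‖⁻¹ • X) :=
      (((hρ.log hpos).contDiffAt_radialExt (coe_sph_ne_zero x)).differentiableAt
        two_ne_zero).hasFDerivAt
    conv_lhs => rw [h1]
    exact (h2.comp X ((hasFDerivAt_id X).const_smul ‖X‖⁻¹)).fderiv
  have hg : ‖fderiv ℝ u (x : Amb n)‖ ≤ m := by
    refine le_of_eq_of_le ?_ (hm x)
    rw [sphGrad, gradient, LinearIsometryEquiv.norm_map]
  rw [hfd, ContinuousLinearMap.comp_smul, ContinuousLinearMap.comp_id, norm_smul, norm_inv,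
    norm_norm]
  gcongr

/-- Integrate along the chord in the ambient space: its length is √2 and its points have norm at
least 1/√2, so the degree-zero extension has derivative at most √2 m there. -/
theorem abs_log_sub_log_le_of_inner_eq_zero (hρ : IsC2 ρ) (hpos : ∀ x, 0 < ρ x) {m : ℝ}
    (hm : ∀ x, ‖sphGrad (fun y => Real.log (ρ y)) x‖ ≤ m) {x z : Sph n}
    (h : ⟪(x : Amb n), (z : Amb n)⟫ = 0) : |Real.log (ρ z) - Real.log (ρ x)| ≤ 2 * m := by
  have hm0 : 0 ≤ m := (norm_nonneg _).trans (hm x)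
  have hs : ∀ X ∈ segment ℝ (x : Amb n) z, 1 / 2 ≤ ‖X‖ ^ 2 := by
    rintro X ⟨a, b, ha, hb, hab, rfl⟩
    rw [norm_add_sq_real, norm_smul, norm_smul, real_inner_smul_left, real_inner_smul_right, h,
      norm_coe_sph, norm_coe_sph, Real.norm_of_nonneg ha, Real.norm_of_nonneg hb]
    have : b = 1 - a := by linarith
    subst this
    nlinarith [sq_nonneg (a - 1 / 2)]
  have hs0 : ∀ X ∈ segment ℝ (x : Amb n) z, X ≠ 0 := fun X hX h0 => by
    have := hs X hX; rw [h0] at this; norm_num at this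
  have h2 : √2 * √2 = (2 : ℝ) := Real.mul_self_sqrt zero_le_two
  have h2p : 0 < √(2 : ℝ) := by positivity
  have key := Convex.norm_image_sub_le_of_norm_fderiv_le (𝕜 := ℝ) (C := √2 * m)
    (f := radialExt fun y => Real.log (ρ y)) (s := segment ℝ (x : Amb n) z)
    (fun X hX => ((hρ.log hpos).contDiffAt_radialExt (hs0 X hX)).differentiableAt two_ne_zero)
    (fun X hX => (norm_fderiv_radialExt_log_le hρ hpos hm (hs0 X hX)).trans (by
      have h1 : ‖X‖⁻¹ ≤ √2 := by
        rw [inv_le_comm₀ (norm_pos_iff.2 (hs0 X hX)) h2p]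
        refine (pow_le_pow_iff_left₀ (by positivity) (norm_nonneg _) two_ne_zero).1 ?_
        rw [inv_pow, Real.sq_sqrt zero_le_two]
        simpa using hs X hX
      gcongr))
    (convex_segment _ _) (left_mem_segment ℝ _ _) (right_mem_segment ℝ _ _)
  have hxz : ‖(z : Amb n) - x‖ = √2 := by
    rw [eq_comm, Real.sqrt_eq_iff_eq_sq zero_le_two (norm_nonneg _), norm_sub_sq_real,
      norm_coe_sph, norm_coe_sph, real_inner_comm, h]
    norm_num
  rw [radialExt_coe, radialExt_coe, hxz, Real.norm_eq_abs] at key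
  refine key.trans (le_of_eq ?_)
  linear_combination m * h2

theorem exists_sph_orthogonal (hn : 2 ≤ n) (x y : Sph n) :
    ∃ z : Sph n, ⟪(x : Amb n), (z : Amb n)⟫ = 0 ∧ ⟪(z : Amb n), (y : Amb n)⟫ = 0 := by
  set V : Submodule ℝ (Amb n) := Submodule.span ℝ ({(x : Amb n), (y : Amb n)} : Finset (Amb n))
  have h1 : Module.finrank ℝ V ≤ 2 := (finrank_span_finset_le_card _).trans Finset.card_le_two
  have h2 := V.finrank_add_finrank_orthogonal
  have h3 : Module.finrank ℝ (Amb n) = n + 1 := by simp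
  have h4 : Vᗮ ≠ ⊥ := fun h => by
    rw [h, finrank_bot] at h2; omega
  obtain ⟨w, hw, hw0⟩ := Submodule.exists_mem_ne_zero_of_ne_bot h4
  have hx : ⟪(x : Amb n), w⟫ = 0 := (Submodule.mem_orthogonal _ _).1 hw _
    (Submodule.subset_span (by simp))
  have hy : ⟪(y : Amb n), w⟫ = 0 := (Submodule.mem_orthogonal _ _).1 hw _
    (Submodule.subset_span (by simp))
  refine ⟨⟨‖w‖⁻¹ • w, by simp [norm_smul, hw0]⟩, ?_, ?_⟩
  · simp [real_inner_smul_right, hx]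
  · rw [real_inner_comm]; simp [real_inner_smul_right, hy]

theorem continuous_norm_sphGrad {g : Sph n → ℝ} (hg : IsC2 g) :
    Continuous fun x => ‖sphGrad g x‖ := by
  refine Continuous.norm (continuous_iff_continuousAt.2 fun x => ?_)
  exact (contDiffAt_gradient
    (hg.contDiffAt_radialExt (coe_sph_ne_zero x))).continuousAt.comp
      continuous_subtype_val.continuousAt

/-- An estimate at the maximum points of the gradient implies the global estimates. -/
theorem gradientBound_of_isMax (hn : 2 ≤ n) (hρ : IsC2 ρ) (hpos : ∀ x, 0 < ρ x) {C : ℝ}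
    (hC : 0 ≤ C) (h : ∀ x₀, 0 < ‖sphGrad (fun y => Real.log (ρ y)) x₀‖ →
      (∀ x, ‖sphGrad (fun y => Real.log (ρ y)) x‖ ≤ ‖sphGrad (fun y => Real.log (ρ y)) x₀‖) →
      ‖sphGrad (fun y => Real.log (ρ y)) x₀‖ ≤ C) : GradientBound (4 * C) ρ := by
  obtain ⟨x₀, -, hx₀⟩ := isCompact_univ.exists_isMaxOn Set.univ_nonempty
    (continuous_norm_sphGrad (hρ.log hpos)).continuousOn
  have hmax : ∀ x, ‖sphGrad (fun y => Real.log (ρ y)) x‖ ≤ C := by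
    intro x
    refine (hx₀ (Set.mem_univ x)).trans ?_
    rcases (norm_nonneg (sphGrad (fun y => Real.log (ρ y)) x₀)).eq_or_lt with h0 | h0
    · exact h0.symm.le.trans hC
    · exact h x₀ h0 fun y => hx₀ (Set.mem_univ y)
  have hcont : Continuous ρ := ContMDiff.continuous hρ
  obtain ⟨x₁, -, h₁⟩ := isCompact_univ.exists_isMaxOn Set.univ_nonempty hcont.continuousOn
  obtain ⟨x₂, -, h₂⟩ := isCompact_univ.exists_isMinOn Set.univ_nonempty hcont.continuousOn
  refine ⟨fun x => (hmax x).trans (by linarith), ρ x₁, ρ x₂, ⟨⟨x₁, rfl⟩, ?_⟩, ⟨⟨x₂, rfl⟩, ?_⟩,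
    ?_, ?_⟩
  · rintro _ ⟨y, rfl⟩; exact h₁ (Set.mem_univ y)
  · rintro _ ⟨y, rfl⟩; exact h₂ (Set.mem_univ y)
  · rw [one_le_div (hpos _)]; exact h₂ (Set.mem_univ x₁)
  -- As n ≥ 2, some unit vector is orthogonal to both extremal points; two chords of cost 2C each
  -- give the constant 4C.
  · obtain ⟨z, hz1, hz2⟩ := exists_sph_orthogonal hn x₂ x₁
    have e1 := (abs_le.1 (abs_log_sub_log_le_of_inner_eq_zero hρ hpos hmax hz1)).2
    have e2 := (abs_le.1 (abs_log_sub_log_le_of_inner_eq_zero hρ hpos hmax hz2)).2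
    rw [← Real.log_le_iff_le_exp (div_pos (hpos _) (hpos _)),
      Real.log_div (hpos _).ne' (hpos _).ne']
    linarith

end Oscillation

/-! ### Comparison with round spheres. -/

section Comparison

variable {n : ℕ} {ρ : Sph n → ℝ}

theorem inCone_pSums_one {p k : ℕ} (hp : 0 < p) (hk : k ≤ n.choose p) :
    InCone k (pSums p (Finset.univ.val.map fun _ : Fin n => (1 : ℝ))) := by
  intro j hj
  rw [pSums_map_univ, Finset.esymm_map_val]
  refine Finset.sum_pos (fun t ht => Finset.prod_pos fun I hI => ?_) ?_
  · have := (Finset.mem_powersetCard.1 ((Finset.mem_powersetCard.1 ht).1 hI)).2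
    simpa [this] using hp
  · rw [Finset.powersetCard_nonempty, Finset.card_powersetCard, Finset.card_univ, Fintype.card_fin]
    omega

/-- The value of the curvature quotient on the unit sphere. -/
noncomputable def sphereQuotient (n p k l : ℕ) : ℝ :=
  (pSums p (Finset.univ.val.map fun _ : Fin n => (1 : ℝ))).esymm k /
    (pSums p (Finset.univ.val.map fun _ : Fin n => (1 : ℝ))).esymm l

theorem sphereQuotient_pos {p k l : ℕ} (hp : 0 < p) (hlk : l < k) (hk : k ≤ n.choose p) :
    0 < sphereQuotient n p k l :=
  div_pos (inCone_pSums_one hp hk k le_rfl) (inCone_pSums_one hp hk l hlk.le)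

theorem curv_one {ξ : Amb n} (hξ : ξ ≠ 0) :
    curv ξ (1 : Amb n →L[ℝ] Amb n) = Finset.univ.val.map fun _ : Fin n => (1 : ℝ) := by
  obtain ⟨κ, b, -, h2, h3⟩ := exists_basis_compress (d := n) (by simp) hξ
    (A := (1 : Amb n →L[ℝ] Amb n)) fun x y => rfl
  rw [h2]
  congr 1
  ext i
  have := h3 i i
  rw [if_pos rfl, one_apply_eq_self, real_inner_self_eq_norm_sq, b.orthonormal.1] at this
  simpa using this.symm

theorem inner_hess_log_norm {y : Amb n} (hy : ‖y‖ = 1) {a : Amb n} (ha : ⟪y, a⟫ = 0) :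
    ⟪hess (fun x : Amb n => Real.log ‖x‖) y a, a⟫ = ⟪a, a⟫ := by
  have h0 : y ≠ 0 := by rintro rfl; simp at hy
  have h1 : gradient (fun x : Amb n => Real.log ‖x‖) =ᶠ[𝓝 y] fun x => (‖x‖ ^ 2)⁻¹ • x := by
    filter_upwards [isOpen_ne.mem_nhds h0] with x hx using gradient_log_norm hx
  have h2 : DifferentiableAt ℝ (fun x : Amb n => (‖x‖ ^ 2)⁻¹) y :=
    (hasStrictFDerivAt_norm_sq y).hasFDerivAt.differentiableAt.inv (by simpa using h0)
  rw [hess, h1.fderiv_eq, fderiv_fun_smul h2 differentiableAt_fun_id]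
  simp [inner_add_left, real_inner_smul_left, ha, hy]

/-- The logarithm of the radius does not vary on the unit sphere, so the restrictions of `logLevel`
and of `-log ρ` to the unit sphere have the same extrema. -/
theorem hess_logLevel_of_isMax (hρ : IsC2 ρ) (hpos : ∀ x, 0 < ρ x) {s : ℝ} {y : Sph n}
    (hmax : ∀ x : Sph n, s * logLevel ρ x ≤ s * logLevel ρ y) (hs : s ≠ 0) :
    gradient (logLevel ρ) y = y ∧
      ∀ a, ⟪(y : Amb n), a⟫ = 0 → s * ⟪hess (logLevel ρ) y a, a⟫ ≤ s * ⟪a, a⟫ := by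
  have hv := logHomogeneous_logLevel hρ hpos
  have h0 := coe_sph_ne_zero y
  have c1 := contDiffAt_log_norm h0
  have c2 := hv.contDiffAt _ h0
  have hloc : IsLocalMax (fun X => s * (logLevel ρ X - Real.log ‖X‖)) (y : Amb n) := by
    refine isLocalMax_of_sphere (norm_coe_sph y) (fun t ht x hx => ?_) fun x hx => ?_
    · rw [hv.smul t ht x hx, norm_smul, Real.norm_of_nonneg ht.le,
        Real.log_mul ht.ne' (norm_ne_zero_iff.2 hx)]
      ring
    · have := hmax ⟨x, by simpa using hx⟩
      simpa [hx] using this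
  have h1 := gradient_eq_zero_of_isLocalMax hloc
  have h2 := hess_nonpos_of_isLocalMax (contDiffAt_const.mul (c2.sub c1)) hloc
  rw [gradient_const_mul' (c2.sub c1), gradient_sub' c2 c1, gradient_log_norm h0, norm_coe_sph,
    smul_eq_zero, or_iff_right hs, sub_eq_zero] at h1
  refine ⟨by simpa using h1, fun a ha => ?_⟩
  have h3 := h2 a
  rw [hess_const_mul (c2.sub c1), hess_sub c2 c1, smul_apply, sub_apply, real_inner_smul_left,
    inner_sub_left, inner_hess_log_norm (norm_coe_sph y) ha] at h3
  linarith

theorem SolvesEq.quotient_eq {p k l : ℕ} {b q : ℝ} {f : Sph n → ℝ} (hf : ∀ x, 0 < f x)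
    (hlk : l < k) (hρ : IsPKConvex p k ρ) (h : SolvesEq p k l b q f ρ) (x : Sph n) :
    (pSums p (curv (gradient (logLevel ρ) x) (hess (logLevel ρ) x))).esymm k /
      (pSums p (curv (gradient (logLevel ρ) x) (hess (logLevel ρ) x))).esymm l =
        f x * Real.exp ((-b - q - k + l) * logLevel ρ x) *
          (1 + ‖sphGrad (fun y => Real.log (ρ y)) x‖ ^ 2) ^ (((k : ℝ) - l - q) / 2) := by
  have hX := coe_sph_ne_zero x
  have hc := hρ.inCone hX
  have h1 := h.log_eq hf hlk hρ hX
  rw [← Real.log_div (hc k le_rfl).ne' (hc l hlk.le).ne', norm_coe_sph, Real.log_one, mul_zero,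
    add_zero, radialExt_coe, norm_sphGrad_log_sq hρ.c2 hρ.pos] at h1
  have hp := hf x
  rw [← Real.exp_log (div_pos (hc k le_rfl) (hc l hlk.le)), h1, Real.exp_add, Real.exp_add,
    Real.exp_log hp, Real.rpow_def_of_pos (by positivity), mul_comm (Real.log (1 + _))]

/-- Comparison with round spheres at the points of `M` closest to and farthest from the origin. -/
theorem SolvesEq.exp_logLevel_bounds {p k l : ℕ} {b q : ℝ} {f : Sph n → ℝ} (hf : ∀ x, 0 < f x)
    (hp : 0 < p) (hlk : l < k) (hk : k ≤ n.choose p) (hρ : IsPKConvex p k ρ)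
    (h : SolvesEq p k l b q f ρ) (hδ : 0 ≤ -b - q - k + l) {fmin fmax : ℝ}
    (hmin : IsLeast (Set.range f) fmin) (hmax : IsGreatest (Set.range f) fmax) (x : Sph n) :
    sphereQuotient n p k l / fmax ≤ Real.exp ((-b - q - k + l) * logLevel ρ x) ∧
      Real.exp ((-b - q - k + l) * logLevel ρ x) ≤ sphereQuotient n p k l / fmin := by
  have hv := logHomogeneous_logLevel hρ.c2 hρ.pos
  have hcont : Continuous fun x : Sph n => logLevel ρ x := continuous_iff_continuousAt.2 fun x =>
    (hv.contDiffAt _ (coe_sph_ne_zero x)).continuousAt.comp continuous_subtype_val.continuousAt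
  obtain ⟨x₁, -, h₁⟩ := isCompact_univ.exists_isMaxOn Set.univ_nonempty hcont.continuousOn
  obtain ⟨x₂, -, h₂⟩ := isCompact_univ.exists_isMinOn Set.univ_nonempty hcont.continuousOn
  have hfmin : 0 < fmin := by obtain ⟨⟨y, rfl⟩, -⟩ := hmin; exact hf y
  have hfmax : 0 < fmax := by obtain ⟨⟨y, rfl⟩, -⟩ := hmax; exact hf y
  -- At a critical point of ρ the factor with 1 + |∇log ρ|² equals 1.
  have hval : ∀ y : Sph n, gradient (logLevel ρ) y = y →
      (pSums p (curv (y : Amb n) (hess (logLevel ρ) y))).esymm k /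
        (pSums p (curv (y : Amb n) (hess (logLevel ρ) y))).esymm l =
          f y * Real.exp ((-b - q - k + l) * logLevel ρ y) := by
    intro y hy
    have e1 := h.quotient_eq hf hlk hρ y
    have e2 := norm_sphGrad_log_sq hρ.c2 hρ.pos y
    rw [hy, norm_coe_sph] at e2
    rw [hy, ← e2] at e1
    simpa using e1
  constructor
  -- At the farthest point v is smallest and D²v is at least the identity on the tangent space, so
  -- the quotient is at least its value on the unit sphere.
  · obtain ⟨g1, g2⟩ := hess_logLevel_of_isMax hρ.c2 hρ.pos (s := -1) (y := x₂)
      (fun x => by have := h₂ (Set.mem_univ x); simp only [Set.mem_ofPred_eq] at this; linarith)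
      (by norm_num)
    have h0 := coe_sph_ne_zero x₂
    have e1 := ((by rw [curv_one h0]; exact inCone_pSums_one hp hk :
      InCone k (pSums p (curv (x₂ : Amb n) 1))).rel_mono hlk
      (pSums_curv_rel_mono (fun _ _ => rfl) (hess_symm (hv.contDiffAt _ h0))
        (fun a ha => by have := g2 a ha; rw [one_apply_eq_self]; linarith) p)).2
    rw [hval x₂ g1, curv_one h0] at e1
    rw [div_le_iff₀ hfmax]
    calc _ ≤ f x₂ * Real.exp ((-b - q - k + l) * logLevel ρ x₂) := e1
      _ ≤ fmax * Real.exp ((-b - q - k + l) * logLevel ρ x) := by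
        have := hmax.2 ⟨x₂, rfl⟩
        have := h₂ (Set.mem_univ x)
        simp only [Set.mem_ofPred_eq] at this
        gcongr
      _ = _ := mul_comm _ _
  -- At the nearest point v is largest and the comparison is reversed.
  · obtain ⟨g1, g2⟩ := hess_logLevel_of_isMax hρ.c2 hρ.pos (s := 1) (y := x₁)
      (fun x => by have := h₁ (Set.mem_univ x); simp only [Set.mem_ofPred_eq] at this; linarith)
      one_ne_zero
    have h0 := coe_sph_ne_zero x₁
    have hc := hρ.inCone h0
    rw [g1] at hc
    have e1 := (hc.rel_mono hlk
      (pSums_curv_rel_mono (A' := 1) (hess_symm (hv.contDiffAt _ h0)) (fun _ _ => rfl)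
        (fun a ha => by have := g2 a ha; rw [one_apply_eq_self]; linarith) p)).2
    rw [hval x₁ g1, curv_one h0] at e1
    rw [le_div_iff₀ hfmin]
    calc _ = fmin * Real.exp ((-b - q - k + l) * logLevel ρ x) := mul_comm _ _
      _ ≤ f x₁ * Real.exp ((-b - q - k + l) * logLevel ρ x₁) := by
        have := hmin.2 ⟨x₁, rfl⟩
        have := h₁ (Set.mem_univ x)
        simp only [Set.mem_ofPred_eq] at this
        have := hf x₁
        gcongr
      _ ≤ _ := e1

end Comparison

/-! ### The gradient estimates. -/

section Estimates

variable {n : ℕ} {ρ : Sph n → ℝ}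

/-- The inequality at a maximum point of the gradient, in terms of the principal curvatures of a
homothetic copy of `M`. -/
theorem SolvesEq.exists_logDeriv_le {p k l : ℕ} {b q : ℝ} {f : Sph n → ℝ} (hf : ∀ x, 0 < f x)
    (hfC : IsC2 f) (hlk : l < k) (hρ : IsPKConvex p k ρ) (h : SolvesEq p k l b q f ρ) {L : ℝ}
    (hL : ∀ x, ‖sphGrad f x‖ / f x ≤ L) {x₀ : Sph n} {m : ℝ}
    (hm : ‖sphGrad (fun y => Real.log (ρ y)) x₀‖ = m) (hm0 : 0 < m)
    (hmax : ∀ x, ‖sphGrad (fun y => Real.log (ρ y)) x‖ ≤ m) :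
    ∃ (d : ℕ) (κ ε : Option (Fin d) → ℝ), d + 1 = n ∧ κ none = 1 ∧ ε none = 0 ∧
      (∀ i, i ≠ none → m * ε i = (1 - κ i) ^ 2 + m ^ 2) ∧
      InCone k (pSums p (Finset.univ.val.map κ)) ∧
      logDeriv p k l κ ε ≤ L - (-b - q - k + l) * m ∧
      (pSums p (Finset.univ.val.map κ)).esymm k / (pSums p (Finset.univ.val.map κ)).esymm l =
        f x₀ * Real.exp ((-b - q - k + l) * logLevel ρ x₀) *
          (1 + m ^ 2) ^ (((k : ℝ) - l - q) / 2) := by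
  have hv := logHomogeneous_logLevel hρ.c2 hρ.pos
  have hx₀ := norm_coe_sph x₀
  have h0 := coe_sph_ne_zero x₀
  have hg : ‖gradient (logLevel ρ) (x₀ : Amb n)‖ ^ 2 = 1 + m ^ 2 := by
    rw [norm_sphGrad_log_sq hρ.c2 hρ.pos, hm]
  have hmax' : ∀ y : Amb n, ‖y‖ = 1 → ‖gradient (logLevel ρ) y‖ ^ 2 ≤ 1 + m ^ 2 := by
    intro y hy
    have e := norm_sphGrad_log_sq hρ.c2 hρ.pos ⟨y, by simpa using hy⟩
    rw [e]
    have := hmax ⟨y, by simpa using hy⟩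
    gcongr
  have hG : HasStrictFDerivAt (fun X => Real.log (radialExt f X) + b * Real.log ‖X‖)
      ((radialExt f x₀)⁻¹ • innerSL ℝ (gradient (radialExt f) x₀) +
        b • innerSL ℝ (gradient (fun X : Amb n => Real.log ‖X‖) x₀)) (x₀ : Amb n) :=
    ((hasStrictFDerivAt_of_contDiffAt_two (hfC.contDiffAt_radialExt h0)).log
      (radialExt_pos hf h0).ne').add
      ((hasStrictFDerivAt_of_contDiffAt_two (contDiffAt_log_norm h0)).const_mul b)
  obtain ⟨d, κ, ε, hd, hcurv, hκ, hε₀, hε, hle⟩ := hv.exists_logDeriv_le (d := n) (by simp) hlk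
    hx₀ hm0 hg hmax' (hρ.inCone h0) hG fun X hX => h.log_eq hf hlk hρ hX
  have hF := hv.adaptedFrame hx₀ hm0 hg hmax'
  refine ⟨d, κ, ε, hd, hκ, hε₀, hε, ?_, hle.trans (sub_le_sub_right ?_ _), ?_⟩
  · rw [← hcurv]; exact hρ.inCone h0
  · refine le_trans ?_ (hL x₀)
    -- The deformation direction is tangent to the sphere, so b log|X| does not contribute and only
    -- the gradient of log f remains.
    rw [add_apply, smul_apply, smul_apply, innerSL_apply_apply, innerSL_apply_apply,
      gradient_log_norm h0, hx₀, real_inner_smul_left, hF.orth, radialExt_coe, mul_zero,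
      smul_zero, add_zero, smul_eq_mul, div_eq_inv_mul]
    refine mul_le_mul_of_nonneg_left ?_ (inv_pos.2 (hf x₀)).le
    refine (real_inner_le_norm _ _).trans ?_
    rw [hF.norm₁, mul_one, sphGrad]
  · rw [← hcurv, h.quotient_eq hf hlk hρ, hm]

theorem le_of_one_add_sq_rpow_le {m q K : ℝ} (hm : 0 ≤ m) (hq : 0 < q)
    (h : (1 + m ^ 2) ^ (q / 2) ≤ K) : m ≤ K ^ q⁻¹ := by
  have h1 : m ^ q ≤ (1 + m ^ 2) ^ (q / 2) := by
    calc m ^ q = (m ^ 2) ^ (q / 2) := by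
          rw [← Real.rpow_natCast, ← Real.rpow_mul hm]; congr 1; push_cast; ring
      _ ≤ _ := by gcongr; linarith
  have hK : 0 ≤ K := (by positivity : (0 : ℝ) ≤ (1 + m ^ 2) ^ (q / 2)).trans h
  exact (Real.le_rpow_inv_iff_of_pos hm hK hq).2 (h1.trans h)

/-- With θ² = (P-1)/P one has Q + m²(P-1)U ≥ 2mθ√(QPU) ≥ 2mθD. The left side of `h2` thus grows at
least like 2θD m, which exceeds L m for large m by `hL`. -/
theorem le_div_of_amgm {D L P Q U m : ℝ} (hm : 0 < m) (hD : 0 ≤ D) (hP : 1 ≤ P) (hU : 0 ≤ U)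
    (hQ : 0 ≤ Q) (h1 : D ^ 2 ≤ Q * (P * U)) (h2 : Q - 2 * D + (P + m ^ 2 * (P - 1)) * U ≤ L * m)
    (hL : L < 2 * D * √((P - 1) / P)) : m ≤ 2 * D / (2 * D * √((P - 1) / P) - L) := by
  have hP0 : 0 < P := one_pos.trans_le hP
  set θ := √((P - 1) / P) with hθ
  have hθ0 : 0 ≤ θ := Real.sqrt_nonneg _
  have hθ2 : θ ^ 2 * P = P - 1 := by
    rw [hθ, Real.sq_sqrt (div_nonneg (by linarith) hP0.le)]; field_simp
  set V := P * U with hV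
  have hV0 : 0 ≤ V := by positivity
  have h3 : 2 * (m * θ * D) ≤ Q + m ^ 2 * θ ^ 2 * V := by
    have h4 : (2 * (m * θ * D)) ^ 2 ≤ (Q + m ^ 2 * θ ^ 2 * V) ^ 2 := by
      have h5 : (m * θ) ^ 2 * D ^ 2 ≤ (m * θ) ^ 2 * (Q * V) :=
        mul_le_mul_of_nonneg_left h1 (sq_nonneg _)
      nlinarith [sq_nonneg (Q - m ^ 2 * θ ^ 2 * V)]
    exact (pow_le_pow_iff_left₀ (by positivity) (by positivity) two_ne_zero).1 h4
  rw [le_div_iff₀ (by linarith)]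
  have h6 : m ^ 2 * θ ^ 2 * V = m ^ 2 * (P - 1) * U := by
    rw [hV, ← hθ2]; ring
  nlinarith

/-- Keep only the term m²U: it makes U at most of order 1/m, hence r at least of order m. But r^D is
at most of order m^{D-q}, so m^q is bounded. -/
theorem le_of_pos_exponent {m q A k L U r : ℝ} {D : ℕ} (hm : 1 ≤ m) (hq : 0 < q)
    (hD : 0 < D) (hL : 0 ≤ L) (hk : 0 ≤ k) (hr : 0 < r) {P Q : ℝ} (hP : 2 ≤ P)
    (hU : 0 ≤ U) (hQ : 0 ≤ Q)
    (h2 : Q - 2 * D + (P + m ^ 2 * (P - 1)) * U ≤ L * m) (h3 : (D : ℝ) ≤ k * U * r)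
    (h4 : r ^ D ≤ A * (1 + m ^ 2) ^ (((D : ℝ) - q) / 2)) :
    m ≤ ((k * (L + 2 * D)) ^ D * A * 2 ^ ((D : ℝ) / 2)) ^ q⁻¹ := by
  have hm0 : 0 < m := by linarith
  have hD1 : (1 : ℝ) ≤ D := by exact_mod_cast hD
  have hs : (0 : ℝ) < 1 + m ^ 2 := by positivity
  refine le_of_one_add_sq_rpow_le hm0.le hq ?_
  have e1 : m ^ 2 * U ≤ (L + 2 * D) * m := by nlinarith [mul_nonneg (sq_nonneg m) hU]
  have e2 : m ≤ k * (L + 2 * D) * r := by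
    have : m * m ≤ m * (k * (L + 2 * D) * r) := by
      calc m * m ≤ m ^ 2 * D := by nlinarith
        _ ≤ m ^ 2 * (k * U * r) := by gcongr
        _ = k * r * (m ^ 2 * U) := by ring
        _ ≤ k * r * ((L + 2 * D) * m) := by gcongr
        _ = _ := by ring
    exact le_of_mul_le_mul_left this hm0
  have e3 : m ^ D ≤ (k * (L + 2 * D)) ^ D * (A * (1 + m ^ 2) ^ (((D : ℝ) - q) / 2)) := by
    calc m ^ D ≤ (k * (L + 2 * D) * r) ^ D := by gcongr
      _ = (k * (L + 2 * D)) ^ D * r ^ D := mul_pow _ _ _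
      _ ≤ _ := by gcongr
  have e4 : (1 + m ^ 2) ^ ((D : ℝ) / 2) ≤ 2 ^ ((D : ℝ) / 2) * m ^ D := by
    calc (1 + m ^ 2) ^ ((D : ℝ) / 2) ≤ (2 * m ^ 2) ^ ((D : ℝ) / 2) := by
          gcongr; nlinarith
      _ = _ := by
          rw [Real.mul_rpow zero_le_two (by positivity), ← Real.rpow_natCast m 2,
            ← Real.rpow_mul hm0.le, ← Real.rpow_natCast m D]
          congr 2
          push_cast; ring
  have e5 : (1 + m ^ 2) ^ (((D : ℝ) - q) / 2) * (1 + m ^ 2) ^ (q / 2) =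
      (1 + m ^ 2) ^ ((D : ℝ) / 2) := by
    rw [← Real.rpow_add hs]; congr 1; ring
  have e6 : 0 < (1 + m ^ 2) ^ (((D : ℝ) - q) / 2) := Real.rpow_pos_of_pos hs _
  refine le_of_mul_le_mul_left ?_ e6
  rw [e5]
  calc _ ≤ 2 ^ ((D : ℝ) / 2) * m ^ D := e4
    _ ≤ 2 ^ ((D : ℝ) / 2) *
        ((k * (L + 2 * D)) ^ D * (A * (1 + m ^ 2) ^ (((D : ℝ) - q) / 2))) := by gcongr
    _ = _ := by ring

/-- Keep only Q, which is at most of order m; hence so is R. But R^D is at least of order m^{D-q},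
so m^{-q} is bounded. -/
theorem le_of_neg_exponent {m q A N L U R : ℝ} {D : ℕ} (hm : 1 ≤ m) (hq : q < 0)
    (hD : 0 < D) (hL : 0 ≤ L) (hN : 0 ≤ N) (hR : 0 < R) (hA : 0 < A) {P Q : ℝ} (hP : 2 ≤ P)
    (hU : 0 ≤ U) (h2 : Q - 2 * D + (P + m ^ 2 * (P - 1)) * U ≤ L * m)
    (h3 : (D : ℝ) * R ≤ N * (P * Q)) (h4 : A * (1 + m ^ 2) ^ (((D : ℝ) - q) / 2) ≤ R ^ D) :
    m ≤ ((N * (P * (L + 2 * D))) ^ D / A) ^ (-q)⁻¹ := by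
  have hm0 : 0 < m := by linarith
  have hD1 : (1 : ℝ) ≤ D := by exact_mod_cast hD
  have hs : (0 : ℝ) < 1 + m ^ 2 := by positivity
  refine le_of_one_add_sq_rpow_le hm0.le (neg_pos.2 hq) ?_
  have e1 : Q ≤ (L + 2 * D) * m := by
    have : 0 ≤ (P + m ^ 2 * (P - 1)) * U := mul_nonneg (by nlinarith [sq_nonneg m]) hU
    nlinarith
  have e2 : R ≤ N * (P * (L + 2 * D)) * m := by
    calc R ≤ D * R := by nlinarith
      _ ≤ N * (P * Q) := h3
      _ ≤ N * (P * ((L + 2 * D) * m)) := by gcongr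
      _ = _ := by ring
  have e3 : R ^ D ≤ (N * (P * (L + 2 * D))) ^ D * (1 + m ^ 2) ^ ((D : ℝ) / 2) := by
    calc R ^ D ≤ (N * (P * (L + 2 * D)) * m) ^ D := by gcongr
      _ = (N * (P * (L + 2 * D))) ^ D * (m ^ 2) ^ ((D : ℝ) / 2) := by
          rw [mul_pow, ← Real.rpow_natCast m 2, ← Real.rpow_mul hm0.le, ← Real.rpow_natCast m D]
          congr 2
          push_cast; ring
      _ ≤ _ := by gcongr; linarith
  have e5 : (1 + m ^ 2) ^ ((D : ℝ) / 2) * (1 + m ^ 2) ^ (-q / 2) =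
      (1 + m ^ 2) ^ (((D : ℝ) - q) / 2) := by
    rw [← Real.rpow_add hs]; congr 1; ring
  have e6 : 0 < (1 + m ^ 2) ^ ((D : ℝ) / 2) := Real.rpow_pos_of_pos hs _
  rw [le_div_iff₀ hA]
  refine le_of_mul_le_mul_left ?_ e6
  calc _ = A * (1 + m ^ 2) ^ (((D : ℝ) - q) / 2) := by rw [← e5]; ring
    _ ≤ _ := h4.trans e3
    _ = _ := mul_comm _ _

theorem isGreatest_ratio_nonneg {f : Sph n → ℝ} (hf : ∀ x, 0 < f x) {L : ℝ}
    (hL : IsGreatest (Set.range fun x => ‖sphGrad f x‖ / f x) L) : 0 ≤ L := by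
  obtain ⟨⟨y, rfl⟩, -⟩ := hL
  exact div_nonneg (norm_nonneg _) (hf y).le

/-- The gradient estimate when the right-hand side is strictly decreasing along rays. -/
theorem SolvesEq.gradientBound {p k l : ℕ} {b q : ℝ} {f : Sph n → ℝ} (hf : ∀ x, 0 < f x)
    (hfC : IsC2 f) (hn : 2 ≤ n) (hlk : l < k) (hρ : IsPKConvex p k ρ)
    (h : SolvesEq p k l b q f ρ) (hδ : 0 < -b - q - k + l) {L : ℝ}
    (hL : IsGreatest (Set.range fun x => ‖sphGrad f x‖ / f x) L) :
    GradientBound (4 * max (L / (-b - q - k + l)) 0) ρ := by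
  refine gradientBound_of_isMax hn hρ.c2 hρ.pos (le_max_right _ _) fun x₀ hm0 hmax =>
    le_max_of_le_left ?_
  obtain ⟨d, κ, ε, hd, hκ, hε₀, hε, hc, hle, -⟩ := h.exists_logDeriv_le hf hfC hlk hρ
    (fun x => hL.2 ⟨x, rfl⟩) rfl hm0 hmax
  have h1 := logDeriv_nonneg hlk hc (ε := ε) fun i => by
    rcases eq_or_ne i none with rfl | hi
    · exact hε₀.ge
    · refine nonneg_of_mul_nonneg_right (b := ε i) ?_ hm0
      rw [hε i hi]; positivity
  rw [le_div_iff₀ hδ]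
  linarith

/-- The inequalities at a maximum point of the gradient when the right-hand side is nonincreasing
along rays. -/
theorem SolvesEq.exists_bounds {p k l : ℕ} {b q : ℝ} {f : Sph n → ℝ} (hf : ∀ x, 0 < f x)
    (hfC : IsC2 f) (hp : 0 < p) (hlk : l < k) (hk : k ≤ n.choose p) (hρ : IsPKConvex p k ρ)
    (h : SolvesEq p k l b q f ρ) (hδ : 0 ≤ -b - q - k + l) {fmin fmax L : ℝ}
    (hmin : IsLeast (Set.range f) fmin) (hmax : IsGreatest (Set.range f) fmax)
    (hL : ∀ x, ‖sphGrad f x‖ / f x ≤ L) {x₀ : Sph n} {m : ℝ}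
    (hm : ‖sphGrad (fun y => Real.log (ρ y)) x₀‖ = m) (hm0 : 0 < m)
    (hmmax : ∀ x, ‖sphGrad (fun y => Real.log (ρ y)) x‖ ≤ m) :
    ∃ U Q r R : ℝ, 0 ≤ U ∧ 0 ≤ Q ∧ 0 < r ∧ 0 < R ∧
      ((k - l : ℕ) : ℝ) ^ 2 ≤ Q * (p * U) ∧
      Q - 2 * ((k - l : ℕ) : ℝ) + (p + m ^ 2 * (p - 1)) * U ≤ L * m ∧
      ((k - l : ℕ) : ℝ) ≤ k * U * r ∧
      r ^ (k - l) ≤ fmax * (sphereQuotient n p k l / fmin) *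
        (1 + m ^ 2) ^ ((((k - l : ℕ) : ℝ) - q) / 2) ∧
      ((k - l : ℕ) : ℝ) * R ≤ (n.choose p) * (p * Q) ∧
      fmin * (sphereQuotient n p k l / fmax) * (1 + m ^ 2) ^ ((((k - l : ℕ) : ℝ) - q) / 2) ≤
        R ^ (k - l) := by
  obtain ⟨d, κ, ε, hd, hκ, hε₀, hε, hc, hle, hG⟩ := h.exists_logDeriv_le hf hfC hlk hρ
    hL hm hm0 hmmax
  obtain ⟨U, Q, hU, hQ, h1, h2, ⟨r, hr, h3, h4⟩, R, hR, h5, h6⟩ :=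
    exists_logDeriv_bounds hlk hc hκ hε₀ hε
  obtain ⟨e1, e2⟩ := h.exp_logLevel_bounds hf hp hlk hk hρ hδ hmin hmax x₀
  have hfmin : 0 < fmin := by obtain ⟨⟨y, rfl⟩, -⟩ := hmin; exact hf y
  have hfmax : 0 < fmax := by obtain ⟨⟨y, rfl⟩, -⟩ := hmax; exact hf y
  have hf1 := hmin.2 ⟨x₀, rfl⟩
  have hf2 := hmax.2 ⟨x₀, rfl⟩
  have hs := sphereQuotient_pos hp hlk hk
  rw [Nat.cast_sub hlk.le]
  rw [hG] at h4 h6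
  rw [Fintype.card_option, Fintype.card_fin, hd] at h5
  -- Only the sign of the coefficient of v is used here, so the bounds do not see its size.
  have h7 : m * logDeriv p k l κ ε ≤ L * m := by
    have : (-b - q - k + l) * m * m ≥ 0 := by positivity
    nlinarith
  refine ⟨U, Q, r, R, hU, hQ, hr, hR, h1, h2.trans h7, h3, h4.trans ?_, h5, le_trans ?_ h6⟩
  · have := hf x₀
    gcongr
  · have := hf x₀
    gcongr

/-- The gradient estimate when the right-hand side is nonincreasing along rays. -/
theorem exists_gradientBound {p k l : ℕ} (hp : 1 < p) (hlk : l < k) (hpn : p ≤ n)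
    (hk : k ≤ n.choose p) (q fmin fmax L : ℝ) :
    ∃ C : ℝ, ∀ f : Sph n → ℝ, IsC2 f → (∀ x, 0 < f x) →
      IsLeast (Set.range f) fmin → IsGreatest (Set.range f) fmax →
      IsGreatest (Set.range fun x => ‖sphGrad f x‖ / f x) L →
      (q ≠ 0 ∨ (q = 0 ∧ ∀ x, ‖sphGrad f x‖ / f x <
        2 * ((k : ℝ) - l) * √(((p : ℝ) - 1) / p))) →
      ∀ (b : ℝ) (ρ : Sph n → ℝ), 0 ≤ -b - q - k + l → IsPKConvex p k ρ →
        SolvesEq p k l b q f ρ → GradientBound C ρ := by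
  have hD : 0 < k - l := Nat.sub_pos_of_lt hlk
  have hp2 : (2 : ℝ) ≤ p := by exact_mod_cast hp
  have hn : 2 ≤ n := le_trans hp hpn
  rcases lt_trichotomy q 0 with hq | hq | hq
  · refine ⟨4 * max 1 (((n.choose p * (p * (L + 2 * (k - l : ℕ)))) ^ (k - l) /
      (fmin * (sphereQuotient n p k l / fmax))) ^ (-q)⁻¹),
      fun f hfC hf hmin hmax hL _ b ρ hδ hρ h => ?_⟩
    refine gradientBound_of_isMax hn hρ.c2 hρ.pos (le_max_of_le_left zero_le_one)
      fun x₀ hm0 hmmax => ?_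
    obtain ⟨U, Q, r, R, hU, hQ, hr, hR, h1, h2, h3, h4, h5, h6⟩ := h.exists_bounds hf hfC
      (by omega) hlk hk hρ hδ hmin hmax (fun x => hL.2 ⟨x, rfl⟩) rfl hm0 hmmax
    have hfmin : 0 < fmin := by obtain ⟨⟨y, rfl⟩, -⟩ := hmin; exact hf y
    have hfmax : 0 < fmax := by obtain ⟨⟨y, rfl⟩, -⟩ := hmax; exact hf y
    have hs := sphereQuotient_pos (by omega : 0 < p) hlk hk
    rcases le_total ‖sphGrad (fun y => Real.log (ρ y)) x₀‖ 1 with hm1 | hm1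
    · exact le_max_of_le_left hm1
    · exact le_max_of_le_right (le_of_neg_exponent hm1 hq hD (isGreatest_ratio_nonneg hf hL)
        (Nat.cast_nonneg _) hR (by positivity) hp2 hU h2 h5 h6)
  · refine ⟨4 * max (2 * ((k - l : ℕ) : ℝ) /
      (2 * ((k - l : ℕ) : ℝ) * √(((p : ℝ) - 1) / p) - L)) 0,
      fun f hfC hf hmin hmax hL hqL b ρ hδ hρ h => ?_⟩
    refine gradientBound_of_isMax hn hρ.c2 hρ.pos (le_max_right _ _)
      fun x₀ hm0 hmmax => le_max_of_le_left ?_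
    obtain ⟨U, Q, r, R, hU, hQ, hr, hR, h1, h2, h3, h4, h5, h6⟩ := h.exists_bounds hf hfC
      (by omega) hlk hk hρ hδ hmin hmax (fun x => hL.2 ⟨x, rfl⟩) rfl hm0 hmmax
    refine le_div_of_amgm hm0 (Nat.cast_nonneg _) (by linarith) hU hQ h1 h2 ?_
    -- The maximum L is attained, so the strict pointwise inequality holds for L itself.
    obtain ⟨y, hy⟩ := hL.1
    rw [Nat.cast_sub hlk.le, ← hy]
    exact (hqL.resolve_left (not_not.2 hq)).2 y
  · refine ⟨4 * max 1 (((k * (L + 2 * (k - l : ℕ))) ^ (k - l) *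
      (fmax * (sphereQuotient n p k l / fmin)) * 2 ^ (((k - l : ℕ) : ℝ) / 2)) ^ q⁻¹),
      fun f hfC hf hmin hmax hL _ b ρ hδ hρ h => ?_⟩
    refine gradientBound_of_isMax hn hρ.c2 hρ.pos (le_max_of_le_left zero_le_one)
      fun x₀ hm0 hmmax => ?_
    obtain ⟨U, Q, r, R, hU, hQ, hr, hR, h1, h2, h3, h4, h5, h6⟩ := h.exists_bounds hf hfC
      (by omega) hlk hk hρ hδ hmin hmax (fun x => hL.2 ⟨x, rfl⟩) rfl hm0 hmmax
    rcases le_total ‖sphGrad (fun y => Real.log (ρ y)) x₀‖ 1 with hm1 | hm1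
    · exact le_max_of_le_left hm1
    · exact le_max_of_le_right (le_of_pos_exponent hm1 hq hD (isGreatest_ratio_nonneg hf hL)
        (Nat.cast_nonneg _) hr hp2 hU hQ h2 h3 h4)

end Estimates

end StarShaped


theorem theorem3p2 (p k l : ℕ) (b q : ℝ) (hp : 1 < p) (hlk : l < k) :
    -- the case `-b - q - k + l > 0`; the constant does not depend on `n`
    (0 < -b - q - k + l →
      ∀ L : ℝ, ∃ C : ℝ,
        ∀ n : ℕ, p ≤ n → k ≤ n.choose p →
        ∀ f : StarShaped.Sph n → ℝ, StarShaped.IsC2 f → (∀ x, 0 < f x) →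
          IsGreatest (Set.range fun x => ‖StarShaped.sphGrad f x‖ / f x) L →
        ∀ ρ : StarShaped.Sph n → ℝ, StarShaped.IsPKConvex p k ρ →
          StarShaped.SolvesEq p k l b q f ρ →
          StarShaped.GradientBound C ρ) ∧
    -- the case `-b - q - k + l = 0`; the constant does not depend on `ε`
    (-b - q - k + l = 0 →
      ∀ n : ℕ, p ≤ n → k ≤ n.choose p →
      ∀ fmin fmax L : ℝ, ∃ C : ℝ,
        ∀ f : StarShaped.Sph n → ℝ, StarShaped.IsC2 f → (∀ x, 0 < f x) →
          IsLeast (Set.range f) fmin → IsGreatest (Set.range f) fmax →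
          IsGreatest (Set.range fun x => ‖StarShaped.sphGrad f x‖ / f x) L →
          (q ≠ 0 ∨ (q = 0 ∧ ∀ x, ‖StarShaped.sphGrad f x‖ / f x <
            2 * ((k : ℝ) - l) * √(((p : ℝ) - 1) / p))) →
        ∀ ε : ℝ, 0 < ε →
        ∀ ρ : StarShaped.Sph n → ℝ, StarShaped.IsPKConvex p k ρ →
          StarShaped.SolvesEq p k l (b - ε) q f ρ →
          StarShaped.GradientBound C ρ) := by
  refine ⟨fun hδ L => ⟨4 * max (L / (-b - q - k + l)) 0, ?_⟩, fun hδ n hpn hk fmin fmax L => ?_⟩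
  · intro n hpn _ f hfC hf hL ρ hρ h
    exact h.gradientBound hf hfC (le_trans hp hpn) hlk hρ hδ hL
  -- This constant is chosen before the exponent of |X|. With b - ε in place of b the coefficient of
  -- v is ε, which is admissible.
  · obtain ⟨C, hC⟩ := StarShaped.exists_gradientBound hp hlk hpn hk q fmin fmax L
    exact ⟨C, fun f hfC hf hmin hmax hL hq ε hε ρ hρ h =>
      hC f hfC hf hmin hmax hL hq (b - ε) ρ (by linarith) hρ h⟩
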